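/- \textbf{Conventions.} A \emph{curve} on a closed oriented smooth surface $\Sigma$ is a generic smooth immersion $\gamma\colon S^1\to\Sigma$ of the oriented circle: it has only finitely many self-intersections, all of them transversal double points (crossings). A \emph{regular neighborhood} of a curve is a narrow immersed band with core the curve, i.e. a neighborhood of $\gamma(S^1)$ that is the image of a continuous, locally injective map $S^1\times[-1,1]\to\Sigma$ which restricts to $\gamma$ on $S^1\times\{0\}$ and overlaps itself only in one square around each crossing, where the two strips cross each other. Two curves are \emph{stably homeomorphic} if there is an orientation-preserving homeomorphism between regular neighborhoods of them that maps the first curve onto the second one and preserves the orientation of the curves. A \emph{signed word} is a finite word in which each occurring letter occurs exactly twice, together with a sign $\pm$ for each letter; signed words are considered up to bijective renaming of the letters. \emph{Cyclic equivalence} $\sim$ of signed words is the equivalence relation generated by $A^{\pm}xA^{\pm}y\sim xA^{\mp}yA^{\mp}$ (and renaming). Given a curve, a base point on it that is not a crossing, and a labelling of the crossings by different letters, its signed word is obtained by moving along the curve once from the base point and writing down the labels of the crossings in the order in which they are met; a crossing has sign $-$ if the tangent vectors of its first and second passage, in this order, form a positively oriented basis, and sign $+$ otherwise. Let $\mathbb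 F$ be a field. A \emph{cyclic equivalence invariant} is a function $v$ from signed words to $\mathbb F$ that takes equal values on cyclically equivalent words. Its \emph{prolongation} $\tilde v$ to singular signed words (signed words some of whose letters are marked by $*$) is determined by $\tilde v=v$ on words without marked letters and $\tilde v(A^*xA^*y)=\tilde v(AxAy)-\tilde v(xy)$, this rule being applied to any marked letter $A^*$, wherever its two occurrences stand in the word. The invariant $v$ is a \emph{finite type invariant of order $n$} if $\tilde v$ vanishes on all singular words with more than $n$ marked letters, and a \emph{finite type invariant} if it is one of some order $n$. \textbf{Theorem.} Finite type invariants form a complete invariant for stable homeomorphism classes of curves on closed oriented surfaces. That is, let $\mathbb F$ be any field, let $\gamma$ and $\gamma'$ be curves on closed oriented smooth surfaces $\Sigma$ and $\Sigma'$, and let $w$ and $w'$ be signed words of $\gamma$ and $\gamma'$, for arbitrary choices of base points and labellings. Then $\gamma$ and $\gamma'$ are stably homeomorphic if and only if $v(w)=v(w')$ for every finite type invariant $v$ with values in $\mathbb F$. -/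

import Mathlib

open Set Filter Topology
open scoped Manifold ContDiff

/-! ### Signed words

Letters are natural numbers; since words are only considered up to renaming of letters, a countable
supply of letters is enough. -/

/-- A signed word: a finite sequence of letters with signs (`true` is `+`, `false` is `-`) in which
every letter that occurs does so exactly twice, both times with the same sign. -/
@[ext]
structure SignedWord where
  seq : List (ℕ × Bool)
  count_eq_two : ∀ p ∈ seq, seq.count p = 2 ∧ (seq.map Prod.fst).count p.1 = 2

namespace SignedWord

/-- The set of letters of a signed word. -/
def letters (w : SignedWord) : Finset ℕ := (w.seq.map Prod.fst).toFinset

/-- Two signed words are isomorphic if a bijective renaming of the letters carries one to the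
other, preserving the signs. -/
def Iso (w w' : SignedWord) : Prop :=
  ∃ f : ℕ → ℕ, InjOn f (w.letters : Set ℕ) ∧ w'.seq = w.seq.map (fun p => (f p.1, p.2))

/-- The elementary move `A^± x A^± y ↦ x A^∓ y A^∓`. -/
def CyclicMove (w w' : SignedWord) : Prop :=
  ∃ (a : ℕ) (s : Bool) (x y : List (ℕ × Bool)),
    w.seq = (a, s) :: (x ++ (a, s) :: y) ∧ w'.seq = x ++ (a, !s) :: (y ++ [(a, !s)])

/-- Cyclic equivalence of (isomorphism classes of) signed words: the equivalence relation generated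
by isomorphisms and the elementary moves. -/
def CyclicEquiv : SignedWord → SignedWord → Prop :=
  Relation.EqvGen fun w w' => w.Iso w' ∨ w.CyclicMove w'

/-- The sub-word obtained by eliminating all letters that lie in `R`. -/
def delete (w : SignedWord) (R : Finset ℕ) : SignedWord where
  seq := w.seq.filter (fun p => p.1 ∉ R)
  count_eq_two := by
    intro p hp
    rw [List.mem_filter] at hp
    have h := w.count_eq_two p hp.1
    refine ⟨(List.count_filter (p := fun p : ℕ × Bool => decide (p.1 ∉ R)) hp.2).trans h.1, ?_⟩
    have e : (w.seq.filter (fun p => decide (p.1 ∉ R))).map Prod.fst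
        = (w.seq.map Prod.fst).filter (fun a => decide (a ∉ R)) := by
      rw [List.filter_map]; rfl
    rw [e]
    exact (List.count_filter (p := fun a : ℕ => decide (a ∉ R)) (by simpa using hp.2)).trans h.2

theorem mem_letters_delete {w : SignedWord} {R : Finset ℕ} {a : ℕ} :
    a ∈ (w.delete R).letters ↔ a ∈ w.letters ∧ a ∉ R := by
  simp only [letters, delete, List.mem_toFinset, List.mem_map, List.mem_filter, decide_eq_true_eq]
  constructor
  · rintro ⟨p, ⟨h1, h2⟩, rfl⟩
    exact ⟨⟨p, h1, rfl⟩, h2⟩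
  · rintro ⟨⟨p, h1, rfl⟩, h2⟩
    exact ⟨p, ⟨h1, h2⟩, rfl⟩

theorem delete_empty (w : SignedWord) : w.delete ∅ = w := by
  ext1; simp [delete]

theorem delete_delete (w : SignedWord) (R S : Finset ℕ) :
    (w.delete R).delete S = w.delete (R ∪ S) := by
  ext1
  simp only [delete, List.filter_filter]
  congr 1
  funext p
  simp [Bool.and_comm]

end SignedWord

/-! ### Singular signed words and finite type invariants -/

/-- A singular signed word: a signed word some of whose letters are marked as singular. -/
structure SingularWord where
  word : SignedWord
  sing : Finset ℕ
  sing_subset : sing ⊆ word.letters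

namespace SingularWord

/-- A signed word, regarded as a singular word without singular letters. -/
def ofWord (w : SignedWord) : SingularWord := ⟨w, ∅, Finset.empty_subset _⟩

/-- Replace the singular letter `A^*` by the ordinary letter `A`. -/
def unmark (s : SingularWord) (a : ℕ) : SingularWord :=
  ⟨s.word, s.sing.erase a, (Finset.erase_subset _ _).trans s.sing_subset⟩

/-- Eliminate the singular letter `A^*`. -/
def remove (s : SingularWord) (a : ℕ) : SingularWord :=
  ⟨s.word.delete {a}, s.sing.erase a, fun b hb => by
    rw [Finset.mem_erase] at hb
    exact SignedWord.mem_letters_delete.2 ⟨s.sing_subset hb.2, by simpa using hb.1⟩⟩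

end SingularWord

/-- A cyclic equivalence invariant with values in `F`: a function on signed words that takes equal
values on cyclically equivalent signed words. -/
structure CyclicInvariant (F : Type*) where
  toFun : SignedWord → F
  eq_of_cyclicEquiv : ∀ w w', w.CyclicEquiv w' → toFun w = toFun w'

namespace CyclicInvariant

instance {F : Type*} : CoeFun (CyclicInvariant F) (fun _ => SignedWord → F) := ⟨toFun⟩

variable {F : Type*} [Field F]

/-- `V` is a prolongation of `v` to singular words: it extends `v`, and
`V(A^* x A^* y) = V(A x A y) - V(x y)` for every singular letter `A^*`. -/
structure IsProlongation (v : CyclicInvariant F) (V : SingularWord → F) : Prop where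
  extends_word : ∀ w, V (SingularWord.ofWord w) = v w
  skein : ∀ (s : SingularWord), ∀ a ∈ s.sing, V s = V (s.unmark a) - V (s.remove a)

/-- The prolongation of `v`, in closed form. By `isProlongation_prolongation` and
`IsProlongation.eq_prolongation` it is the unique function satisfying `IsProlongation v`. -/
def prolongation (v : CyclicInvariant F) (s : SingularWord) : F :=
  ∑ R ∈ s.sing.powerset, (-1 : F) ^ R.card * v (s.word.delete R)

theorem isProlongation_prolongation (v : CyclicInvariant F) :
    v.IsProlongation v.prolongation where
  extends_word w := by
    simp [prolongation, SingularWord.ofWord, SignedWord.delete_empty]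
  skein s a ha := by
    obtain ⟨w, S, hS⟩ := s
    simp only at ha
    simp only [prolongation, SingularWord.unmark, SingularWord.remove, SignedWord.delete_delete]
    conv_lhs => rw [← Finset.insert_erase ha]
    rw [Finset.sum_powerset_insert (Finset.notMem_erase a S), sub_eq_add_neg,
      ← Finset.sum_neg_distrib]
    congr 1
    refine Finset.sum_congr rfl fun R hR => ?_
    have haR : a ∉ R := fun h => Finset.notMem_erase a S (Finset.mem_powerset.1 hR h)
    rw [Finset.card_insert_of_notMem haR, ← Finset.insert_eq]
    ring

theorem IsProlongation.eq_prolongation {v : CyclicInvariant F} {V : SingularWord → F}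
    (hV : v.IsProlongation V) : V = v.prolongation := by
  have key : ∀ (n : ℕ) (s : SingularWord), s.sing.card = n → V s = v.prolongation s := by
    intro n
    induction n with
    | zero =>
      rintro ⟨w, S, hS⟩ h
      obtain rfl : S = ∅ := Finset.card_eq_zero.1 h
      exact (hV.extends_word w).trans (v.isProlongation_prolongation.extends_word w).symm
    | succ n ih =>
      intro s h
      obtain ⟨a, ha⟩ : s.sing.Nonempty := Finset.card_pos.1 (by omega)
      have hc : (s.sing.erase a).card = n := by rw [Finset.card_erase_of_mem ha]; omega
      rw [hV.skein s a ha, v.isProlongation_prolongation.skein s a ha, ih (s.unmark a) hc,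
        ih (s.remove a) hc]
  funext s
  exact key _ s rfl

/-- `v` is a finite type invariant of order `n`: its prolongation vanishes on all singular words
with more than `n` singular letters. -/
def IsFiniteTypeOfOrder (v : CyclicInvariant F) (n : ℕ) : Prop :=
  ∀ s : SingularWord, n < s.sing.card → v.prolongation s = 0

/-- `v` is a finite type invariant (of some order). -/
def IsFiniteType (v : CyclicInvariant F) : Prop := ∃ n, v.IsFiniteTypeOfOrder n

end CyclicInvariant

/-! ### Generic curves on oriented surfaces -/

/-- The coordinate plane. -/
abbrev Plane := EuclideanSpace ℝ (Fin 2)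

/-- The determinant of two plane vectors: positive iff `(u, v)` is a positively oriented basis. -/
def planeDet (u v : Plane) : ℝ := u 0 * v 1 - u 1 * v 0

/-- The unit vector of angle `t`. -/
noncomputable def unitVec (t : ℝ) : Plane := !₂[Real.cos t, Real.sin t]

/-- The given atlas of the surface `M` is oriented: all transition maps between its charts have
positive Jacobian. The surface is then oriented by its charts. -/
class OrientedSurface (M : Type*) [TopologicalSpace M] [ChartedSpace Plane M] : Prop where
  det_pos : ∀ e ∈ atlas Plane M, ∀ e' ∈ atlas Plane M, ∀ x ∈ (e.symm.trans e').source,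
    0 < (fderiv ℝ (e.symm.trans e') x).det

section Curves

variable {M : Type*} [TopologicalSpace M] [ChartedSpace Plane M]

/-- The velocity at time `t` of the curve `s ↦ f (exp (i s))`, read in the preferred chart of `M`
at the point `f (exp (i t))`. -/
noncomputable def curveVelocity (f : Circle → M) (t : ℝ) : Plane :=
  mfderiv 𝓘(ℝ, ℝ) (𝓡 2) (fun s : ℝ => f (Circle.exp s)) t (1 : ℝ)

/-- The points of the circle at which `f` is not injective. -/
def doubleParams (f : Circle → M) : Set Circle := {z | ∃ w, w ≠ z ∧ f w = f z}

variable (M) in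
/-- A curve on `M`: a generic smooth immersion of the oriented circle, i.e. one with finitely many
self-intersections, all of which are transversal double points. -/
structure GenericCurve where
  toFun : Circle → M
  contMDiff : ContMDiff (𝓡 1) (𝓡 2) ∞ toFun
  immersion : ∀ z, Function.Injective (mfderiv (𝓡 1) (𝓡 2) toFun z)
  finite_doubleParams : (doubleParams toFun).Finite
  no_triple : ∀ z w u, toFun z = toFun w → toFun w = toFun u → z = w ∨ w = u ∨ z = u
  transversal : ∀ s t : ℝ, Circle.exp s ≠ Circle.exp t →
    toFun (Circle.exp s) = toFun (Circle.exp t) →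
    planeDet (curveVelocity toFun s) (curveVelocity toFun t) ≠ 0

namespace GenericCurve

instance : CoeFun (GenericCurve M) (fun _ => Circle → M) := ⟨toFun⟩

/-- A base point `exp (i * base)` on the curve away from the crossings, together with a labelling
of the crossings by different letters. -/
structure Labelling (γ : GenericCurve M) where
  base : ℝ
  base_notMem : Circle.exp base ∉ doubleParams γ
  label : M → ℕ
  label_injOn : InjOn label (γ '' doubleParams γ)

theorem nonempty_labelling (γ : GenericCurve M) : Nonempty γ.Labelling := by
  classical
  have hinf : (univ : Set Circle).Infinite := by
    have h1 : (Ioo (0 : ℝ) 1).Infinite := Ioo_infinite one_pos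
    have h2 : InjOn Circle.exp (Ioo (0 : ℝ) 1) :=
      (Circle.exp_injOn_Icc (a := 0) (b := 1) (by nlinarith [Real.pi_gt_three])).mono
        Ioo_subset_Icc_self
    exact (h1.image h2).mono (subset_univ _)
  obtain ⟨z, -, hz⟩ := hinf.exists_notMem_finite γ.finite_doubleParams
  obtain ⟨t, rfl⟩ := Circle.exp_surjective z
  obtain ⟨f, hf⟩ := Set.countable_iff_exists_injOn.1 (γ.finite_doubleParams.image γ).countable
  exact ⟨⟨t, hz, f, hf⟩⟩

namespace Labelling

variable {γ : GenericCurve M} (P : γ.Labelling)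

/-- The time interval of one turn along the curve from the base point. -/
def turn : Set ℝ := Ioo P.base (P.base + 2 * Real.pi)

/-- The times of one turn at which the curve passes through a crossing. -/
def crossingTimes : Set ℝ := {t | t ∈ P.turn ∧ Circle.exp t ∈ doubleParams γ}

theorem injOn_exp_turn : InjOn Circle.exp P.turn :=
  (Circle.exp_injOn_Ico (a := P.base) (b := P.base + 2 * Real.pi) (by linarith)).mono
    Ioo_subset_Ico_self

theorem finite_crossingTimes : P.crossingTimes.Finite :=
  Set.Finite.of_finite_image
    (γ.finite_doubleParams.subset (by rintro _ ⟨t, ht, rfl⟩; exact ht.2))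
    (P.injOn_exp_turn.mono fun _ h => h.1)

/-- The crossing `x` is negative if the ordered pair of its first and second passages, counted from
the base point, is positively oriented: when both strands point upwards, the first passage runs
from the bottom left to the top right. -/
def IsNegative (x : M) : Prop :=
  ∃ t₁ ∈ P.turn, ∃ t₂ ∈ P.turn, t₁ < t₂ ∧ γ (Circle.exp t₁) = x ∧ γ (Circle.exp t₂) = x ∧
    0 < planeDet (curveVelocity γ t₁) (curveVelocity γ t₂)

open Classical in
/-- The letter with its sign that is written down at time `t`. -/
noncomputable def signedLetter (t : ℝ) : ℕ × Bool :=
  (P.label (γ (Circle.exp t)), !decide (P.IsNegative (γ (Circle.exp t))))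

/-- The signed letters written down, in the order of time, during one turn along the curve. -/
noncomputable def wordSeq : List (ℕ × Bool) :=
  (P.finite_crossingTimes.toFinset.sort (· ≤ ·)).map P.signedLetter

theorem exists_turn_of_doubleParam {z : Circle} (hz : z ∈ doubleParams γ) :
    ∃ t ∈ P.turn, Circle.exp t = z := by
  obtain ⟨s, rfl⟩ := Circle.exp_surjective z
  have hp := Real.two_pi_pos
  have h := toIcoMod_mem_Ico hp P.base s
  have he : Circle.exp (toIcoMod hp P.base s) = Circle.exp s := by
    rw [toIcoMod, zsmul_eq_mul]
    exact Circle.periodic_exp.sub_int_mul_eq _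
  refine ⟨toIcoMod hp P.base s, ⟨lt_of_le_of_ne h.1 fun h0 => ?_, h.2⟩, he⟩
  exact P.base_notMem (by rw [h0, he]; exact hz)

theorem exists_partner {t : ℝ} (ht : t ∈ P.crossingTimes) :
    ∃ u ∈ P.crossingTimes, u ≠ t ∧
      ∀ v ∈ P.crossingTimes, γ (Circle.exp v) = γ (Circle.exp t) ↔ v = t ∨ v = u := by
  obtain ⟨w, hw, hwt⟩ := ht.2
  have hwd : w ∈ doubleParams γ := ⟨Circle.exp t, hw.symm, hwt.symm⟩
  obtain ⟨u, hu, rfl⟩ := P.exists_turn_of_doubleParam hwd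
  refine ⟨u, ⟨hu, hwd⟩, fun h => hw (by rw [h]), fun v hv => ⟨fun h => ?_, ?_⟩⟩
  · rcases γ.no_triple _ _ _ h hwt.symm with h | h | h
    · exact Or.inl (P.injOn_exp_turn hv.1 ht.1 h)
    · exact absurd h.symm hw
    · exact Or.inr (P.injOn_exp_turn hv.1 hu h)
  · rintro (rfl | rfl)
    · rfl
    · exact hwt

theorem count_map_eq_two {β : Type*} [BEq β] [LawfulBEq β] (f : ℝ → β)
    (hf : ∀ t ∈ P.crossingTimes, ∀ v ∈ P.crossingTimes,
      f v = f t ↔ γ (Circle.exp v) = γ (Circle.exp t))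
    {t : ℝ} (ht : t ∈ P.crossingTimes) :
    ((P.finite_crossingTimes.toFinset.sort (· ≤ ·)).map f).count (f t) = 2 := by
  classical
  obtain ⟨u, hu, hut, hv⟩ := P.exists_partner ht
  set L := P.finite_crossingTimes.toFinset.sort (· ≤ ·) with hL
  have hmem : ∀ v, v ∈ L ↔ v ∈ P.crossingTimes := fun v => by simp [hL]
  have hnd : L.Nodup := Finset.sort_nodup _ _
  rw [List.count, List.countP_map, List.countP_eq_length_filter,
    ← List.toFinset_card_of_nodup (hnd.filter _)]
  have : (L.filter ((fun x => x == f t) ∘ f)).toFinset = {t, u} := by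
    ext v
    simp only [List.mem_toFinset, List.mem_filter, Function.comp, beq_iff_eq, Finset.mem_insert,
      Finset.mem_singleton, hmem]
    constructor
    · rintro ⟨h1, h2⟩
      exact (hv v h1).1 ((hf t ht v h1).1 h2)
    · intro h
      have h1 : v ∈ P.crossingTimes := by rcases h with rfl | rfl <;> assumption
      exact ⟨h1, (hf t ht v h1).2 ((hv v h1).2 h)⟩
  rw [this, Finset.card_pair hut.symm]

/-- The signed word of the pointed curve with the given labelling of its crossings. -/
noncomputable def word : SignedWord where
  seq := P.wordSeq
  count_eq_two := by
    intro p hp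
    obtain ⟨t, ht, rfl⟩ := List.mem_map.1 hp
    have ht' : t ∈ P.crossingTimes := by simpa using ht
    have hlab : ∀ t ∈ P.crossingTimes, ∀ v ∈ P.crossingTimes,
        P.label (γ (Circle.exp v)) = P.label (γ (Circle.exp t)) →
          γ (Circle.exp v) = γ (Circle.exp t) := fun t ht v hv h =>
      P.label_injOn (mem_image_of_mem _ hv.2) (mem_image_of_mem _ ht.2) h
    refine ⟨P.count_map_eq_two _ (fun t ht v hv => ⟨fun h => ?_, fun h => ?_⟩) ht', ?_⟩
    · exact hlab t ht v hv (congrArg Prod.fst h)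
    · unfold signedLetter; rw [h]
    · rw [wordSeq, List.map_map]
      exact P.count_map_eq_two (Prod.fst ∘ P.signedLetter)
        (fun t ht v hv => ⟨hlab t ht v hv, fun h => congrArg P.label h⟩) ht'

end Labelling
end GenericCurve

/-! ### Regular neighborhoods and stable homeomorphism -/

/-- The closed annulus `S¹ × [-1, 1]`. -/
def annulus : Set (Circle × ℝ) := univ ×ˢ Icc (-1) 1

/-- A narrow immersed band with core the closed curve `f`: a locally injective continuous map
`band : S¹ × [-1, 1] → M` that restricts to `f` on `S¹ × {0}` and overlaps itself only in one square
around each crossing. If `f z = f w` with `z ≠ w`, the overlap is given by gluing the squares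
`{z e^{iεa}} × {b}` and `{w e^{iεa'}} × {b'}`, `a, b, a', b' ∈ [-1, 1]`, by a rotation by a right
angle, `(a', b') = (σ b, -σ a)` with `σ = ±1`; so the core of each strand is a fiber of the other
one. -/
structure ImmersedBand (f : Circle → M) where
  band : Circle × ℝ → M
  continuousOn : ContinuousOn band annulus
  locallyInjective : ∀ p ∈ annulus, ∃ U ∈ 𝓝 p, InjOn band (U ∩ annulus)
  core : ∀ z, band (z, 0) = f z
  ε : ℝ
  ε_pos : 0 < ε
  ε_lt : ε < Real.pi
  σ : Circle → Circle → ℝ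
  σ_eq : ∀ z w, σ z w = 1 ∨ σ z w = -1
  disjoint_arcs : ∀ z ∈ doubleParams f, ∀ w ∈ doubleParams f, z ≠ w →
    ∀ a ∈ Icc (-1 : ℝ) 1, ∀ b ∈ Icc (-1 : ℝ) 1, z * Circle.exp (ε * a) ≠ w * Circle.exp (ε * b)
  overlap : ∀ p ∈ annulus, ∀ q ∈ annulus, band p = band q ↔ p = q ∨
    ∃ z w, z ≠ w ∧ f z = f w ∧ ∃ a ∈ Icc (-1 : ℝ) 1, ∃ b ∈ Icc (-1 : ℝ) 1,
      p = (z * Circle.exp (ε * a), b) ∧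
      q = (w * Circle.exp (ε * (σ z w * b)), -(σ z w * a))

/-- A regular neighborhood of the closed curve `f`: a neighborhood of the curve that is the image of
a narrow immersed band with core `f`. -/
def IsRegularNeighborhood (f : Circle → M) (N : Set M) : Prop :=
  (∀ z, N ∈ 𝓝 (f z)) ∧ ∃ B : ImmersedBand f, B.band '' annulus = N

/-- A map between subsets of oriented surfaces preserves the orientation if it has local degree `1`
at every interior point `x`: read in the charts around `x` and `h x`, the image of every
sufficiently small counterclockwise circle around `x` winds exactly once counterclockwise around
`h x`. The winding number is measured by a continuous choice `θ` of the angle. -/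
def PreservesOrientation {M' : Type*} [TopologicalSpace M'] [ChartedSpace Plane M']
    {N : Set M} {N' : Set M'} (h : N → N') : Prop :=
  ∀ x : N, (x : M) ∈ interior N → ∀ᶠ r : ℝ in 𝓝[>] 0,
    ∃ θ : ℝ → ℝ, Continuous θ ∧ θ (2 * Real.pi) = θ 0 + 2 * Real.pi ∧
      ∀ t ∈ Icc 0 (2 * Real.pi), ∃ y : N,
        (y : M) ∈ (chartAt Plane (x : M)).source ∧
        chartAt Plane (x : M) y = chartAt Plane (x : M) x + r • unitVec t ∧
        (h y : M') ∈ (chartAt Plane (h x : M')).source ∧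
        ∃ ρ > (0 : ℝ), chartAt Plane (h x : M') (h y) =
          chartAt Plane (h x : M') (h x) + ρ • unitVec (θ t)

/-- A map of the circle preserves the orientation if it lifts to a continuous monotone map of the
line. -/
def CirclePreservesOrientation (φ : Circle → Circle) : Prop :=
  ∃ g : ℝ → ℝ, Continuous g ∧ Monotone g ∧ ∀ t, φ (Circle.exp t) = Circle.exp (g t)

/-- Two curves are stably homeomorphic if there is an orientation preserving homeomorphism between
regular neighborhoods of them which maps the first curve onto the second one, preserving the
orientation of the curves. -/
def StablyHomeomorphic {M' : Type*} [TopologicalSpace M'] [ChartedSpace Plane M']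
    (γ : GenericCurve M) (δ : GenericCurve M') : Prop :=
  ∃ (N : Set M) (N' : Set M'), IsRegularNeighborhood γ N ∧ IsRegularNeighborhood δ N' ∧
    ∃ h : N ≃ₜ N', PreservesOrientation h ∧
      ∃ φ : Circle ≃ₜ Circle, CirclePreservesOrientation φ ∧
        ∀ (z : Circle) (y : N), (y : M) = γ z → (h y : M') = δ (φ z)

end Curves

/-! ### Cyclic equivalence of signed words -/

namespace SignedWord

/-! Both sides of the theorem are equivalent to cyclic equivalence of the two signed words.

Invariants. For a fixed word `c`, count the sub-words of `u` that are cyclically equivalent to `c`.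
Deleting letters is compatible with the elementary move, so the count is a cyclic equivalence
invariant (`subwordCount_eq_of_cyclicEquiv`). Its prolongation is an alternating sum over sets of
deleted marked letters; after exchanging the sums only those sub-words survive that retain every
marked letter, and if more letters are marked than `c` has, these are too long to be equivalent to
`c` (`isFiniteType_counting`). If `c` is the longer of two words, the count is 1 on `c` and 0 on the
other word unless the two are equivalent. Since 1 ≠ 0 in every field, the characteristic plays no
role.

Words of one curve. Moving the base point past one passage of a crossing reverses the order of its
two passages and hence its sign: this is the elementary move. So the words of a curve form exactly
one cyclic equivalence class (`cyclicEquiv_word`, `exists_word_eq_of_cyclicEquiv`).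

From a homeomorphism to words. A homeomorphism of neighborhoods carries base point and labels along;
only the signs need an argument, since it need not be differentiable. By hypothesis it sends small
circles around a crossing to loops of winding number one. Such a loop meets the image of the first
strand only at images of points of that strand. If the sign changed, the angle of the loop, in
coordinates that straighten the image strand, would be trapped in too short an interval
(`planeDet_pos_of_preservesOrientation`).

From words to a homeomorphism. Equal words give an increasing reparametrization that matches the
crossings and is a translation near them (`exists_matching`). Around each curve a band is built by
interpolating in charts; at a crossing it is the sum of the two strands in a chart, so that both
strands define the same square up to a quarter turn (`exists_isBandOn`, `eventually_eq`). By
compactness a thin band has no other overlaps (`exists_isBand`). The reparametrization, extended by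
the identity in the transversal direction, respects the gluing of the squares (`glued_iff`), so it
descends to a homeomorphism of the images. In band coordinates that map is increasing in each
variable and therefore keeps winding numbers (`winding_of_orientedAt`). -/

theorem mem_letters {w : SignedWord} {a : ℕ} : a ∈ w.letters ↔ ∃ s, (a, s) ∈ w.seq := by
  simp [letters]

theorem Iso.letters_eq {w w' : SignedWord} {f : ℕ → ℕ}
    (h : w'.seq = w.seq.map (fun p => (f p.1, p.2))) : w'.letters = w.letters.image f := by
  ext a
  simp only [letters, h, List.map_map, List.mem_toFinset, List.mem_map, Finset.mem_image,
    exists_exists_and_eq_and, Function.comp]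

theorem Iso.symm {w w' : SignedWord} (h : w.Iso w') : w'.Iso w := by
  obtain ⟨f, hf, he⟩ := h
  have hinv : ∀ a ∈ w.letters, Function.invFunOn f (w.letters : Set ℕ) (f a) = a := fun a ha =>
    hf.leftInvOn_invFunOn ha
  refine ⟨Function.invFunOn f (w.letters : Set ℕ), ?_, ?_⟩
  · rw [Iso.letters_eq he]
    intro a ha b hb hab
    simp only [Finset.coe_image, mem_image, Finset.mem_coe] at ha hb
    obtain ⟨a, ha, rfl⟩ := ha
    obtain ⟨b, hb, rfl⟩ := hb
    rw [hinv a ha, hinv b hb] at hab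
    rw [hab]
  · rw [he, List.map_map]
    symm
    conv_rhs => rw [← List.map_id w.seq]
    refine List.map_congr_left fun p hp => ?_
    have : p.1 ∈ w.letters := mem_letters.2 ⟨p.2, hp⟩
    simp [hinv _ this]

theorem CyclicMove.letters_eq {w w' : SignedWord} (h : w.CyclicMove w') :
    w'.letters = w.letters := by
  obtain ⟨a, s, x, y, h1, h2⟩ := h
  ext b
  simp only [letters, h1, h2]
  simp

theorem CyclicEquiv.card_letters_eq {w w' : SignedWord} (h : w.CyclicEquiv w') :
    w.letters.card = w'.letters.card := by
  induction h with
  | rel w w' h =>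
    rcases h with ⟨f, hf, he⟩ | h
    · rw [Iso.letters_eq he, Finset.card_image_of_injOn hf]
    · rw [h.letters_eq]
  | refl => rfl
  | symm _ _ _ ih => exact ih.symm
  | trans _ _ _ _ _ ih1 ih2 => exact ih1.trans ih2

theorem Iso.delete {w w' : SignedWord} {f : ℕ → ℕ} (hf : InjOn f (w.letters : Set ℕ))
    (he : w'.seq = w.seq.map (fun p => (f p.1, p.2))) {T : Finset ℕ} (hT : T ⊆ w.letters) :
    (w.delete T).Iso (w'.delete (T.image f)) := by
  refine ⟨f, hf.mono fun a ha => (mem_letters_delete.1 ha).1, ?_⟩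
  simp only [SignedWord.delete, he, List.filter_map]
  congr 1
  refine List.filter_congr fun p hp => ?_
  have hp1 : p.1 ∈ w.letters := mem_letters.2 ⟨p.2, hp⟩
  simp only [Function.comp, Finset.mem_image, decide_eq_decide]
  refine not_congr ⟨?_, fun h => ⟨p.1, h, rfl⟩⟩
  rintro ⟨b, hb, hbp⟩
  rwa [← hf (hT hb) hp1 hbp]

/-- If the moved letter is deleted, the two words become equal; otherwise the same move applies to
the filtered pieces `x` and `y`. -/
theorem CyclicMove.delete {w w' : SignedWord} (h : w.CyclicMove w') (T : Finset ℕ) :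
    (w.delete T).CyclicEquiv (w'.delete T) := by
  obtain ⟨a, s, x, y, h1, h2⟩ := h
  by_cases ha : a ∈ T
  · have : w.delete T = w'.delete T := by
      ext1
      simp [SignedWord.delete, h1, h2, ha]
    rw [this]
    exact Relation.EqvGen.refl _
  · refine Relation.EqvGen.rel _ _ (Or.inr ⟨a, s, x.filter (fun p => decide (p.1 ∉ T)),
      y.filter (fun p => decide (p.1 ∉ T)), ?_, ?_⟩)
    · simp [SignedWord.delete, h1, ha]
    · simp [SignedWord.delete, h2, ha]

end SignedWord

/-! ### Counting sub-words -/

namespace CyclicInvariant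

open SignedWord

variable (F : Type*) [Field F]

open Classical in
/-- The number of sub-words of `u` that are cyclically equivalent to `c`. -/
noncomputable def subwordCount (c u : SignedWord) : F :=
  ∑ T ∈ u.letters.powerset, if (u.delete T).CyclicEquiv c then 1 else 0

/-- For each generator the sets of deleted letters correspond bijectively, by the renaming or by the
identity, and corresponding sub-words are cyclically equivalent. -/
theorem subwordCount_eq_of_cyclicEquiv (c : SignedWord) {u u' : SignedWord}
    (h : u.CyclicEquiv u') : subwordCount F c u = subwordCount F c u' := by
  classical
  have key : ∀ {w w' : SignedWord}, w.CyclicEquiv w' → (w.CyclicEquiv c ↔ w'.CyclicEquiv c) :=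
    fun h => ⟨fun h' => (Relation.EqvGen.symm _ _ h).trans _ _ _ h', fun h' => h.trans _ _ _ h'⟩
  induction h with
  | rel w w' h =>
    rcases h with ⟨f, hf, he⟩ | h
    · unfold subwordCount
      rw [Iso.letters_eq he]
      refine Finset.sum_bij (fun T _ => T.image f) ?_ ?_ ?_ ?_
      · intro T hT
        exact Finset.mem_powerset.2 (Finset.image_subset_image (Finset.mem_powerset.1 hT))
      · intro T hT S hS hTS
        have hT' := Finset.mem_powerset.1 hT
        have hS' := Finset.mem_powerset.1 hS
        have := congrArg (fun X : Finset ℕ => (X : Set ℕ)) hTS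
        simp only [Finset.coe_image] at this
        exact_mod_cast (hf.image_eq_image_iff (by exact_mod_cast hT') (by exact_mod_cast hS')).1
          this
      · intro T hT
        obtain ⟨S, hS, rfl⟩ := Finset.subset_image_iff.1 (Finset.mem_powerset.1 hT)
        exact ⟨S, Finset.mem_powerset.2 (by exact_mod_cast hS), rfl⟩
      · intro T hT
        rw [if_congr (key (Relation.EqvGen.rel _ _ (Or.inl
          (Iso.delete hf he (Finset.mem_powerset.1 hT))))) rfl rfl]
    · unfold subwordCount
      rw [h.letters_eq]
      exact Finset.sum_congr rfl fun T _ => if_congr (key (h.delete T)) rfl rfl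
  | refl => rfl
  | symm _ _ _ ih => exact ih.symm
  | trans _ _ _ _ _ ih1 ih2 => exact ih1.trans ih2

/-- Counting sub-words, as a cyclic equivalence invariant. -/
noncomputable def counting (c : SignedWord) : CyclicInvariant F :=
  ⟨subwordCount F c, fun _ _ h => subwordCount_eq_of_cyclicEquiv F c h⟩

/-- Sub-words of a sub-word are indexed here by the full set of letters deleted from `u`. With one
index set for all `R`, the sums in the prolongation can be exchanged. -/
theorem subwordCount_delete (c u : SignedWord) {R : Finset ℕ} (hR : R ⊆ u.letters) [∀ T, Decidable
    ((u.delete T).CyclicEquiv c)] :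
    subwordCount F c (u.delete R) =
      ∑ T ∈ u.letters.powerset with R ⊆ T, if (u.delete T).CyclicEquiv c then 1 else 0 := by
  unfold subwordCount
  refine Finset.sum_bij (fun T _ => R ∪ T) ?_ ?_ ?_ ?_
  · intro T hT
    simp only [Finset.mem_filter, Finset.mem_powerset] at hT ⊢
    exact ⟨Finset.union_subset hR fun a ha => (mem_letters_delete.1 (hT ha)).1,
      Finset.subset_union_left⟩
  · intro T hT S hS hTS
    simp only [Finset.mem_powerset] at hT hS
    have hd : ∀ X ⊆ (u.delete R).letters, (R ∪ X) \ R = X := by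
      intro X hX
      rw [Finset.union_sdiff_left, Finset.sdiff_eq_self_iff_disjoint, Finset.disjoint_left]
      exact fun a ha => (mem_letters_delete.1 (hX ha)).2
    rw [← hd T hT, ← hd S hS, hTS]
  · intro T hT
    simp only [Finset.mem_filter, Finset.mem_powerset] at hT
    refine ⟨T \ R, ?_, Finset.union_sdiff_of_subset hT.2⟩
    refine Finset.mem_powerset.2 fun a ha => mem_letters_delete.2 ?_
    rw [Finset.mem_sdiff] at ha
    exact ⟨hT.1 ha.1, ha.2⟩
  · intro T _
    rw [delete_delete]
    congr

/-- The sub-word with deleted set `T` is counted with the coefficient `∑ (-1)^|R|` over `R ⊆ S ∩ T`.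
This vanishes unless `T` avoids the marked set `S`, and then the sub-word still has all letters of
`S`, more than `c` has. -/
theorem isFiniteType_counting (c : SignedWord) : (counting F c).IsFiniteType := by
  classical
  refine ⟨c.letters.card, fun s hs => ?_⟩
  obtain ⟨w, S, hS⟩ := s
  simp only at hs
  simp only [prolongation, counting]
  have h1 : ∀ R ∈ S.powerset, (-1 : F) ^ R.card * subwordCount F c (w.delete R)
      = ∑ T ∈ w.letters.powerset, if R ⊆ T then
          (-1 : F) ^ R.card * (if (w.delete T).CyclicEquiv c then 1 else 0) else 0 := by
    intro R hR
    rw [subwordCount_delete F c w ((Finset.mem_powerset.1 hR).trans hS), Finset.mul_sum,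
      Finset.sum_filter]
  rw [Finset.sum_congr rfl h1, Finset.sum_comm]
  refine Finset.sum_eq_zero fun T hT => ?_
  rw [← Finset.sum_filter, ← Finset.sum_mul]
  by_cases hd : Disjoint S T
  · rw [if_neg, mul_zero]
    intro h
    refine absurd h.card_letters_eq (ne_of_gt (hs.trans_le (Finset.card_le_card ?_)))
    exact fun a ha => mem_letters_delete.2 ⟨hS ha, Finset.disjoint_left.1 hd ha⟩
  · have : S.powerset.filter (fun R => R ⊆ T) = (S ∩ T).powerset := by
      ext R
      simp only [Finset.mem_filter, Finset.mem_powerset, Finset.subset_inter_iff]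
    rw [this]
    have h0 := @Finset.sum_powerset_neg_one_pow_card _ _ (S ∩ T)
    rw [if_neg (by rwa [← Finset.disjoint_iff_inter_eq_empty])] at h0
    have h2 := congrArg (Int.cast : ℤ → F) h0
    push_cast at h2
    rw [h2, zero_mul]

/-- Cyclic equivalence preserves the number of letters, so a word with at most as many letters as
`w` can contain `w` only with nothing deleted. The two counts are therefore 1 or 0. -/
theorem cyclicEquiv_of_subwordCount_eq {w w' : SignedWord}
    (hc : w'.letters.card ≤ w.letters.card)
    (h : subwordCount F w w = subwordCount F w w') : w'.CyclicEquiv w := by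
  classical
  have hcard : ∀ (u : SignedWord) (T : Finset ℕ), T ⊆ u.letters → u.letters.card ≤ w.letters.card →
      (u.delete T).CyclicEquiv w → T = ∅ := by
    intro u T hT hu hTw
    have h1 := hTw.card_letters_eq
    have h2 : (u.delete T).letters = u.letters \ T := by
      ext a
      simp [mem_letters_delete]
    rw [h2] at h1
    have h3 := Finset.card_sdiff_add_card_eq_card hT
    exact Finset.card_eq_zero.1 (by omega)
  have h1 : subwordCount F w w = 1 := by
    unfold subwordCount
    rw [Finset.sum_eq_single ∅, delete_empty, if_pos (show w.CyclicEquiv w from Relation.EqvGen.refl _)]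
    · intro T hT hne
      rw [if_neg fun h => hne (hcard w T (Finset.mem_powerset.1 hT) le_rfl h)]
    · simp
  by_contra hne
  have h0 : subwordCount F w w' = 0 := by
    unfold subwordCount
    refine Finset.sum_eq_zero fun T hT => if_neg fun hTw => hne ?_
    obtain rfl := hcard w' T (Finset.mem_powerset.1 hT) hc hTw
    rwa [delete_empty] at hTw
  rw [h1, h0] at h
  exact one_ne_zero h

/-- Finite type invariants separate signed words up to cyclic equivalence. -/
theorem cyclicEquiv_iff_forall_isFiniteType {w w' : SignedWord} :
    w.CyclicEquiv w' ↔ ∀ v : CyclicInvariant F, v.IsFiniteType → v w = v w' := by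
  refine ⟨fun h v _ => v.eq_of_cyclicEquiv _ _ h, fun h => ?_⟩
  rcases le_total w'.letters.card w.letters.card with hc | hc
  · exact Relation.EqvGen.symm _ _
      (cyclicEquiv_of_subwordCount_eq F hc (h _ (isFiniteType_counting F w)))
  · exact cyclicEquiv_of_subwordCount_eq F hc (h _ (isFiniteType_counting F w')).symm

end CyclicInvariant

/-! ### Sorted lists -/

theorem Finset.sort_eq_of_pairwise_lt {S : Finset ℝ} {l : List ℝ} (hl : l.Pairwise (· < ·))
    (h : ∀ x, x ∈ l ↔ x ∈ S) : S.sort (· ≤ ·) = l := by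
  refine List.Perm.eq_of_pairwise (le := (· ≤ ·)) (fun a b _ _ h1 h2 => le_antisymm h1 h2)
    (Finset.pairwise_sort _ _) (hl.imp le_of_lt) ?_
  refine (List.perm_ext_iff_of_nodup (Finset.sort_nodup _ _) (hl.imp ne_of_lt)).2 fun x => ?_
  rw [Finset.mem_sort, h]

theorem Finset.sort_pairwise_lt (S : Finset ℝ) : (S.sort (· ≤ ·)).Pairwise (· < ·) :=
  (Finset.sortedLT_sort S).pairwise

/-! ### The angle parameter of the circle -/

theorem Circle.exp_add_int_mul (t : ℝ) (k : ℤ) :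
    Circle.exp (t + k * (2 * Real.pi)) = Circle.exp t :=
  Circle.periodic_exp.int_mul k t

/-! ### Velocities -/

section Curves

variable {M : Type*} [TopologicalSpace M] [ChartedSpace Plane M]

theorem planeDet_swap (u v : Plane) : planeDet v u = -planeDet u v := by
  simp only [planeDet]; ring

namespace GenericCurve

theorem contMDiff_comp_exp (γ : GenericCurve M) :
    ContMDiff 𝓘(ℝ, ℝ) (𝓡 2) ∞ (fun s : ℝ => γ (Circle.exp s)) :=
  γ.contMDiff.comp contMDiff_circleExp

theorem curveVelocity_eq_deriv (γ : GenericCurve M) (t : ℝ) :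
    curveVelocity γ t = deriv (fun s : ℝ => chartAt Plane (γ (Circle.exp t)) (γ (Circle.exp s))) t := by
  have hd : MDifferentiableAt 𝓘(ℝ, ℝ) (𝓡 2) (fun s : ℝ => γ (Circle.exp s)) t :=
    (γ.contMDiff_comp_exp t).mdifferentiableAt (by simp)
  rw [curveVelocity, hd.mfderiv, ← fderiv_apply_one_eq_deriv, ← fderivWithin_univ]
  simp only [writtenInExtChartAt, modelWithCornersSelf_coe, range_id]
  rfl

theorem curveVelocity_congr (γ : GenericCurve M) {s t : ℝ} (h : Circle.exp s = Circle.exp t) :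
    curveVelocity γ s = curveVelocity γ t := by
  obtain ⟨k, hk⟩ := Circle.exp_eq_exp.1 h
  rw [curveVelocity_eq_deriv, curveVelocity_eq_deriv, h, hk]
  have := deriv_comp_add_const (fun s : ℝ => chartAt Plane (γ (Circle.exp t)) (γ (Circle.exp s)))
    (k * (2 * Real.pi)) t
  rw [← this]
  simp only [Circle.exp_add_int_mul]

/-! ### Signed letters and moving the base point -/

namespace Labelling

variable {γ : GenericCurve M}

/-- The negativity of a crossing, in terms of its two passages. -/
theorem isNegative_iff (P : γ.Labelling) {t u : ℝ} (ht : t ∈ P.turn) (hu : u ∈ P.turn)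
    (htu : t < u) (h : γ (Circle.exp t) = γ (Circle.exp u)) :
    P.IsNegative (γ (Circle.exp t)) ↔ 0 < planeDet (curveVelocity γ t) (curveVelocity γ u) := by
  refine ⟨?_, fun hd => ⟨t, ht, u, hu, htu, rfl, h.symm, hd⟩⟩
  rintro ⟨t₁, h₁, t₂, h₂, h12, e1, e2, hd⟩
  -- Without triple points there is only one increasing pair of times over the crossing, so the
  -- witnesses of negativity are `t` and `u`.
  have htrip : ∀ a ∈ P.turn, ∀ b ∈ P.turn, ∀ c ∈ P.turn, a < b → b < c →
      γ (Circle.exp a) = γ (Circle.exp b) → γ (Circle.exp b) = γ (Circle.exp c) → False := by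
    intro a ha b hb c hc hab hbc e e'
    rcases γ.no_triple _ _ _ e e' with h | h | h
    · exact hab.ne (P.injOn_exp_turn ha hb h)
    · exact hbc.ne (P.injOn_exp_turn hb hc h)
    · exact (hab.trans hbc).ne (P.injOn_exp_turn ha hc h)
  have ht1 : t₁ = t := by
    rcases lt_trichotomy t₁ t with h' | h' | h'
    · exact (htrip _ h₁ _ ht _ hu h' htu e1 h).elim
    · exact h'
    · exact (htrip _ ht _ h₁ _ h₂ h' h12 e1.symm (e1.trans e2.symm)).elim
  subst ht1
  have ht2 : t₂ = u := by
    rcases lt_trichotomy t₂ u with h' | h' | h'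
    · exact (htrip _ ht _ h₂ _ hu h12 h' e2.symm (e2.trans h)).elim
    · exact h'
    · exact (htrip _ ht _ hu _ h₂ htu h' h (h.symm.trans e2.symm)).elim
  rwa [← ht2]

theorem exp_ne_of_mem_turn (P : γ.Labelling) {t u : ℝ} (ht : t ∈ P.turn) (hu : u ∈ P.turn)
    (htu : t ≠ u) : Circle.exp t ≠ Circle.exp u :=
  fun h => htu (P.injOn_exp_turn ht hu h)

theorem word_eq_of_strictMonoOn {M' : Type*} [TopologicalSpace M'] [ChartedSpace Plane M']
    {δ : GenericCurve M'} (P : γ.Labelling) (Q : δ.Labelling) (g : ℝ → ℝ)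
    (hg : StrictMonoOn g P.crossingTimes) (himg : g '' P.crossingTimes = Q.crossingTimes)
    (hl : ∀ t ∈ P.crossingTimes, Q.signedLetter (g t) = P.signedLetter t) : P.word = Q.word := by
  ext1
  change P.wordSeq = Q.wordSeq
  unfold wordSeq
  have hmem : ∀ t ∈ P.finite_crossingTimes.toFinset.sort (· ≤ ·), t ∈ P.crossingTimes :=
    fun t ht => by simpa using ht
  have : Q.finite_crossingTimes.toFinset.sort (· ≤ ·)
      = (P.finite_crossingTimes.toFinset.sort (· ≤ ·)).map g := by
    refine Finset.sort_eq_of_pairwise_lt ?_ fun x => ?_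
    · rw [List.pairwise_map]
      exact (Finset.sort_pairwise_lt _).imp_of_mem
        fun {a b} ha hb hab => hg (hmem a ha) (hmem b hb) hab
    · simp [← himg]
  rw [this, List.map_map]
  exact List.map_congr_left fun t ht => (hl t (hmem t ht)).symm

theorem signedLetter_eq_of_iff {M' : Type*} [TopologicalSpace M'] [ChartedSpace Plane M']
    {δ : GenericCurve M'} (P : γ.Labelling) (Q : δ.Labelling) {t u : ℝ}
    (hl : Q.label (δ (Circle.exp u)) = P.label (γ (Circle.exp t)))
    (hn : P.IsNegative (γ (Circle.exp t)) ↔ Q.IsNegative (δ (Circle.exp u))) :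
    Q.signedLetter u = P.signedLetter t :=
  Prod.ext hl (congrArg (fun b : Bool => !b) (decide_eq_decide.2 hn.symm))

theorem signedLetter_eq_of_iff_not (P Q : γ.Labelling) {t u : ℝ}
    (hl : Q.label (γ (Circle.exp u)) = P.label (γ (Circle.exp t)))
    (hn : Q.IsNegative (γ (Circle.exp u)) ↔ ¬ P.IsNegative (γ (Circle.exp t))) :
    Q.signedLetter u = ((P.signedLetter t).1, !(P.signedLetter t).2) := by
  classical
  refine Prod.ext hl (congrArg (fun b : Bool => !b) ?_)
  by_cases h : P.IsNegative (γ (Circle.exp t)) <;> simp [signedLetter, h, hn]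

/-- Transport of signed letters: if the passages through crossings correspond, respecting the order
and the sign of the determinant of the velocities, then so do the letters. -/
theorem signedLetter_eq_of_correspond {M' : Type*} [TopologicalSpace M'] [ChartedSpace Plane M']
    {δ : GenericCurve M'} (P : γ.Labelling) (Q : δ.Labelling) (g : ℝ → ℝ)
    (hg : StrictMonoOn g P.crossingTimes)
    (himg : ∀ t ∈ P.crossingTimes, g t ∈ Q.turn)
    (hγ : ∀ t ∈ P.crossingTimes, ∀ u ∈ P.crossingTimes, γ (Circle.exp t) = γ (Circle.exp u) →
      δ (Circle.exp (g t)) = δ (Circle.exp (g u)))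
    (hdet : ∀ t ∈ P.crossingTimes, ∀ u ∈ P.crossingTimes, γ (Circle.exp t) = γ (Circle.exp u) →
      t < u → (0 < planeDet (curveVelocity γ t) (curveVelocity γ u) ↔
        0 < planeDet (curveVelocity δ (g t)) (curveVelocity δ (g u))))
    (hlab : ∀ t ∈ P.crossingTimes, Q.label (δ (Circle.exp (g t))) = P.label (γ (Circle.exp t))) :
    ∀ t ∈ P.crossingTimes, Q.signedLetter (g t) = P.signedLetter t := by
  have key : ∀ t ∈ P.crossingTimes, ∀ u ∈ P.crossingTimes, γ (Circle.exp t) = γ (Circle.exp u) →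
      t < u → (P.IsNegative (γ (Circle.exp t)) ↔ Q.IsNegative (δ (Circle.exp (g t)))) := by
    intro t ht u hu h htu
    rw [P.isNegative_iff ht.1 hu.1 htu h,
      Q.isNegative_iff (himg t ht) (himg u hu) (hg ht hu htu) (hγ t ht u hu h)]
    exact hdet t ht u hu h htu
  intro t ht
  obtain ⟨u, hu, hut, hp⟩ := P.exists_partner ht
  have hγu : γ (Circle.exp u) = γ (Circle.exp t) := (hp u hu).2 (Or.inr rfl)
  have hneg : P.IsNegative (γ (Circle.exp t)) ↔ Q.IsNegative (δ (Circle.exp (g t))) := by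
    rcases lt_or_gt_of_ne hut with h | h
    · rw [← hγu, ← hγ u hu t ht hγu]
      exact key u hu t ht hγu h
    · exact key t ht u hu hγu.symm h
  exact P.signedLetter_eq_of_iff Q (hlab t ht) hneg

/-- The same labelling with another base point. -/
def rebase (P : γ.Labelling) (b : ℝ) (hb : Circle.exp b ∉ doubleParams γ) : γ.Labelling :=
  ⟨b, hb, P.label, P.label_injOn⟩

theorem word_eq_of_forall_notMem (P P' : γ.Labelling) (hlab : P'.label = P.label)
    (hb : P.base ≤ P'.base) (h : ∀ t ∈ Icc P.base P'.base, Circle.exp t ∉ doubleParams γ) :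
    P.word = P'.word := by
  have hP : P.crossingTimes = P'.crossingTimes := by
    ext t
    refine ⟨fun ht => ⟨⟨?_, ht.1.2.trans_le (by linarith)⟩, ht.2⟩,
      fun ht => ⟨⟨hb.trans_lt ht.1.1, ?_⟩, ht.2⟩⟩
    · by_contra hc
      exact h t ⟨ht.1.1.le, not_lt.1 hc⟩ ht.2
    · by_contra hc
      -- A passage gained at the end of the new turn would, one turn earlier, lie between the two
      -- base points.
      refine h (t - 2 * Real.pi) ⟨by linarith, by linarith [ht.1.2]⟩ ?_
      rw [← Circle.exp_add_two_pi, sub_add_cancel]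
      exact ht.2
  refine word_eq_of_strictMonoOn P P' id (strictMonoOn_id) (by simpa using hP) ?_
  refine signedLetter_eq_of_correspond P P' id strictMonoOn_id (fun t ht => (hP ▸ ht).1)
    (fun _ _ _ _ h => h) (fun _ _ _ _ _ _ => Iff.rfl) (fun t _ => by rw [hlab]; rfl)

theorem word_eq_of_base_eq_add_int_mul (P P' : γ.Labelling) (hlab : P'.label = P.label) (k : ℤ)
    (hb : P'.base = P.base + k * (2 * Real.pi)) : P.word = P'.word := by
  have hmono : StrictMono (fun t : ℝ => t + k * (2 * Real.pi)) := fun a b h => by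
    simpa using h
  have himg : (fun t : ℝ => t + k * (2 * Real.pi)) '' P.crossingTimes = P'.crossingTimes := by
    ext t
    simp only [mem_image]
    constructor
    · rintro ⟨t, ht, rfl⟩
      refine ⟨⟨by rw [hb]; linarith [ht.1.1], by rw [hb]; linarith [ht.1.2]⟩, ?_⟩
      rw [Circle.exp_add_int_mul]; exact ht.2
    · intro ht
      have h1 := ht.1.1
      have h2 := ht.1.2
      rw [hb] at h1 h2
      refine ⟨t - k * (2 * Real.pi), ⟨⟨by linarith, by linarith⟩, ?_⟩, by ring⟩
      rw [← Circle.exp_add_int_mul _ k, sub_add_cancel]; exact ht.2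
  refine word_eq_of_strictMonoOn P P' _ (hmono.strictMonoOn _) himg ?_
  refine signedLetter_eq_of_correspond P P' _ (hmono.strictMonoOn _)
    (fun t ht => (himg ▸ mem_image_of_mem _ ht).1) ?_ ?_ ?_
  · intro t _ u _ h
    simpa only [Circle.exp_add_int_mul] using h
  · intro t _ u _ _ _
    rw [γ.curveVelocity_congr (Circle.exp_add_int_mul t k),
      γ.curveVelocity_congr (Circle.exp_add_int_mul u k)]
  · intro t _
    simp only [Circle.exp_add_int_mul, hlab]

/-- Moving the base point past one passage of a crossing is the elementary move. -/
theorem cyclicMove_of_existsUnique (P P' : γ.Labelling) (hlab : P'.label = P.label)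
    (hb : P'.base < P.base + 2 * Real.pi) {t₁ : ℝ} (ht₁ : t₁ ∈ Ioo P.base P'.base)
    (hd : Circle.exp t₁ ∈ doubleParams γ)
    (huniq : ∀ t ∈ Ioo P.base P'.base, Circle.exp t ∈ doubleParams γ → t = t₁) :
    P.word.CyclicMove P'.word := by
  have hpi := Real.two_pi_pos
  have hbb : P.base < P'.base := ht₁.1.trans ht₁.2
  set S : Finset ℝ := P.finite_crossingTimes.toFinset.erase t₁ with hS
  have hSmem : ∀ t, t ∈ S ↔ Circle.exp t ∈ doubleParams γ ∧ P'.base < t ∧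
      t < P.base + 2 * Real.pi := by
    intro t
    simp only [hS, Finset.mem_erase, Set.Finite.mem_toFinset]
    constructor
    · rintro ⟨h1, h2⟩
      refine ⟨h2.2, ?_, h2.1.2⟩
      by_contra hc
      rcases (not_lt.1 hc).eq_or_lt with h | h
      · exact P'.base_notMem (h ▸ h2.2)
      · exact h1 (huniq t ⟨h2.1.1, h⟩ h2.2)
    · rintro ⟨h1, h2, h3⟩
      exact ⟨fun h => by linarith [ht₁.2], ⟨hbb.trans h2, h3⟩, h1⟩
  set L := S.sort (· ≤ ·) with hL
  have hLmem : ∀ t, t ∈ L ↔ Circle.exp t ∈ doubleParams γ ∧ P'.base < t ∧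
      t < P.base + 2 * Real.pi := fun t => by rw [← hSmem, hL, Finset.mem_sort]
  have hLs : L.Pairwise (· < ·) := Finset.sort_pairwise_lt S
  have h1c : t₁ ∈ P.crossingTimes := ⟨⟨ht₁.1, ht₁.2.trans hb⟩, hd⟩
  -- The passage at `t₁` is the first one seen from the old base point; from the new one it is the
  -- last, at time `t₁ + 2π`. All other times are unchanged.
  have hPL : P.finite_crossingTimes.toFinset.sort (· ≤ ·) = t₁ :: L := by
    refine Finset.sort_eq_of_pairwise_lt ?_ fun x => ?_
    · refine List.pairwise_cons.2 ⟨fun t ht => ?_, hLs⟩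
      exact ht₁.2.trans ((hLmem t).1 ht).2.1
    · rw [List.mem_cons, hL, Finset.mem_sort, hS, Finset.mem_erase]
      by_cases hx : x = t₁
      · simp [hx, h1c]
      · simp [hx]
  have hexp : Circle.exp (t₁ + 2 * Real.pi) = Circle.exp t₁ := Circle.exp_add_two_pi t₁
  have hP'L : P'.finite_crossingTimes.toFinset.sort (· ≤ ·) = L ++ [t₁ + 2 * Real.pi] := by
    refine Finset.sort_eq_of_pairwise_lt ?_ fun x => ?_
    · refine List.pairwise_append.2 ⟨hLs, List.pairwise_singleton _ _, fun t ht u hu => ?_⟩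
      rw [List.mem_singleton.1 hu]
      linarith [((hLmem t).1 ht).2.2, ht₁.1]
    · rw [List.mem_append, hLmem, List.mem_singleton, Set.Finite.mem_toFinset]
      constructor
      · rintro (h | rfl)
        · exact ⟨⟨h.2.1, by linarith⟩, h.1⟩
        · exact ⟨⟨by linarith [ht₁.1], by linarith [ht₁.2]⟩, by rw [hexp]; exact hd⟩
      · intro h
        by_cases hx : x < P.base + 2 * Real.pi
        · exact Or.inl ⟨h.2, h.1.1, hx⟩
        · refine Or.inr ?_
          have hx' : Circle.exp (x - 2 * Real.pi) ∈ doubleParams γ := by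
            rw [← Circle.exp_add_two_pi, sub_add_cancel]; exact h.2
          rcases (not_lt.1 hx).eq_or_lt with h' | h'
          · refine absurd h.2 ?_
            rw [← h', Circle.exp_add_two_pi]
            exact P.base_notMem
          · have := huniq (x - 2 * Real.pi) ⟨by linarith, by linarith [h.1.2]⟩ hx'
            linarith
  obtain ⟨u, huc, hut, hp⟩ := P.exists_partner h1c
  have hγu : γ (Circle.exp u) = γ (Circle.exp t₁) := (hp u huc).2 (Or.inr rfl)
  have huS : u ∈ S := by simp [hS, hut, huc]
  have huL : u ∈ L := by rw [hL, Finset.mem_sort]; exact huS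
  obtain ⟨X, Y, hXY⟩ := List.append_of_mem huL
  have huP : u ∈ P.turn := huc.1
  have huP' : u ∈ P'.turn := ⟨((hLmem u).1 huL).2.1, by linarith [((hLmem u).1 huL).2.2]⟩
  have htP' : t₁ + 2 * Real.pi ∈ P'.turn := ⟨by linarith [ht₁.1], by linarith [ht₁.2]⟩
  have htu : t₁ < u := ht₁.2.trans huP'.1
  have hut' : u < t₁ + 2 * Real.pi := by linarith [huP.2, ht₁.1]
  -- Both passages of any other crossing occur at the same times in both turns, hence in the same
  -- order.
  have hsame : ∀ v ∈ L, v ≠ u → P'.signedLetter v = P.signedLetter v := by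
    intro v hv hvu
    have hmem : ∀ v ∈ L, v ∈ P.turn ∧ v ∈ P'.turn := fun v hv =>
      ⟨⟨hbb.trans ((hLmem v).1 hv).2.1, ((hLmem v).1 hv).2.2⟩,
        ((hLmem v).1 hv).2.1, by linarith [((hLmem v).1 hv).2.2]⟩
    have hneg : ∀ v ∈ L, ∀ v' ∈ L, v < v' → γ (Circle.exp v) = γ (Circle.exp v') →
        (P.IsNegative (γ (Circle.exp v)) ↔ P'.IsNegative (γ (Circle.exp v))) := by
      intro v hv v' hv' hvv h
      rw [P.isNegative_iff (hmem v hv).1 (hmem v' hv').1 hvv h,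
        P'.isNegative_iff (hmem v hv).2 (hmem v' hv').2 hvv h]
    have hvc : v ∈ P.crossingTimes := ⟨(hmem v hv).1, ((hLmem v).1 hv).1⟩
    have hvt : v ≠ t₁ := fun h => by
      have := ((hLmem v).1 hv).2.1
      linarith [ht₁.2]
    obtain ⟨v', hv', hne, hp'⟩ := P.exists_partner hvc
    have hγv : γ (Circle.exp v') = γ (Circle.exp v) := (hp' v' hv').2 (Or.inr rfl)
    have hv't : v' ≠ t₁ := by
      rintro rfl
      rcases (hp v hvc).1 hγv.symm with h | h
      · exact hne h.symm
      · exact hvu h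
    have hv'L : v' ∈ L := by
      rw [hL, Finset.mem_sort, hS, Finset.mem_erase]
      exact ⟨hv't, by simpa using hv'⟩
    have : P.IsNegative (γ (Circle.exp v)) ↔ P'.IsNegative (γ (Circle.exp v)) := by
      rcases lt_or_gt_of_ne hne with h | h
      · rw [← hγv]
        exact hneg v' hv'L v hv h hγv
      · exact hneg v hv v' hv'L h hγv.symm
    exact P.signedLetter_eq_of_iff P' (by rw [hlab]) this
  have hdet := γ.transversal t₁ u (P.exp_ne_of_mem_turn h1c.1 huP htu.ne) hγu.symm
  have hnegP := P.isNegative_iff h1c.1 huP htu hγu.symm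
  have hnegP' := P'.isNegative_iff huP' htP' hut' (by rw [hexp, hγu])
  -- From the new base point the passage at `u` precedes the one at `t₁ + 2π`, so the determinant is
  -- taken in the opposite order.
  rw [γ.curveVelocity_congr hexp, planeDet_swap, hγu] at hnegP'
  have hflip : P'.IsNegative (γ (Circle.exp t₁)) ↔ ¬ P.IsNegative (γ (Circle.exp t₁)) := by
    rw [hnegP, hnegP']
    constructor
    · intro h; linarith
    · intro h; exact neg_pos.2 (lt_of_le_of_ne (not_lt.1 h) hdet)
  have hletter : P'.signedLetter u = (P.label (γ (Circle.exp t₁)), !(P.signedLetter t₁).2) := by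
    exact P.signedLetter_eq_of_iff_not P' (by rw [hlab, hγu]) (by rw [hγu, hflip])
  have hletter2 : P'.signedLetter (t₁ + 2 * Real.pi)
      = (P.label (γ (Circle.exp t₁)), !(P.signedLetter t₁).2) := by
    exact P.signedLetter_eq_of_iff_not P' (by rw [hlab, hexp]) (by rw [hexp, hflip])
  have hletter0 : P.signedLetter u = P.signedLetter t₁ :=
    P.signedLetter_eq_of_iff P (by rw [hγu]) (by rw [hγu])
  have hnd : L.Nodup := hLs.imp ne_of_lt
  rw [hXY] at hnd
  have hX : X.map P'.signedLetter = X.map P.signedLetter := by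
    refine List.map_congr_left fun v hv => hsame v (by simp [hXY, hv]) ?_
    rintro rfl
    exact (List.nodup_append.1 hnd).2.2 v hv v (by simp) rfl
  have hY : Y.map P'.signedLetter = Y.map P.signedLetter := by
    refine List.map_congr_left fun v hv => hsame v (by simp [hXY, hv]) ?_
    rintro rfl
    exact (List.nodup_cons.1 (List.nodup_append.1 hnd).2.1).1 hv
  refine ⟨P.label (γ (Circle.exp t₁)), (P.signedLetter t₁).2, X.map P.signedLetter,
    Y.map P.signedLetter, ?_, ?_⟩
  · change P.wordSeq = _
    rw [wordSeq, hPL, hXY]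
    simp only [List.map_cons, List.map_append, hletter0]
    rfl
  · change P'.wordSeq = _
    rw [wordSeq, hP'L, hXY]
    simp only [List.map_cons, List.map_append, hletter, hletter2, hX, hY, List.map_nil,
      List.append_assoc, List.cons_append]

end Labelling
end GenericCurve
end Curves

/-! ### The elementary move and its inverse are single-valued -/

namespace SignedWord

theorem notMem_of_seq_eq {w : SignedWord} {p : ℕ × Bool} {x y : List (ℕ × Bool)}
    (h : w.seq = p :: (x ++ p :: y)) : p ∉ x ∧ p ∉ y := by
  have h2 := (w.count_eq_two p (by simp [h])).1
  rw [h, List.count_cons_self, List.count_append, List.count_cons_self] at h2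
  exact ⟨fun hx => by have := List.count_pos_iff.2 hx; omega,
    fun hy => by have := List.count_pos_iff.2 hy; omega⟩

theorem notMem_of_seq_eq' {w : SignedWord} {p : ℕ × Bool} {x y : List (ℕ × Bool)}
    (h : w.seq = x ++ p :: (y ++ [p])) : p ∉ x ∧ p ∉ y := by
  have h2 := (w.count_eq_two p (by simp [h])).1
  rw [h, List.count_append, List.count_cons_self, List.count_append, List.count_cons_self] at h2
  exact ⟨fun hx => by have := List.count_pos_iff.2 hx; omega,
    fun hy => by have := List.count_pos_iff.2 hy; omega⟩

/-- The first letter determines the move, because its second occurrence is the only place where the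
rest can be split. Hence a move performed geometrically on a base point yields the very word
prescribed by the algebraic move. -/
theorem CyclicMove.right_unique {w w₁ w₂ : SignedWord} (h₁ : w.CyclicMove w₁)
    (h₂ : w.CyclicMove w₂) : w₁ = w₂ := by
  obtain ⟨a, s, x, y, e1, e2⟩ := h₁
  obtain ⟨b, r, x', y', f1, f2⟩ := h₂
  obtain ⟨h1, h2⟩ := List.cons_eq_cons.1 (e1.symm.trans f1)
  obtain ⟨rfl, rfl⟩ := Prod.mk.inj h1
  have hx := notMem_of_seq_eq e1
  have hx' := notMem_of_seq_eq f1
  obtain ⟨rfl, -, rfl⟩ := (List.append_cons_inj_of_notMem hx.1 hx.2).1 h2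
  ext1
  rw [e2, f2]

theorem CyclicMove.left_unique {w w₁ w₂ : SignedWord} (h₁ : w₁.CyclicMove w)
    (h₂ : w₂.CyclicMove w) : w₁ = w₂ := by
  obtain ⟨a, s, x, y, e1, e2⟩ := h₁
  obtain ⟨b, r, x', y', f1, f2⟩ := h₂
  have h := e2.symm.trans f2
  rw [← List.cons_append, ← List.cons_append, ← List.append_assoc, ← List.append_assoc] at h
  obtain ⟨h1, h2⟩ := List.append_inj' h rfl
  obtain ⟨rfl, h3⟩ := Prod.mk.inj (List.singleton_inj.1 h2)
  obtain rfl : s = r := by simpa using h3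
  have hx := notMem_of_seq_eq' e2
  have hx' := notMem_of_seq_eq' f2
  obtain ⟨rfl, -, rfl⟩ := (List.append_cons_inj_of_notMem hx.1 hx.2).1 h1
  ext1
  rw [e1, f1]

end SignedWord

/-! ### The words of one curve form a cyclic equivalence class -/

section Curves

variable {M : Type*} [TopologicalSpace M] [ChartedSpace Plane M]

namespace GenericCurve
namespace Labelling

variable {γ : GenericCurve M}

theorem mem_image_doubleParams_iff (P : γ.Labelling) {x : M} :
    x ∈ γ '' doubleParams γ ↔ ∃ t ∈ P.crossingTimes, γ (Circle.exp t) = x := by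
  constructor
  · rintro ⟨z, hz, rfl⟩
    obtain ⟨t, ht, rfl⟩ := P.exists_turn_of_doubleParam hz
    exact ⟨t, ⟨ht, hz⟩, rfl⟩
  · rintro ⟨t, ht, rfl⟩
    exact mem_image_of_mem _ ht.2

theorem mem_seq_iff (P : γ.Labelling) {p : ℕ × Bool} :
    p ∈ P.word.seq ↔ ∃ t ∈ P.crossingTimes, P.signedLetter t = p := by
  change p ∈ P.wordSeq ↔ _
  simp [wordSeq]

/-- The same base point with another labelling of the crossings. -/
def relabel (P : γ.Labelling) (f : ℕ → ℕ) (hf : InjOn f (P.word.letters : Set ℕ)) :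
    γ.Labelling where
  base := P.base
  base_notMem := P.base_notMem
  label := f ∘ P.label
  label_injOn := by
    refine hf.comp P.label_injOn fun x hx => ?_
    obtain ⟨t, ht, rfl⟩ := P.mem_image_doubleParams_iff.1 hx
    exact SignedWord.mem_letters.2 ⟨_, P.mem_seq_iff.2 ⟨t, ht, rfl⟩⟩

theorem word_relabel (P : γ.Labelling) (f : ℕ → ℕ) (hf : InjOn f (P.word.letters : Set ℕ)) :
    (P.relabel f hf).word.seq = P.word.seq.map (fun p => (f p.1, p.2)) := by
  change (P.relabel f hf).wordSeq = P.wordSeq.map _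
  rw [wordSeq, wordSeq, List.map_map]
  rfl

theorem exists_word_eq_of_iso (P : γ.Labelling) {w : SignedWord} (h : P.word.Iso w) :
    ∃ P' : γ.Labelling, P'.word = w := by
  obtain ⟨f, hf, he⟩ := h
  exact ⟨P.relabel f hf, by ext1; rw [word_relabel, he]⟩

/-- There are finitely many crossing times, so a new base point fits between `t` and the next
passage. -/
theorem exists_gt_of_mem_turn (P : γ.Labelling) {t c : ℝ} (ht : t ∈ P.turn) (hc : t < c) :
    ∃ b ∈ P.turn, Circle.exp b ∉ doubleParams γ ∧ t < b ∧ b < c ∧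
      ∀ u ∈ P.crossingTimes, u < b → u ≤ t := by
  have h1 : ∀ᶠ b in 𝓝[>] t, ∀ u ∈ P.crossingTimes, t < u → b < u :=
    nhdsWithin_le_nhds ((Filter.eventually_all_finite P.finite_crossingTimes).2 fun u _ =>
      Filter.eventually_imp_distrib_left.2 fun h => eventually_lt_nhds h)
  have h2 : ∀ᶠ b in 𝓝[>] t, b ∈ P.turn := nhdsWithin_le_nhds (isOpen_Ioo.mem_nhds ht)
  obtain ⟨b, ⟨hu, hb⟩, hb'⟩ := ((h1.and h2).and (Ioo_mem_nhdsGT hc)).exists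
  exact ⟨b, hb, fun hd => lt_irrefl b (hu b ⟨hb, hd⟩ hb'.1), hb'.1, hb'.2, fun u huc hub =>
    not_lt.1 fun h => hub.not_gt (hu u huc h)⟩

theorem exists_lt_of_mem_turn (P : γ.Labelling) {t : ℝ} (ht : t ∈ P.turn) :
    ∃ b ∈ P.turn, Circle.exp b ∉ doubleParams γ ∧ b < t ∧ ∀ u ∈ P.crossingTimes, b < u → t ≤ u := by
  have h1 : ∀ᶠ b in 𝓝[<] t, ∀ u ∈ P.crossingTimes, u < t → u < b :=
    nhdsWithin_le_nhds ((Filter.eventually_all_finite P.finite_crossingTimes).2 fun u _ =>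
      Filter.eventually_imp_distrib_left.2 fun h => eventually_gt_nhds h)
  have h2 : ∀ᶠ b in 𝓝[<] t, b ∈ P.turn := nhdsWithin_le_nhds (isOpen_Ioo.mem_nhds ht)
  obtain ⟨b, ⟨hu, hb⟩, hb'⟩ := ((h1.and h2).and self_mem_nhdsWithin).exists
  have hb' : b < t := hb'
  exact ⟨b, hb, fun hd => lt_irrefl b (hu b ⟨hb, hd⟩ hb'), hb', fun u huc hub =>
    not_lt.1 fun h => hub.not_gt (hu u huc h)⟩

theorem crossingTimes_nonempty (P : γ.Labelling) (h : P.word.seq ≠ []) :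
    P.crossingTimes.Nonempty := by
  obtain ⟨p, hp⟩ := List.exists_mem_of_ne_nil _ h
  obtain ⟨t, ht, -⟩ := P.mem_seq_iff.1 hp
  exact ⟨t, ht⟩

/-- By `right_unique` it suffices to perform some move: the base point is shifted to just behind the
first passage. -/
theorem exists_word_eq_of_cyclicMove (P : γ.Labelling) {w : SignedWord}
    (h : P.word.CyclicMove w) : ∃ P' : γ.Labelling, P'.word = w := by
  have hne : P.crossingTimes.Nonempty := P.crossingTimes_nonempty (by
    obtain ⟨a, s, x, y, h1, -⟩ := h
    simp [h1])
  obtain ⟨t, ht, hmin⟩ := P.finite_crossingTimes.exists_minimalFor id _ hne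
  obtain ⟨b, hb, hbd, htb, -, hu⟩ := P.exists_gt_of_mem_turn ht.1 (lt_add_one t)
  refine ⟨P.rebase b hbd, SignedWord.CyclicMove.right_unique ?_ h⟩
  refine P.cyclicMove_of_existsUnique (P.rebase b hbd) rfl hb.2 (t₁ := t) ⟨ht.1.1, htb⟩ ht.2 ?_
  intro u hu' hud
  have huc : u ∈ P.crossingTimes := ⟨⟨hu'.1, hu'.2.trans hb.2⟩, hud⟩
  have h1 := hu u huc hu'.2
  exact le_antisymm h1 (hmin huc h1)

/-- For the inverse move the base point goes back over the last passage. To see this as a forward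
move, the old base point is replaced by the same point one full turn later. -/
theorem exists_word_eq_of_cyclicMove' (P : γ.Labelling) {w : SignedWord}
    (h : w.CyclicMove P.word) : ∃ P' : γ.Labelling, P'.word = w := by
  have hne : P.crossingTimes.Nonempty := P.crossingTimes_nonempty (by
    obtain ⟨a, s, x, y, -, h1⟩ := h
    simp [h1])
  obtain ⟨t, ht, hmax⟩ := P.finite_crossingTimes.exists_maximalFor id _ hne
  obtain ⟨b, hb, hbd, htb, hu⟩ := P.exists_lt_of_mem_turn ht.1
  have hbase : Circle.exp (P.base + 2 * Real.pi) ∉ doubleParams γ := by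
    rw [Circle.exp_add_two_pi]; exact P.base_notMem
  have hP : P.word = (P.rebase _ hbase).word :=
    P.word_eq_of_base_eq_add_int_mul _ rfl 1 (by simp [rebase])
  refine ⟨P.rebase b hbd, SignedWord.CyclicMove.left_unique ?_ h⟩
  rw [hP]
  refine (P.rebase b hbd).cyclicMove_of_existsUnique (P.rebase _ hbase) rfl ?_ (t₁ := t)
    ⟨htb, ht.1.2⟩ ht.2 ?_
  · change P.base + 2 * Real.pi < b + 2 * Real.pi
    linarith [hb.1]
  · intro u hu' hud
    have huc : u ∈ P.crossingTimes := ⟨⟨hb.1.trans hu'.1, hu'.2⟩, hud⟩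
    have h1 := hu u huc hu'.1
    exact le_antisymm (hmax huc h1) h1

/-- All signed words that are cyclically equivalent to a signed word of a curve are signed words of
this curve. -/
theorem exists_word_eq_of_cyclicEquiv (P : γ.Labelling) {w : SignedWord}
    (h : P.word.CyclicEquiv w) : ∃ P' : γ.Labelling, P'.word = w := by
  have key : ∀ {w w' : SignedWord}, w.CyclicEquiv w' →
      ((∃ P : γ.Labelling, P.word = w) ↔ ∃ P : γ.Labelling, P.word = w') := by
    intro w w' h
    induction h with
    | rel w w' h =>
      rcases h with h | h
      · exact ⟨fun ⟨P, hP⟩ => P.exists_word_eq_of_iso (hP ▸ h),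
          fun ⟨P, hP⟩ => P.exists_word_eq_of_iso (hP ▸ h.symm)⟩
      · exact ⟨fun ⟨P, hP⟩ => P.exists_word_eq_of_cyclicMove (hP ▸ h),
          fun ⟨P, hP⟩ => P.exists_word_eq_of_cyclicMove' (hP ▸ h)⟩
    | refl => exact Iff.rfl
    | symm _ _ _ ih => exact ih.symm
    | trans _ _ _ _ _ ih1 ih2 => exact ih1.trans ih2
  exact (key h).1 ⟨P, rfl⟩

/-- Induction on the number of passages between the two base points; each step moves the base point
past the earliest of them. -/
theorem cyclicEquiv_of_base_mem (Q : γ.Labelling) (n : ℕ) : ∀ P : γ.Labelling,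
    Q.label = P.label → Q.base ∈ Ico P.base (P.base + 2 * Real.pi) →
    {t | t ∈ P.crossingTimes ∧ t < Q.base}.ncard = n → P.word.CyclicEquiv Q.word := by
  induction n with
  | zero =>
    intro P hl hb hn
    have hfin : {t | t ∈ P.crossingTimes ∧ t < Q.base}.Finite :=
      P.finite_crossingTimes.subset fun _ h => h.1
    rw [Set.ncard_eq_zero hfin] at hn
    rw [P.word_eq_of_forall_notMem Q hl hb.1]
    · exact Relation.EqvGen.refl _
    · intro t ht hd
      rcases ht.1.eq_or_lt with h | h
      · exact P.base_notMem (h ▸ hd)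
      rcases ht.2.eq_or_lt with h' | h'
      · exact Q.base_notMem (h' ▸ hd)
      exact hn.subset ⟨⟨⟨h, ht.2.trans_lt hb.2⟩, hd⟩, h'⟩
  | succ n ih =>
    intro P hl hb hn
    have hfin : {t | t ∈ P.crossingTimes ∧ t < Q.base}.Finite :=
      P.finite_crossingTimes.subset fun _ h => h.1
    obtain ⟨t, ht, hmin⟩ := hfin.exists_minimalFor id _ ((Set.ncard_pos hfin).1 (by omega))
    obtain ⟨b, hb', hbd, htb, hbQ, hu⟩ := P.exists_gt_of_mem_turn ht.1.1 ht.2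
    refine Relation.EqvGen.trans _ (P.rebase b hbd).word _ (Relation.EqvGen.rel _ _ (Or.inr ?_))
      (ih (P.rebase b hbd) hl ⟨hbQ.le, hb.2.trans ?_⟩ ?_)
    · refine P.cyclicMove_of_existsUnique (P.rebase b hbd) rfl hb'.2 (t₁ := t) ⟨ht.1.1.1, htb⟩
        ht.1.2 ?_
      intro u hu' hud
      have huc : u ∈ P.crossingTimes := ⟨⟨hu'.1, hu'.2.trans hb'.2⟩, hud⟩
      have h1 := hu u huc hu'.2
      exact le_antisymm h1 (hmin ⟨huc, hu'.2.trans hbQ⟩ h1)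
    · change P.base + 2 * Real.pi < b + 2 * Real.pi
      linarith [hb'.1]
    · have : {u | u ∈ (P.rebase b hbd).crossingTimes ∧ u < Q.base}
          = {t | t ∈ P.crossingTimes ∧ t < Q.base} \ {t} := by
        ext u
        simp only [mem_ofPred_eq, Set.mem_sdiff, mem_singleton_iff]
        constructor
        · rintro ⟨⟨h1, h2⟩, h3⟩
          have h1' : b < u := h1.1
          exact ⟨⟨⟨⟨hb'.1.trans h1', h3.trans hb.2⟩, h2⟩, h3⟩, fun h => by linarith⟩
        · rintro ⟨⟨h1, h3⟩, h4⟩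
          have h5 : b < u := by
            rcases lt_trichotomy b u with h | h | h
            · exact h
            · exact absurd (h ▸ h1.2) hbd
            · have h6 := hu u h1 h
              exact absurd (le_antisymm h6 (hmin ⟨h1, h3⟩ h6)) h4
          refine ⟨⟨⟨h5, h1.1.2.trans ?_⟩, h1.2⟩, h3⟩
          change P.base + 2 * Real.pi < b + 2 * Real.pi
          linarith [hb'.1]
      rw [this, Set.ncard_sdiff_singleton_of_mem ht, hn]
      rfl

/-- Any two signed words of the same curve are cyclically equivalent. -/
theorem cyclicEquiv_word (P Q : γ.Labelling) : P.word.CyclicEquiv Q.word := by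
  have hp := Real.two_pi_pos
  have hbase : ∀ k : ℤ, Circle.exp (P.base + k * (2 * Real.pi)) ∉ doubleParams γ := fun k => by
    rw [Circle.exp_add_int_mul]; exact P.base_notMem
  -- Full turns do not change the word; they bring the base point of `P` into the last turn up to
  -- the base point of `Q`.
  obtain ⟨k, hk, -⟩ := existsUnique_add_zsmul_mem_Ioc hp P.base (Q.base - 2 * Real.pi)
  rw [zsmul_eq_mul] at hk
  set P₁ := P.rebase _ (hbase k) with hP₁
  have h1 : P.word = P₁.word := P.word_eq_of_base_eq_add_int_mul _ rfl k rfl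
  -- The change to the labels of `Q` is a renaming, done separately from the change of base point.
  set P₂ : γ.Labelling := ⟨P₁.base, P₁.base_notMem, Q.label, Q.label_injOn⟩ with hP₂
  have h2 : P₁.word.Iso P₂.word := by
    have : Nonempty M := ⟨γ 1⟩
    set g := Function.invFunOn P.label (γ '' doubleParams γ) with hg
    have hinv : ∀ x ∈ γ '' doubleParams γ, g (P.label x) = x := fun x hx =>
      P.label_injOn.leftInvOn_invFunOn hx
    have hinv' : ∀ a ∈ P₁.word.letters, ∃ x ∈ γ '' doubleParams γ, P.label x = a := by
      intro a ha
      obtain ⟨s, hs⟩ := SignedWord.mem_letters.1 ha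
      obtain ⟨t, ht, hts⟩ := P₁.mem_seq_iff.1 hs
      exact ⟨γ (Circle.exp t), mem_image_of_mem _ ht.2, congrArg Prod.fst hts⟩
    refine ⟨Q.label ∘ g, ?_, ?_⟩
    · intro a ha b hb hab
      obtain ⟨x, hx, rfl⟩ := hinv' a ha
      obtain ⟨y, hy, rfl⟩ := hinv' b hb
      simp only [Function.comp, hinv x hx, hinv y hy] at hab
      rw [Q.label_injOn hx hy hab]
    · change P₂.wordSeq = P₁.wordSeq.map _
      rw [wordSeq, wordSeq, List.map_map]
      refine List.map_congr_left fun t ht => ?_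
      have ht' : t ∈ P₂.crossingTimes := by simpa using ht
      refine Prod.ext ?_ rfl
      change Q.label (γ (Circle.exp t)) = Q.label (g (P.label (γ (Circle.exp t))))
      rw [hinv _ (mem_image_of_mem _ ht'.2)]
  rw [h1]
  refine Relation.EqvGen.trans _ P₂.word _ (Relation.EqvGen.rel _ _ (Or.inl h2))
    (cyclicEquiv_of_base_mem Q _ P₂ rfl ⟨?_, ?_⟩ rfl)
  · change P.base + k * (2 * Real.pi) ≤ Q.base
    linarith [hk.2]
  · change Q.base < P.base + k * (2 * Real.pi) + 2 * Real.pi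
    linarith [hk.1]

end Labelling
end GenericCurve
end Curves

/-! ### Functions with `g (t + 2π) = g t + 2π` -/

theorem exists_quasiperiodic_extension {f : ℝ → ℝ} (hf : Continuous f) {b : ℝ}
    (hb : f (b + 2 * Real.pi) = f b + 2 * Real.pi) :
    ∃ g : ℝ → ℝ, Continuous g ∧ (∀ t, g (t + 2 * Real.pi) = g t + 2 * Real.pi) ∧
      ∀ t ∈ Icc b (b + 2 * Real.pi), g t = f t := by
  have hp := Real.two_pi_pos
  -- Without its linear part `f` takes equal values at both ends of the period, so composing with
  -- the fractional part is continuous.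
  set F : ℝ → ℝ := fun s => f (b + 2 * Real.pi * s) - 2 * Real.pi * s with hF
  have hFc : Continuous F := by fun_prop
  have hF01 : F 0 = F 1 := by simp [hF, hb]
  have hG : Continuous (fun t : ℝ => F (Int.fract t)) := hFc.continuousOn.comp_fract'' hF01
  have hper : ∀ t : ℝ, (t + 2 * Real.pi - b) / (2 * Real.pi) = (t - b) / (2 * Real.pi) + 1 := by
    intro t; field_simp; ring
  set g : ℝ → ℝ := fun t => (t - b) + F (Int.fract ((t - b) / (2 * Real.pi))) with hg
  have hgp : ∀ t, g (t + 2 * Real.pi) = g t + 2 * Real.pi := by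
    intro t
    simp only [hg, hper, Int.fract_add_one]
    ring
  have hico : ∀ t ∈ Ico b (b + 2 * Real.pi), g t = f t := by
    intro t ht
    have h1 : Int.fract ((t - b) / (2 * Real.pi)) = (t - b) / (2 * Real.pi) := by
      rw [Int.fract_eq_self]
      exact ⟨div_nonneg (by linarith [ht.1]) hp.le, (div_lt_one hp).2 (by linarith [ht.2])⟩
    simp only [hg, h1, hF]
    rw [mul_div_cancel₀ _ hp.ne']
    simp
  refine ⟨g, ?_, hgp, fun t ht => ?_⟩
  · exact (by fun_prop : Continuous fun t : ℝ => t - b).add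
      (hG.comp (by fun_prop : Continuous fun t : ℝ => (t - b) / (2 * Real.pi)))
  · rcases ht.2.eq_or_lt with h | h
    · rw [h, hgp, hb, hico b ⟨le_rfl, by linarith⟩]
    · exact hico t ⟨ht.1, h⟩

/-! ### Winding numbers of loops in the plane -/

/-- The `2π`-periodic curve `(x, y)` winds exactly once counterclockwise around the origin. -/
def WindsOnce (x y : ℝ → ℝ) : Prop :=
  ∃ θ : ℝ → ℝ, Continuous θ ∧ (∀ t, θ (t + 2 * Real.pi) = θ t + 2 * Real.pi) ∧
    ∀ t, ∃ ρ > (0 : ℝ), x t = ρ * Real.cos (θ t) ∧ y t = ρ * Real.sin (θ t)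

namespace WindsOnce

theorem circle {r : ℝ} (hr : 0 < r) :
    WindsOnce (fun t => r * Real.cos t) (fun t => r * Real.sin t) :=
  ⟨id, continuous_id, fun _ => rfl, fun _ => ⟨r, hr, rfl, rfl⟩⟩

/-- Two loops with positive inner product at every time enclose an angle below a right angle. This
angle is a continuous periodic function of time, and adding it to the angle of the first loop gives
an angle of the second. -/
theorem of_inner_pos {x y x' y' : ℝ → ℝ} (h : WindsOnce x y)
    (hx : Continuous x) (hy : Continuous y) (hx' : Continuous x') (hy' : Continuous y')
    (px : x.Periodic (2 * Real.pi)) (py : y.Periodic (2 * Real.pi))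
    (px' : x'.Periodic (2 * Real.pi)) (py' : y'.Periodic (2 * Real.pi))
    (hpos : ∀ t, 0 < x t * x' t + y t * y' t) : WindsOnce x' y' := by
  obtain ⟨θ, hθ, hθp, hxy⟩ := h
  -- This is the conjugate of `x + iy` times `x' + iy'`; its argument is the angle from the first
  -- vector to the second.
  set w : ℝ → ℂ := fun t => ⟨x t * x' t + y t * y' t, x t * y' t - y t * x' t⟩ with hw
  have hwc : Continuous w := by
    have : w = fun t => ((x t * x' t + y t * y' t : ℝ) : ℂ)
        + ((x t * y' t - y t * x' t : ℝ) : ℂ) * Complex.I := by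
      funext t; exact Complex.ext (by simp [hw]) (by simp [hw])
    rw [this]
    fun_prop
  have hws : ∀ t, w t ∈ Complex.slitPlane := fun t => Or.inl (hpos t)
  have hwp : ∀ t, w (t + 2 * Real.pi) = w t := fun t => by
    simp only [hw, px t, py t, px' t, py' t]
  refine ⟨fun t => θ t + Complex.arg (w t), ?_, fun t => ?_, fun t => ?_⟩
  · refine hθ.add (continuous_iff_continuousAt.2 fun t => ?_)
    exact (Complex.continuousAt_arg (hws t)).comp hwc.continuousAt
  · simp only [hθp, hwp]; ring
  · obtain ⟨ρ, hρ, e1, e2⟩ := hxy t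
    have hw0 : w t ≠ 0 := Complex.slitPlane_ne_zero (hws t)
    have c1 : ‖w t‖ * Real.cos (Complex.arg (w t)) = x t * x' t + y t * y' t :=
      Complex.norm_mul_cos_arg (w t)
    have c2 : ‖w t‖ * Real.sin (Complex.arg (w t)) = x t * y' t - y t * x' t :=
      Complex.norm_mul_sin_arg (w t)
    have hcs := Real.sin_sq_add_cos_sq (θ t)
    refine ⟨‖w t‖ / ρ, div_pos (norm_pos_iff.2 hw0) hρ, ?_, ?_⟩
    · rw [Real.cos_add, div_mul_eq_mul_div, eq_div_iff hρ.ne']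
      have : ‖w t‖ * (Real.cos (θ t) * Real.cos (w t).arg - Real.sin (θ t) * Real.sin (w t).arg)
          = Real.cos (θ t) * (‖w t‖ * Real.cos (w t).arg)
            - Real.sin (θ t) * (‖w t‖ * Real.sin (w t).arg) := by ring
      rw [this, c1, c2, e1, e2]
      linear_combination (-(x' t * ρ)) * hcs
    · rw [Real.sin_add, div_mul_eq_mul_div, eq_div_iff hρ.ne']
      have : ‖w t‖ * (Real.sin (θ t) * Real.cos (w t).arg + Real.cos (θ t) * Real.sin (w t).arg)
          = Real.sin (θ t) * (‖w t‖ * Real.cos (w t).arg)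
            + Real.cos (θ t) * (‖w t‖ * Real.sin (w t).arg) := by ring
      rw [this, c1, c2, e1, e2]
      linear_combination (-(y' t * ρ)) * hcs

theorem rotate {x y : ℝ → ℝ} (h : WindsOnce x y) {p q : ℝ} (hpq : 0 < p ^ 2 + q ^ 2) :
    WindsOnce (fun t => p * x t - q * y t) (fun t => q * x t + p * y t) := by
  obtain ⟨θ, hθ, hθp, hxy⟩ := h
  set w : ℂ := ⟨p, q⟩ with hw
  have hw0 : w ≠ 0 := by
    intro h
    have h1 : p = 0 := congrArg Complex.re h
    have h2 : q = 0 := congrArg Complex.im h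
    simp [h1, h2] at hpq
  have c1 : ‖w‖ * Real.cos (Complex.arg w) = p := Complex.norm_mul_cos_arg w
  have c2 : ‖w‖ * Real.sin (Complex.arg w) = q := Complex.norm_mul_sin_arg w
  refine ⟨fun t => θ t + Complex.arg w, by fun_prop, fun t => by simp only [hθp]; ring,
    fun t => ?_⟩
  obtain ⟨ρ, hρ, e1, e2⟩ := hxy t
  refine ⟨‖w‖ * ρ, mul_pos (norm_pos_iff.2 hw0) hρ, ?_, ?_⟩
  · beta_reduce
    rw [Real.cos_add, e1, e2]
    linear_combination (-(ρ * Real.cos (θ t))) * c1 + (ρ * Real.sin (θ t)) * c2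
  · beta_reduce
    rw [Real.sin_add, e1, e2]
    linear_combination (-(ρ * Real.sin (θ t))) * c1 - (ρ * Real.cos (θ t)) * c2

theorem ne_zero {x y : ℝ → ℝ} (h : WindsOnce x y) (t : ℝ) : 0 < x t ^ 2 + y t ^ 2 := by
  obtain ⟨θ, -, -, hxy⟩ := h
  obtain ⟨ρ, hρ, e1, e2⟩ := hxy t
  have : x t ^ 2 + y t ^ 2 = ρ ^ 2 := by
    rw [e1, e2]
    linear_combination ρ ^ 2 * Real.sin_sq_add_cos_sq (θ t)
  rw [this]
  positivity

/-- Polar decomposition: a matrix of positive determinant is a rotation followed by a positive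
definite symmetric map, up to scale. The rotation shifts the angle by a constant, and the remaining
discrepancy is handled by `of_inner_pos`. -/
theorem linear {x y : ℝ → ℝ} (h : WindsOnce x y) (hx : Continuous x) (hy : Continuous y)
    (px : x.Periodic (2 * Real.pi)) (py : y.Periodic (2 * Real.pi))
    {a b c d : ℝ} (hdet : 0 < a * d - b * c) :
    WindsOnce (fun t => a * x t + b * y t) (fun t => c * x t + d * y t) := by
  -- The matrix with rows `(p, -q)` and `(q, p)` is a positive multiple of the rotation in the polar
  -- decomposition. Its transpose times the given matrix is symmetric with diagonal entries `A`, `D`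
  -- and off-diagonal entries `B / 2`.
  set p := a + d with hp
  set q := c - b with hq
  have hpq : 0 < p ^ 2 + q ^ 2 := by
    simp only [hp, hq]
    nlinarith [sq_nonneg (a - d), sq_nonneg (b + c)]
  refine (h.rotate hpq).of_inner_pos (by fun_prop) (by fun_prop) (by fun_prop) (by fun_prop)
    (fun t => by simp only [px t, py t]) (fun t => by simp only [px t, py t])
    (fun t => by simp only [px t, py t]) (fun t => by simp only [px t, py t]) fun t => ?_
  have h0 := h.ne_zero t
  set X := x t
  set Y := y t
  set A := p * a + q * c with hA
  set D := p * d - q * b with hD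
  set B := p * b + q * d + p * c - q * a with hB
  have hsum : A + D = p ^ 2 + q ^ 2 := by simp only [hA, hD, hp, hq]; ring
  have hprod : 4 * A * D - B ^ 2 = 4 * (a * d - b * c) * (p ^ 2 + q ^ 2) := by
    simp only [hA, hD, hB, hp, hq]; ring
  have hAD : 0 < 4 * A * D - B ^ 2 := by rw [hprod]; positivity
  have hADp : 0 < A * D := by nlinarith [sq_nonneg B]
  have hA0 : 0 < A := by
    by_contra hc
    have hD0 : D ≤ 0 := by nlinarith
    nlinarith
  have key : 0 < 4 * A * (A * X ^ 2 + B * X * Y + D * Y ^ 2) := by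
    have : 4 * A * (A * X ^ 2 + B * X * Y + D * Y ^ 2)
        = (2 * A * X + B * Y) ^ 2 + (4 * A * D - B ^ 2) * Y ^ 2 := by ring
    rw [this]
    by_cases hY : Y = 0
    · have hX : X ≠ 0 := by rintro hX; simp [hX, hY] at h0
      rw [hY]
      have : 0 < (2 * A * X) ^ 2 := by positivity
      simpa using this
    · have : 0 < (4 * A * D - B ^ 2) * Y ^ 2 := by positivity
      nlinarith [sq_nonneg (2 * A * X + B * Y)]
  have := pos_of_mul_pos_right key (by positivity)
  calc 0 < A * X ^ 2 + B * X * Y + D * Y ^ 2 := this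
    _ = _ := by simp only [hA, hB, hD]; ring

/-- A loop that winds once clockwise cannot cross the first coordinate axis as a positively
oriented loop does. -/
theorem false_of_reversed {x y : ℝ → ℝ} (h : WindsOnce x fun t => -y t) {α : ℝ} (hα : 0 < y α)
    (h1 : ∀ t ∈ Icc (α - Real.pi) α, y t = 0 → 0 < x t)
    (h2 : ∀ t ∈ Icc α (α + Real.pi), y t = 0 → x t < 0) : False := by
  have hpi := Real.pi_pos
  obtain ⟨θ, hθ, hθp, hxy⟩ := h
  -- Full turns normalize the angle at `α` to `(-π, π]`; as `-y α < 0`, it lies in `(-π, 0)`.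
  obtain ⟨k, hk, -⟩ := existsUnique_add_zsmul_mem_Ioc Real.two_pi_pos (θ α) (-Real.pi)
  rw [zsmul_eq_mul] at hk
  set φ : ℝ → ℝ := fun t => θ t + k * (2 * Real.pi) with hφ
  have hφc : Continuous φ := by fun_prop
  have hxy' : ∀ t, ∃ ρ > (0 : ℝ), x t = ρ * Real.cos (φ t) ∧ -y t = ρ * Real.sin (φ t) := by
    intro t
    simp only [hφ, Real.cos_add_int_mul_two_pi, Real.sin_add_int_mul_two_pi]
    exact hxy t
  have hφα : φ α ∈ Ioo (-Real.pi) 0 := by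
    refine ⟨hk.1, ?_⟩
    by_contra hc
    obtain ⟨ρ, hρ, -, e⟩ := hxy' α
    have h3 : φ α ≤ Real.pi := by simp only [hφ]; linarith [hk.2]
    have := Real.sin_nonneg_of_nonneg_of_le_pi (not_lt.1 hc) h3
    nlinarith
  -- At the angle `-π` the vector would lie on the negative first axis, which `h1` excludes before
  -- `α`; the angle `0` is excluded by `h2` after `α`. So the angle grows by less than `π` in a full
  -- turn.
  have h3 : -Real.pi < φ (α - Real.pi) := by
    by_contra hc
    obtain ⟨t, ht, e⟩ := intermediate_value_Icc (by linarith : α - Real.pi ≤ α) hφc.continuousOn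
      ⟨not_lt.1 hc, hφα.1.le⟩
    obtain ⟨ρ, hρ, e1, e2⟩ := hxy' t
    rw [e] at e1 e2
    simp at e1 e2
    linarith [h1 t ht e2]
  have h4 : φ (α + Real.pi) < 0 := by
    by_contra hc
    obtain ⟨t, ht, e⟩ := intermediate_value_Icc (by linarith : α ≤ α + Real.pi) hφc.continuousOn
      ⟨hφα.2.le, not_lt.1 hc⟩
    obtain ⟨ρ, hρ, e1, e2⟩ := hxy' t
    rw [e] at e1 e2
    simp at e1 e2
    linarith [h2 t ht e2]
  have h5 : φ (α + Real.pi) = φ (α - Real.pi) + 2 * Real.pi := by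
    have := hθp (α - Real.pi)
    rw [show α - Real.pi + 2 * Real.pi = α + Real.pi by ring] at this
    simp only [hφ, this]; ring
  linarith

end WindsOnce

/-! ### Linear algebra of the plane -/

namespace Plane

theorem norm_sq (v : Plane) : ‖v‖ ^ 2 = v 0 ^ 2 + v 1 ^ 2 := by
  rw [EuclideanSpace.real_norm_sq_eq]; simp [Fin.sum_univ_two]

theorem apply_eq (L : ℝ × ℝ →L[ℝ] Plane) (p : ℝ × ℝ) :
    L p = p.1 • L (1, 0) + p.2 • L (0, 1) := by
  rw [← map_smul, ← map_smul, ← map_add]; simp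

theorem apply_eq' (T : Plane →L[ℝ] Plane) (v : Plane) :
    T v = v 0 • T !₂[1, 0] + v 1 • T !₂[0, 1] := by
  rw [← map_smul, ← map_smul, ← map_add]
  congr 1
  ext i
  fin_cases i <;> simp

theorem det_eq (T : Plane →L[ℝ] Plane) : T.det = planeDet (T !₂[1, 0]) (T !₂[0, 1]) := by
  have h := LinearMap.det_toMatrix (EuclideanSpace.basisFun (Fin 2) ℝ).toBasis (T : Plane →ₗ[ℝ] Plane)
  change LinearMap.det (T : Plane →ₗ[ℝ] Plane) = _
  have e0 : EuclideanSpace.single (0 : Fin 2) (1 : ℝ) = !₂[1, 0] := by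
    ext i; fin_cases i <;> simp
  have e1 : EuclideanSpace.single (1 : Fin 2) (1 : ℝ) = !₂[0, 1] := by
    ext i; fin_cases i <;> simp
  rw [← h, Matrix.det_fin_two]
  simp [LinearMap.toMatrix_apply, planeDet, e0, e1]
  ring

theorem det_comp (T : Plane →L[ℝ] Plane) (u v : Plane) :
    planeDet (T u) (T v) = T.det * planeDet u v := by
  rw [apply_eq' T u, apply_eq' T v, det_eq]
  simp [planeDet]
  ring

/-- An invertible linear map of the parameter plane to the plane. -/
theorem exists_equiv (L : ℝ × ℝ →L[ℝ] Plane) (h : planeDet (L (1, 0)) (L (0, 1)) ≠ 0) :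
    ∃ L' : (ℝ × ℝ) ≃L[ℝ] Plane, (L' : ℝ × ℝ →L[ℝ] Plane) = L := by
  have hinj : Function.Injective (L : ℝ × ℝ →ₗ[ℝ] Plane) := by
    rw [injective_iff_map_eq_zero]
    intro p hp
    have hp' : L p = 0 := hp
    rw [apply_eq] at hp'
    have h0 := congrArg (fun v : Plane => v 0) hp'
    have h1 := congrArg (fun v : Plane => v 1) hp'
    simp at h0 h1
    have e1 : p.1 * planeDet (L (1, 0)) (L (0, 1)) = 0 := by
      simp only [planeDet]; linear_combination (L (0, 1) 1) * h0 - (L (0, 1) 0) * h1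
    have e2 : p.2 * planeDet (L (1, 0)) (L (0, 1)) = 0 := by
      simp only [planeDet]; linear_combination (L (1, 0) 0) * h1 - (L (1, 0) 1) * h0
    exact Prod.ext ((mul_eq_zero.1 e1).resolve_right h) ((mul_eq_zero.1 e2).resolve_right h)
  refine ⟨(LinearEquiv.ofInjectiveOfFinrankEq _ hinj (by simp)).toContinuousLinearEquiv, ?_⟩
  exact ContinuousLinearMap.ext fun p =>
    DFunLike.congr_fun (LinearEquiv.coe_ofInjectiveOfFinrankEq _ hinj (by simp)) p

theorem ne_zero_of_det' (T : Plane →L[ℝ] Plane) (h : T.det ≠ 0) {v : Plane} (hv : v ≠ 0) :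
    T v ≠ 0 := by
  intro h0
  have hc : ∀ u, planeDet v u = 0 := fun u => by
    have := det_comp T v u
    rw [h0] at this
    simp only [planeDet, PiLp.zero_apply, zero_mul, sub_zero] at this
    exact (mul_eq_zero.1 this.symm).resolve_left h
  refine hv ?_
  ext i
  have h1 := hc !₂[0, 1]
  have h2 := hc !₂[1, 0]
  simp [planeDet] at h1 h2
  fin_cases i <;> simp [h1, h2]

end Plane

/-! ### Loops in the plane -/

namespace WindsOnce

/-- The argument of Rouché's theorem: if the difference of two vectors is shorter than one of them,
their inner product is positive. -/
theorem of_norm_sub_lt {c c' : ℝ → Plane} (h : WindsOnce (fun t => c t 0) fun t => c t 1)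
    (hc : Continuous c) (hc' : Continuous c') (pc : c.Periodic (2 * Real.pi))
    (pc' : c'.Periodic (2 * Real.pi))
    (hlt : ∀ t, ‖c' t - c t‖ < ‖c t‖ ∨ ‖c' t - c t‖ < ‖c' t‖) :
    WindsOnce (fun t => c' t 0) fun t => c' t 1 := by
  refine h.of_inner_pos (by fun_prop) (by fun_prop) (by fun_prop) (by fun_prop)
    (fun t => by simp only [pc t]) (fun t => by simp only [pc t]) (fun t => by simp only [pc' t])
    (fun t => by simp only [pc' t]) fun t => ?_
  have h1 : ∀ a b : Plane, ‖a‖ < ‖b‖ → ‖a‖ ^ 2 < ‖b‖ ^ 2 := fun a b h => by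
    gcongr
  rcases hlt t with h2 | h2
  all_goals
    have := h1 _ _ h2
    simp only [Plane.norm_sq, PiLp.sub_apply] at this
    nlinarith [sq_nonneg (c t 0), sq_nonneg (c t 1), sq_nonneg (c' t 0), sq_nonneg (c' t 1)]

theorem map_plane {c : ℝ → Plane} (h : WindsOnce (fun t => c t 0) fun t => c t 1)
    (hc : Continuous c) (pc : c.Periodic (2 * Real.pi)) {T : Plane →L[ℝ] Plane} (hT : 0 < T.det) :
    WindsOnce (fun t => T (c t) 0) fun t => T (c t) 1 := by
  rw [Plane.det_eq] at hT
  have := h.linear (by fun_prop) (by fun_prop) (fun t => by simp only [pc t])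
    (fun t => by simp only [pc t]) (a := T !₂[1, 0] 0) (b := T !₂[0, 1] 0) (c := T !₂[1, 0] 1)
    (d := T !₂[0, 1] 1) (by simp only [planeDet] at hT; linarith)
  convert this using 2 with t t
  all_goals
    rw [Plane.apply_eq' T]
    simp
    ring

theorem map_prod {q : ℝ → ℝ × ℝ} (h : WindsOnce (fun t => (q t).1) fun t => (q t).2)
    (hq : Continuous q) (pq : q.Periodic (2 * Real.pi)) {L : ℝ × ℝ →L[ℝ] Plane}
    (hL : 0 < planeDet (L (1, 0)) (L (0, 1))) :
    WindsOnce (fun t => L (q t) 0) fun t => L (q t) 1 := by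
  have := h.linear (by fun_prop) (by fun_prop) (fun t => by simp only [pq t])
    (fun t => by simp only [pq t]) (a := L (1, 0) 0) (b := L (0, 1) 0) (c := L (1, 0) 1)
    (d := L (0, 1) 1) (by simp only [planeDet] at hL; linarith)
  convert this using 2 with t t
  all_goals
    rw [Plane.apply_eq L]
    simp
    ring

/-- The inverse of `L` also has positive determinant, so `linear` applies to it; its entries come
from Cramer's rule. -/
theorem of_map_prod {q : ℝ → ℝ × ℝ} {L : ℝ × ℝ →L[ℝ] Plane}
    (h : WindsOnce (fun t => L (q t) 0) fun t => L (q t) 1)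
    (hq : Continuous q) (pq : q.Periodic (2 * Real.pi))
    (hL : 0 < planeDet (L (1, 0)) (L (0, 1))) :
    WindsOnce (fun t => (q t).1) fun t => (q t).2 := by
  set D := planeDet (L (1, 0)) (L (0, 1)) with hD
  have hD' : D = L (1, 0) 0 * L (0, 1) 1 - L (1, 0) 1 * L (0, 1) 0 := rfl
  have := h.linear (by fun_prop) (by fun_prop) (fun t => by simp only [pq t])
    (fun t => by simp only [pq t]) (a := L (0, 1) 1 / D) (b := -L (0, 1) 0 / D)
    (c := -L (1, 0) 1 / D) (d := L (1, 0) 0 / D) (by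
      have : L (0, 1) 1 / D * (L (1, 0) 0 / D) - -L (0, 1) 0 / D * (-L (1, 0) 1 / D)
          = D / D / D := by
        rw [hD']; ring
      rw [this]; positivity)
  convert this using 2 with t t
  all_goals
    rw [Plane.apply_eq L (q t)]
    simp
    field_simp
    rw [hD']
    ring

/-- A map that is monotone, in the sense of monotone operators, preserves winding numbers. -/
theorem of_monotone {q q' : ℝ → ℝ × ℝ} (h : WindsOnce (fun t => (q t).1) fun t => (q t).2)
    (hq : Continuous q) (hq' : Continuous q') (pq : q.Periodic (2 * Real.pi))
    (pq' : q'.Periodic (2 * Real.pi))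
    (hpos : ∀ t, 0 < (q t).1 * (q' t).1 + (q t).2 * (q' t).2) :
    WindsOnce (fun t => (q' t).1) fun t => (q' t).2 :=
  h.of_inner_pos (by fun_prop) (by fun_prop) (by fun_prop) (by fun_prop)
    (fun t => by simp only [pq t]) (fun t => by simp only [pq t]) (fun t => by simp only [pq' t])
    (fun t => by simp only [pq' t]) hpos

end WindsOnce

/-- A linear approximation with injective derivative. -/
theorem HasFDerivAt.eventually_norm_sub_lt {E F : Type*} [NormedAddCommGroup E] [NormedSpace ℝ E]
    [FiniteDimensional ℝ E] [NormedAddCommGroup F] [NormedSpace ℝ F] {f : E → F} {T : E →L[ℝ] F}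
    {x : E} (h : HasFDerivAt f T x) (hT : Function.Injective T) :
    ∀ᶠ y in 𝓝 x, y ≠ x → ‖f y - f x - T (y - x)‖ < ‖T (y - x)‖ := by
  obtain ⟨K, hK, hKT⟩ := (LinearMap.injective_iff_antilipschitz (T : E →ₗ[ℝ] F)).1 hT
  have hK' : (0 : ℝ) < K := hK
  have h1 := h.isLittleO.bound (show (0 : ℝ) < (K : ℝ)⁻¹ / 2 by positivity)
  filter_upwards [h1] with y hy hne
  have h2 := hKT.le_mul_dist (y - x) 0
  simp only [dist_zero_right, map_zero] at h2
  have h2' : ‖y - x‖ ≤ K * ‖T (y - x)‖ := h2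
  have h3 : 0 < ‖y - x‖ := norm_pos_iff.2 (sub_ne_zero.2 hne)
  refine hy.trans_lt ?_
  rw [div_mul_eq_mul_div, div_lt_iff₀ two_pos, inv_mul_lt_iff₀ hK']
  nlinarith

/-! ### Charts of an oriented surface -/

section Charts

variable {M : Type*} [TopologicalSpace M] [ChartedSpace Plane M] [IsManifold (𝓡 2) ∞ M]

theorem contDiffAt_transition {e e' : OpenPartialHomeomorph M Plane} (he : e ∈ atlas Plane M)
    (he' : e' ∈ atlas Plane M) {x : M} (hx : x ∈ e.source) (hx' : x ∈ e'.source) :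
    ContDiffAt ℝ ∞ (e' ∘ e.symm) (e x) := by
  have h := ModelWithCorners.contDiffOn_extendCoordChange (I := 𝓡 2) (n := ∞)
    (IsManifold.subset_maximalAtlas he) (IsManifold.subset_maximalAtlas he')
  have hs : ((𝓡 2).extendCoordChange e e').source ∈ 𝓝 (e x) := by
    have := ModelWithCorners.extendCoordChange_source_mem_nhdsWithin' (I := 𝓡 2) hx hx'
    simpa using this
  exact h.contDiffAt hs

theorem exists_hasStrictFDerivAt_transition [OrientedSurface M]
    {e e' : OpenPartialHomeomorph M Plane} (he : e ∈ atlas Plane M)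
    (he' : e' ∈ atlas Plane M) {x : M} (hx : x ∈ e.source) (hx' : x ∈ e'.source) :
    ∃ T : Plane →L[ℝ] Plane, 0 < T.det ∧ HasStrictFDerivAt (e' ∘ e.symm) T (e x) := by
  refine ⟨_, ?_, (contDiffAt_transition he he' hx hx').hasStrictFDerivAt (by simp)⟩
  refine OrientedSurface.det_pos e he e' he' (e x) ?_
  rw [OpenPartialHomeomorph.trans_source, OpenPartialHomeomorph.symm_source]
  exact ⟨e.map_source hx, by simpa [e.left_inv hx] using hx'⟩

end Charts

/-! ### Local parametrizations and winding numbers -/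

section Oriented

variable {M : Type*} [TopologicalSpace M] [ChartedSpace Plane M]

/-- Near the point `p`, the map `F` from the parameter plane to a surface is a local homeomorphism
that is close to an orientation preserving linear map in some chart. -/
def OrientedAt (F : ℝ × ℝ → M) (p : ℝ × ℝ) : Prop :=
  ∃ Ψ : OpenPartialHomeomorph (ℝ × ℝ) M, p ∈ Ψ.source ∧ EqOn F Ψ Ψ.source ∧
    ∃ e ∈ atlas Plane M, ∃ L : ℝ × ℝ →L[ℝ] Plane, 0 < planeDet (L (1, 0)) (L (0, 1)) ∧
      (∀ q ∈ Ψ.source, F q ∈ e.source) ∧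
      ∀ q ∈ Ψ.source, ∀ q' ∈ Ψ.source, q ≠ q' → ‖e (F q) - e (F q') - L (q - q')‖ < ‖L (q - q')‖

namespace OrientedAt

variable {F : ℝ × ℝ → M} {p : ℝ × ℝ}

/-- The estimate in `OrientedAt` compares all pairs of points of the source and mentions no
derivative. This makes the condition open, although the bands below are only known to be strictly
differentiable at points of the core. -/
theorem eventually (h : OrientedAt F p) : ∀ᶠ q in 𝓝 p, OrientedAt F q := by
  obtain ⟨Ψ, hp, hΨ⟩ := h
  filter_upwards [Ψ.open_source.mem_nhds hp] with q hq
  exact ⟨Ψ, hq, hΨ⟩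

theorem exists_injOn (h : OrientedAt F p) : ∃ U ∈ 𝓝 p, InjOn F U := by
  obtain ⟨Ψ, hp, hΨ, -⟩ := h
  exact ⟨Ψ.source, Ψ.open_source.mem_nhds hp, Ψ.injOn.congr hΨ.symm⟩

theorem continuousAt (h : OrientedAt F p) : ContinuousAt F p := by
  obtain ⟨Ψ, hp, hΨ, -⟩ := h
  exact (Ψ.continuousAt hp).congr (hΨ.symm.eventuallyEq_of_mem (Ψ.open_source.mem_nhds hp))

theorem map_nhds_eq (h : OrientedAt F p) : map F (𝓝 p) = 𝓝 (F p) := by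
  obtain ⟨Ψ, hp, hΨ, -⟩ := h
  rw [hΨ hp, ← Ψ.map_nhds_eq hp]
  exact Filter.map_congr (hΨ.eventuallyEq_of_mem (Ψ.open_source.mem_nhds hp))

/-- By strict differentiability the error of the linear approximation is Lipschitz with arbitrarily
small constant near `p`. A constant below `‖L⁻¹‖⁻¹` gives a local homeomorphism; half of it is
taken, which also yields the strict inequality between the norms. -/
theorem of_hasStrictFDerivAt {e : OpenPartialHomeomorph M Plane} (he : e ∈ atlas Plane M)
    {L : ℝ × ℝ →L[ℝ] Plane} (hL : 0 < planeDet (L (1, 0)) (L (0, 1)))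
    (hF : HasStrictFDerivAt (fun q => e (F q)) L p) (hs : ∀ᶠ q in 𝓝 p, F q ∈ e.source) :
    OrientedAt F p := by
  obtain ⟨L', rfl⟩ := Plane.exists_equiv L hL.ne'
  obtain ⟨s, hps, hso, hsa⟩ := hF.approximates_deriv_on_open_nhds
  obtain ⟨s', hs's, hs'o, hps'⟩ := _root_.mem_nhds_iff.1 hs
  have hsub := hsa.mono_set (inter_subset_left (t := s'))
  have hnt : Nontrivial (ℝ × ℝ) := inferInstance
  have hc : ‖(L'.symm : Plane →L[ℝ] ℝ × ℝ)‖₊⁻¹ / 2 < ‖(L'.symm : Plane →L[ℝ] ℝ × ℝ)‖₊⁻¹ :=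
    NNReal.half_lt_self (inv_ne_zero (ne_of_gt (by exact_mod_cast L'.symm.norm_pos)))
  set φ := hsub.toOpenPartialHomeomorph (fun q => e (F q)) (s ∩ s') (Or.inr hc)
    (hso.inter hs'o) with hφ
  have hφs : φ.source = s ∩ s' := rfl
  have hφc : ∀ q, φ q = e (F q) := fun q => rfl
  have hsrc : (φ.trans e.symm).source = s ∩ s' := by
    rw [OpenPartialHomeomorph.trans_source, hφs]
    refine inter_eq_left.2 fun q hq => ?_
    rw [mem_preimage, hφc]
    exact e.map_source (hs's hq.2)
  refine ⟨φ.trans e.symm, ?_, ?_, e, he, L', hL, ?_, ?_⟩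
  · rw [hsrc]; exact ⟨hps, hps'⟩
  · intro q hq
    rw [hsrc] at hq
    rw [OpenPartialHomeomorph.coe_trans, Function.comp, hφc, e.left_inv (hs's hq.2)]
  · intro q hq
    rw [hsrc] at hq
    exact hs's hq.2
  · intro q hq q' hq' hne
    rw [hsrc] at hq hq'
    refine (hsub q hq q' hq').trans_lt ?_
    have h1 : 0 < ‖q - q'‖ := norm_pos_iff.2 (sub_ne_zero.2 hne)
    have h2 : ‖q - q'‖ ≤ ‖(L'.symm : Plane →L[ℝ] ℝ × ℝ)‖ * ‖L' (q - q')‖ := by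
      simpa using (L'.symm : Plane →L[ℝ] ℝ × ℝ).le_opNorm (L' (q - q'))
    have h3 : 0 < ‖(L'.symm : Plane →L[ℝ] ℝ × ℝ)‖ := L'.symm.norm_pos
    rw [NNReal.coe_div, NNReal.coe_inv, coe_nnnorm, NNReal.coe_ofNat, div_mul_eq_mul_div,
      div_lt_iff₀ two_pos, inv_mul_lt_iff₀ h3]
    change ‖q - q'‖ < ‖(L'.symm : Plane →L[ℝ] ℝ × ℝ)‖ * (‖L' (q - q')‖ * 2)
    nlinarith

end OrientedAt

theorem unitVec_periodic : unitVec.Periodic (2 * Real.pi) := fun t => by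
  simp [unitVec]

theorem continuous_unitVec : Continuous unitVec := by
  unfold unitVec; fun_prop

theorem norm_unitVec (t : ℝ) : ‖unitVec t‖ = 1 := by
  have h : ‖unitVec t‖ ^ 2 = 1 := by
    rw [Plane.norm_sq]
    simp [unitVec]
  nlinarith [norm_nonneg (unitVec t)]

/-- The winding condition of `PreservesOrientation` holds at a point near which the map is
`F q ↦ F' (Φ q)`, for orientation preserving parametrizations `F`, `F'` and a monotone map `Φ`. -/
theorem winding_of_orientedAt [IsManifold (𝓡 2) ∞ M] [OrientedSurface M]
    {M' : Type*} [TopologicalSpace M'] [ChartedSpace Plane M'] [IsManifold (𝓡 2) ∞ M']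
    [OrientedSurface M'] {N : Set M} {N' : Set M'} (h : N → N') (x : N)
    (hx : (x : M) ∈ interior N) {F : ℝ × ℝ → M} {F' : ℝ × ℝ → M'} {p : ℝ × ℝ} {Φ : ℝ × ℝ → ℝ × ℝ}
    (hF : OrientedAt F p) (hp : F p = x) (hF' : OrientedAt F' (Φ p)) (hp' : F' (Φ p) = h x)
    (hΦ : Continuous Φ)
    (hmono : ∀ q, q ≠ p → 0 < (q.1 - p.1) * ((Φ q).1 - (Φ p).1) + (q.2 - p.2) * ((Φ q).2 - (Φ p).2))
    (hcomp : ∀ᶠ q in 𝓝 p, ∀ y : N, (y : M) = F q → (h y : M') = F' (Φ q)) :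
    ∀ᶠ r : ℝ in 𝓝[>] 0,
      ∃ θ : ℝ → ℝ, Continuous θ ∧ θ (2 * Real.pi) = θ 0 + 2 * Real.pi ∧
        ∀ t ∈ Icc 0 (2 * Real.pi), ∃ y : N,
          (y : M) ∈ (chartAt Plane (x : M)).source ∧
          chartAt Plane (x : M) y = chartAt Plane (x : M) x + r • unitVec t ∧
          (h y : M') ∈ (chartAt Plane (h x : M')).source ∧
          ∃ ρ > (0 : ℝ), chartAt Plane (h x : M') (h y) =
            chartAt Plane (h x : M') (h x) + ρ • unitVec (θ t) := by
  have hF'c := hF'.continuousAt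
  obtain ⟨Ψ, hpΨ, hΨ, e, he, L, hL, hes, hLa⟩ := hF
  obtain ⟨Ψ', hpΨ', hΨ', e', he', L', hL', hes', hLa'⟩ := hF'
  set c := chartAt Plane (x : M) with hc
  set c' := chartAt Plane (h x : M') with hc'
  have hcx : (x : M) ∈ c.source := mem_chart_source Plane (x : M)
  have hcx' : (h x : M') ∈ c'.source := mem_chart_source Plane (h x : M')
  have hex : (x : M) ∈ e.source := hp ▸ hes p hpΨ
  have hex' : (h x : M') ∈ e'.source := hp' ▸ hes' _ hpΨ'
  obtain ⟨T, hT, hTd⟩ := exists_hasStrictFDerivAt_transition (e := c)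
    (chart_mem_atlas Plane (x : M)) he
    hcx hex
  obtain ⟨T', hT', hTd'⟩ := exists_hasStrictFDerivAt_transition (e' := c') he'
    (chart_mem_atlas Plane (h x : M')) hex' hcx'
  have hTinj : Function.Injective T := (injective_iff_map_eq_zero T).2 fun v hv => by
    by_contra hne
    exact Plane.ne_zero_of_det' T hT.ne' hne hv
  have hTinj' : Function.Injective T' := (injective_iff_map_eq_zero T').2 fun v hv => by
    by_contra hne
    exact Plane.ne_zero_of_det' T' hT'.ne' hne hv
  set Y : Plane → M := fun v => c.symm (c x + v) with hY
  set Q : Plane → ℝ × ℝ := fun v => Ψ.symm (Y v) with hQ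
  have hY0 : Y 0 = x := by simp [hY, c.left_inv hcx]
  have hQ0 : Q 0 = p := by
    rw [hQ]; simp only [hY0]
    rw [← hp, hΨ hpΨ, Ψ.left_inv hpΨ]
  have hxΨ : (x : M) ∈ Ψ.target := by
    rw [← hp, hΨ hpΨ]; exact Ψ.map_source hpΨ
  have hYc : ∀ v, c x + v ∈ c.target → ContinuousAt Y v := fun v hv =>
    ContinuousAt.comp (f := fun v => c x + v) (g := c.symm) (c.symm.continuousAt hv)
      (by fun_prop)
  have hY0c : Tendsto Y (𝓝 0) (𝓝 (x : M)) := by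
    have := hYc 0 (by simpa using c.map_source hcx)
    rwa [ContinuousAt, hY0] at this
  have hQ0c : Tendsto Q (𝓝 0) (𝓝 p) := by
    have := ((Ψ.symm.continuousAt hxΨ).tendsto).comp hY0c
    rwa [← hY0, show Ψ.symm (Y 0) = p from hQ0] at this
  have hΦQ : Tendsto (fun v => Φ (Q v)) (𝓝 0) (𝓝 (Φ p)) := (hΦ.tendsto p).comp hQ0c
  have hF'Q : Tendsto (fun v => F' (Φ (Q v))) (𝓝 0) (𝓝 (h x : M')) := by
    have := hF'c.tendsto.comp hΦQ
    rwa [hp'] at this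
  have g1 : ∀ᶠ v in 𝓝 (0 : Plane), c x + v ∈ c.target := by
    have : Tendsto (fun v : Plane => c x + v) (𝓝 0) (𝓝 (c x)) := by
      have h0 : ContinuousAt (fun v : Plane => c x + v) 0 := by fun_prop
      simpa [ContinuousAt] using h0
    exact this (c.open_target.mem_nhds (c.map_source hcx))
  have g2 : ∀ᶠ v in 𝓝 (0 : Plane), Y v ∈ Ψ.target := hY0c (Ψ.open_target.mem_nhds hxΨ)
  have g3 : ∀ᶠ v in 𝓝 (0 : Plane), Y v ∈ N := hY0c (mem_interior_iff_mem_nhds.1 hx)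
  have g4 := hQ0c.eventually hcomp
  have g5 : ∀ᶠ v in 𝓝 (0 : Plane), Φ (Q v) ∈ Ψ'.source := hΦQ (Ψ'.open_source.mem_nhds hpΨ')
  have g6 : ∀ᶠ v in 𝓝 (0 : Plane), F' (Φ (Q v)) ∈ c'.source := hF'Q (c'.open_source.mem_nhds hcx')
  have g7 : ∀ᶠ v in 𝓝 (0 : Plane), v ≠ 0 → ‖e (Y v) - e x - T v‖ < ‖T v‖ := by
    have h1 := hTd.hasFDerivAt.eventually_norm_sub_lt hTinj
    have : Tendsto (fun v : Plane => c x + v) (𝓝 0) (𝓝 (c x)) := by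
      have h0 : ContinuousAt (fun v : Plane => c x + v) 0 := by fun_prop
      simpa [ContinuousAt] using h0
    filter_upwards [this.eventually h1] with v hv hne
    have := hv (by simpa using hne)
    simpa [c.left_inv hcx, hY] using this
  have g8 : ∀ᶠ v in 𝓝 (0 : Plane), e' (F' (Φ (Q v))) ≠ e' (h x) →
      ‖c' (F' (Φ (Q v))) - c' (h x) - T' (e' (F' (Φ (Q v))) - e' (h x))‖
        < ‖T' (e' (F' (Φ (Q v))) - e' (h x))‖ := by
    have h1 := hTd'.hasFDerivAt.eventually_norm_sub_lt hTinj'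
    have h2 : Tendsto (fun v => e' (F' (Φ (Q v)))) (𝓝 0) (𝓝 (e' (h x))) :=
      (e'.continuousAt hex').tendsto.comp hF'Q
    filter_upwards [h2.eventually h1, g5] with v hv h5 hne
    have := hv hne
    simpa [e'.left_inv hex', e'.left_inv (hes' _ h5)] using this
  obtain ⟨R, hR, hall⟩ := Metric.eventually_nhds_iff_ball.1
    ((((((g1.and g2).and g3).and g4).and g5).and g6).and (g7.and g8))
  filter_upwards [Ioo_mem_nhdsGT hR] with r hr
  set V : ℝ → Plane := fun t => r • unitVec t with hV
  have hVp : V.Periodic (2 * Real.pi) := fun t => by simp only [hV, unitVec_periodic t]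
  have hVc : Continuous V := continuous_unitVec.const_smul r
  have hVn : ∀ t, ‖V t‖ = r := fun t => by simp [hV, norm_smul, norm_unitVec, abs_of_pos hr.1]
  have hV0 : ∀ t, V t ≠ 0 := fun t => norm_pos_iff.1 ((hVn t).symm ▸ hr.1)
  have hVall := fun t => hall (V t) (by simpa [hVn t] using hr.2)
  have k1 := fun t => (hVall t).1.1.1.1.1.1
  have k2 := fun t => (hVall t).1.1.1.1.1.2
  have k3 := fun t => (hVall t).1.1.1.1.2
  have k4 := fun t => (hVall t).1.1.1.2
  have k5 := fun t => (hVall t).1.1.2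
  have k6 := fun t => (hVall t).1.2
  have k7 := fun t => (hVall t).2.1 (hV0 t)
  have k8 := fun t => (hVall t).2.2
  have hYV : Continuous fun t => Y (V t) := continuous_iff_continuousAt.2 fun t =>
    ContinuousAt.comp (g := Y) (hYc _ (k1 t)) hVc.continuousAt
  have hQV : Continuous fun t => Q (V t) := continuous_iff_continuousAt.2 fun t =>
    ContinuousAt.comp (g := Ψ.symm) (Ψ.symm.continuousAt (k2 t)) hYV.continuousAt
  have hQs : ∀ t, Q (V t) ∈ Ψ.source := fun t => Ψ.map_target (k2 t)
  have hFQ : ∀ t, F (Q (V t)) = Y (V t) := fun t => by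
    rw [hΨ (hQs t)]; exact Ψ.right_inv (k2 t)
  have hYx : ∀ t, Y (V t) ≠ x := fun t h0 => by
    have h1 : c (Y (V t)) = c x + V t := c.right_inv (k1 t)
    rw [h0] at h1
    exact hV0 t (by simpa using h1)
  have hQp : ∀ t, Q (V t) ≠ p := fun t h0 => hYx t (by rw [← hFQ t, h0, hp])
  have hΦQV : Continuous fun t => Φ (Q (V t)) := hΦ.comp hQV
  have hΦne : ∀ t, Φ (Q (V t)) ≠ Φ p := fun t h0 => by
    have := hmono _ (hQp t)
    simp [h0] at this
  have hF'V : Continuous fun t => F' (Φ (Q (V t))) := continuous_iff_continuousAt.2 fun t =>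
    ContinuousAt.comp (g := F')
      (OrientedAt.continuousAt ⟨Ψ', k5 t, hΨ', e', he', L', hL', hes', hLa'⟩) hΦQV.continuousAt
  -- The winding number is followed from the circle in the chart at `x` to its image in the chart at
  -- `h x`. Each step applies or inverts a linear map of positive determinant, replaces a map by a
  -- sufficiently close linear one, or, in `w6`, uses the monotonicity of `Φ`.
  have w1 : WindsOnce (fun t => V t 0) fun t => V t 1 := by
    simpa [hV, unitVec] using WindsOnce.circle hr.1
  have w2 := w1.map_plane hVc hVp hT
  have heY : Continuous fun t => e (Y (V t)) - e x := by
    refine (continuous_iff_continuousAt.2 fun t => ?_).sub continuous_const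
    exact ContinuousAt.comp (g := e) (e.continuousAt (hFQ t ▸ hes _ (hQs t))) hYV.continuousAt
  have w3 := w2.of_norm_sub_lt (c' := fun t => e (Y (V t)) - e x) (T.continuous.comp hVc) heY
    (fun t => by simp only [hVp t]) (fun t => by simp only [hVp t]) (fun t => Or.inl (k7 t))
  have w4 := w3.of_norm_sub_lt (c' := fun t => L (Q (V t) - p)) heY
    (L.continuous.comp (hQV.sub continuous_const))
    (fun t => by simp only [hVp t]) (fun t => by simp only [hVp t]) (fun t => Or.inr (by
      have := hLa _ (hQs t) p hpΨ (hQp t)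
      rw [norm_sub_rev]
      rwa [hFQ, hp] at this))
  have w5 := w4.of_map_prod (hQV.sub continuous_const) (fun t => by simp only [hVp t]) hL
  have w6 := w5.of_monotone (q' := fun t => Φ (Q (V t)) - Φ p) (hQV.sub continuous_const)
    (hΦQV.sub continuous_const) (fun t => by simp only [hVp t]) (fun t => by simp only [hVp t])
    (fun t => hmono _ (hQp t))
  have w7 := w6.map_prod (hΦQV.sub continuous_const) (fun t => by simp only [hVp t]) hL'
  have heF' : Continuous fun t => e' (F' (Φ (Q (V t)))) - e' (h x) := by
    refine (continuous_iff_continuousAt.2 fun t => ?_).sub continuous_const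
    exact ContinuousAt.comp (g := e') (e'.continuousAt (hes' _ (k5 t))) hF'V.continuousAt
  have hlt' : ∀ t, ‖e' (F' (Φ (Q (V t)))) - e' (h x) - L' (Φ (Q (V t)) - Φ p)‖
      < ‖L' (Φ (Q (V t)) - Φ p)‖ := fun t => by
    have := hLa' _ (k5 t) _ hpΨ' (hΦne t)
    rwa [hp'] at this
  have w8 := w7.of_norm_sub_lt (c' := fun t => e' (F' (Φ (Q (V t)))) - e' (h x))
    (L'.continuous.comp (hΦQV.sub continuous_const)) heF'
    (fun t => by simp only [hVp t]) (fun t => by simp only [hVp t]) (fun t => Or.inl (hlt' t))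
  have w9 := w8.map_plane heF' (fun t => by simp only [hVp t]) hT'
  have hcF' : Continuous fun t => c' (F' (Φ (Q (V t)))) - c' (h x) := by
    refine (continuous_iff_continuousAt.2 fun t => ?_).sub continuous_const
    exact ContinuousAt.comp (g := c') (c'.continuousAt (k6 t)) hF'V.continuousAt
  have hne' : ∀ t, e' (F' (Φ (Q (V t)))) ≠ e' (h x) := fun t h0 => by
    have := hlt' t
    rw [h0, sub_self, zero_sub, norm_neg] at this
    exact lt_irrefl _ this
  have w10 := w9.of_norm_sub_lt (c' := fun t => c' (F' (Φ (Q (V t)))) - c' (h x))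
    (T'.continuous.comp heF') hcF'
    (fun t => by simp only [hVp t]) (fun t => by simp only [hVp t])
    (fun t => Or.inl (k8 t (hne' t)))
  obtain ⟨θ, hθ, hθp, hxy⟩ := w10
  refine ⟨θ, hθ, by simpa using hθp 0, fun t _ => ?_⟩
  have hhy : (h ⟨Y (V t), k3 t⟩ : M') = F' (Φ (Q (V t))) := k4 t _ (hFQ t).symm
  refine ⟨⟨Y (V t), k3 t⟩, c.map_target (k1 t), c.right_inv (k1 t), ?_, ?_⟩
  · rw [hhy]; exact k6 t
  · obtain ⟨ρ, hρ, e0, e1⟩ := hxy t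
    refine ⟨ρ, hρ, ?_⟩
    rw [hhy, ← sub_eq_iff_eq_add']
    ext i
    fin_cases i
    · simpa [unitVec] using e0
    · simpa [unitVec] using e1

end Oriented

/-! ### Homeomorphisms and the signs of crossings -/

theorem WindsOnce.of_Icc {x y : ℝ → ℝ} (px : x.Periodic (2 * Real.pi))
    (py : y.Periodic (2 * Real.pi)) {θ : ℝ → ℝ} (hθ : Continuous θ)
    (hθp : θ (2 * Real.pi) = θ 0 + 2 * Real.pi)
    (h : ∀ t ∈ Icc 0 (2 * Real.pi), ∃ ρ > (0 : ℝ), x t = ρ * Real.cos (θ t) ∧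
      y t = ρ * Real.sin (θ t)) : WindsOnce x y := by
  obtain ⟨g, hg, hgp, hgθ⟩ := exists_quasiperiodic_extension hθ (b := 0) (by simpa using hθp)
  refine ⟨g, hg, hgp, fun t => ?_⟩
  obtain ⟨k, hk, -⟩ := existsUnique_add_zsmul_mem_Ico Real.two_pi_pos t 0
  set t₀ := t + k • (2 * Real.pi) with ht₀
  have hk' : t₀ ∈ Icc 0 (2 * Real.pi) := by
    rw [zero_add] at hk
    exact Ico_subset_Icc_self hk
  obtain ⟨ρ, hρ, e1, e2⟩ := h t₀ hk'
  have hx : x t₀ = x t := px.zsmul k t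
  have hy : y t₀ = y t := py.zsmul k t
  have hgt : g t₀ = θ t₀ := hgθ t₀ (by simpa using hk')
  have hcos : Real.cos (g t₀) = Real.cos (g t) := by
    have hper : Function.Periodic (fun s => Real.cos (g s)) (2 * Real.pi) := fun s => by
      simp only [hgp, Real.cos_add_two_pi]
    exact hper.zsmul k t
  have hsin : Real.sin (g t₀) = Real.sin (g t) := by
    have hper : Function.Periodic (fun s => Real.sin (g s)) (2 * Real.pi) := fun s => by
      simp only [hgp, Real.sin_add_two_pi]
    exact hper.zsmul k t
  exact ⟨ρ, hρ, by rw [← hx, e1, ← hgt, hcos], by rw [← hy, e2, ← hgt, hsin]⟩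

theorem exists_eq_smul_unitVec {v : Plane} {r : ℝ} (hv : ‖v‖ = r) : ∃ t, v = r • unitVec t := by
  set w : ℂ := ⟨v 0, v 1⟩ with hw
  have hn : ‖w‖ = r := by
    rw [Complex.norm_def, Complex.normSq_apply, ← hv, ← Real.sqrt_sq (norm_nonneg v),
      Plane.norm_sq]
    congr 1
    simp [hw]
    ring
  refine ⟨Complex.arg w, ?_⟩
  ext i
  fin_cases i
  · simpa [unitVec, hn] using (Complex.norm_mul_cos_arg w).symm
  · simpa [unitVec, hn] using (Complex.norm_mul_sin_arg w).symm

theorem planeDet_smul_unitVec (r t α : ℝ) :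
    planeDet (r • unitVec t) (r • unitVec α) = r ^ 2 * Real.sin (α - t) := by
  rw [Real.sin_sub]
  simp [planeDet, unitVec]
  ring

/-- Two strands through the origin whose velocities form a positively oriented basis. -/
theorem exists_forall_planeDet_pos {σ τ : ℝ → Plane} {u v : Plane} (hσ : HasDerivAt σ u 0)
    (hσ0 : σ 0 = 0) (hτ : HasDerivAt τ v 0) (hτ0 : τ 0 = 0) (huv : 0 < planeDet u v) :
    ∃ η > 0, ∀ a ∈ Ioo (-η) η, ∀ b ∈ Ioo 0 η, a ≠ 0 → 0 < a * planeDet (σ a) (τ b) := by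
  have h1 := hasDerivAt_iff_tendsto_slope.1 hσ
  have h2 := hasDerivAt_iff_tendsto_slope.1 hτ
  have h3 : Tendsto (fun p : ℝ × ℝ => planeDet (slope σ 0 p.1) (slope τ 0 p.2))
      (𝓝[≠] 0 ×ˢ 𝓝[≠] 0) (𝓝 (planeDet u v)) := by
    have hc : Continuous fun p : Plane × Plane => planeDet p.1 p.2 := by
      unfold planeDet; fun_prop
    exact (hc.tendsto (u, v)).comp ((h1.prodMap h2).mono_right (by rw [nhds_prod_eq]))
  have h4 := h3.eventually (eventually_gt_nhds huv)
  rw [eventually_prod_iff] at h4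
  obtain ⟨pa, ha, pb, hb, hab⟩ := h4
  rw [eventually_nhdsWithin_iff, Metric.eventually_nhds_iff] at ha hb
  obtain ⟨ε₁, h₁, ha⟩ := ha
  obtain ⟨ε₂, h₂, hb⟩ := hb
  refine ⟨min ε₁ ε₂, lt_min h₁ h₂, fun a haa b hbb ha0 => ?_⟩
  have h5 : |a| < min ε₁ ε₂ := abs_lt.2 haa
  have h6 : |b| < min ε₁ ε₂ := abs_lt.2 ⟨by linarith [hbb.1, lt_min h₁ h₂], hbb.2⟩
  have h7 := hab (ha (by simpa using h5.trans_le (min_le_left _ _)) (by simpa using ha0))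
    (hb (by simpa using h6.trans_le (min_le_right _ _)) (by simpa using hbb.1.ne'))
  simp only [slope_def_module, sub_zero, hσ0, hτ0] at h7
  have h8 : planeDet (a⁻¹ • σ a) (b⁻¹ • τ b) = a⁻¹ * b⁻¹ * planeDet (σ a) (τ b) := by
    simp [planeDet]; ring
  rw [h8] at h7
  have h9 : a * planeDet (σ a) (τ b) = (a ^ 2 * b) * (a⁻¹ * b⁻¹ * planeDet (σ a) (τ b)) := by
    field_simp [hbb.1.ne']
  rw [h9]
  have := hbb.1
  positivity

theorem GenericCurve.continuous_comp_exp {M : Type*} [TopologicalSpace M] [ChartedSpace Plane M]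
    (γ : GenericCurve M) : Continuous fun t : ℝ => γ (Circle.exp t) :=
  γ.contMDiff.continuous.comp Circle.exp.continuous

section Curves

variable {M : Type*} [TopologicalSpace M] [ChartedSpace Plane M] [IsManifold (𝓡 2) ∞ M]

namespace GenericCurve

theorem contDiffAt_chart (γ : GenericCurve M) {e : OpenPartialHomeomorph M Plane}
    (he : e ∈ atlas Plane M) {t : ℝ} (ht : γ (Circle.exp t) ∈ e.source) :
    ContDiffAt ℝ ∞ (fun s : ℝ => e (γ (Circle.exp s))) t := by
  have h1 : ContMDiffAt (𝓡 2) (𝓡 2) ∞ e (γ (Circle.exp t)) :=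
    contMDiffAt_of_mem_maximalAtlas (IsManifold.subset_maximalAtlas he) ht
  exact contMDiffAt_iff_contDiffAt.1 (h1.comp t (γ.contMDiff_comp_exp t))

theorem hasStrictDerivAt_chartAt (γ : GenericCurve M) (t : ℝ) :
    HasStrictDerivAt (fun s : ℝ => chartAt Plane (γ (Circle.exp t)) (γ (Circle.exp s)))
      (curveVelocity γ t) t := by
  rw [curveVelocity_eq_deriv]
  exact (γ.contDiffAt_chart (chart_mem_atlas _ _) (mem_chart_source _ _)).hasStrictDerivAt
    (by simp)

end GenericCurve
end Curves

set_option maxHeartbeats 800000 in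
/-- An orientation preserving homeomorphism of neighborhoods of two curves that maps the first curve
to the second one preserves the signs of the crossings. -/
theorem planeDet_pos_of_preservesOrientation {M : Type*} [TopologicalSpace M]
    [ChartedSpace Plane M] [IsManifold (𝓡 2) ∞ M]
    {M' : Type*} [TopologicalSpace M'] [ChartedSpace Plane M'] [IsManifold (𝓡 2) ∞ M']
    (γ : GenericCurve M) (δ : GenericCurve M') {N : Set M} {N' : Set M'} (h : N ≃ₜ N')
    (hor : PreservesOrientation h) (hN : ∀ z, N ∈ 𝓝 (γ z)) {g : ℝ → ℝ} (hg : Continuous g)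
    (hgm : StrictMono g)
    (hgh : ∀ (t : ℝ) (y : N), (y : M) = γ (Circle.exp t) → (h y : M') = δ (Circle.exp (g t)))
    {s t : ℝ} (hst : γ (Circle.exp s) = γ (Circle.exp t))
    (hdet' : planeDet (curveVelocity δ (g s)) (curveVelocity δ (g t)) ≠ 0)
    (hdet : 0 < planeDet (curveVelocity γ s) (curveVelocity γ t)) :
    0 < planeDet (curveVelocity δ (g s)) (curveVelocity δ (g t)) := by
  classical
  by_contra hneg
  replace hneg := lt_of_le_of_ne (not_lt.1 hneg) hdet'
  have hNγ : ∀ z, γ z ∈ N := fun z => mem_of_mem_nhds (hN z)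
  set x : N := ⟨γ (Circle.exp s), hNγ _⟩ with hx
  have hhx : (h x : M') = δ (Circle.exp (g s)) := hgh s x rfl
  have hhx' : (h x : M') = δ (Circle.exp (g t)) := hgh t x hst
  set c := chartAt Plane (x : M) with hc
  set c' := chartAt Plane (h x : M') with hc'
  have hcx : (x : M) ∈ c.source := mem_chart_source Plane (x : M)
  have hcx' : (h x : M') ∈ c'.source := mem_chart_source Plane (h x : M')
  set u := curveVelocity γ s
  set v := curveVelocity γ t
  set u' := curveVelocity δ (g s)
  set v' := curveVelocity δ (g t)
  -- the strands in the charts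
  set σ : ℝ → Plane := fun a => c (γ (Circle.exp (s + a))) - c x with hσ
  set τ : ℝ → Plane := fun a => c (γ (Circle.exp (t + a))) - c x with hτ
  set σ' : ℝ → Plane := fun a => c' (δ (Circle.exp (g s + a))) - c' (h x) with hσ'
  set τ' : ℝ → Plane := fun a => c' (δ (Circle.exp (g t + a))) - c' (h x) with hτ'
  have hσd : HasDerivAt σ u 0 := by
    have h1 := (γ.hasStrictDerivAt_chartAt s).hasDerivAt
    refine HasDerivAt.sub_const (c x) ?_
    rw [← add_zero s] at h1
    simpa only [add_zero] using h1.comp_const_add s 0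
  have hτd : HasDerivAt τ v 0 := by
    have h1 := (γ.hasStrictDerivAt_chartAt t).hasDerivAt
    rw [← hst] at h1
    refine HasDerivAt.sub_const (c x) ?_
    rw [← add_zero t] at h1
    simpa only [add_zero] using h1.comp_const_add t 0
  have hσ'd : HasStrictDerivAt σ' u' 0 := by
    have h0 := δ.hasStrictDerivAt_chartAt (g s)
    rw [← hhx] at h0
    have h2 : HasStrictDerivAt (fun a : ℝ => g s + a) 1 0 := (hasStrictDerivAt_id _).const_add _
    have h1 : HasStrictDerivAt (fun a => c' (δ (Circle.exp a))) u' (g s + 0) := by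
      rw [add_zero]; exact h0
    have h3 := h1.scomp 0 h2
    rw [one_smul] at h3
    exact h3.sub_const (c' (h x))
  have hτ'd : HasStrictDerivAt τ' v' 0 := by
    have h0 := δ.hasStrictDerivAt_chartAt (g t)
    rw [← hhx'] at h0
    have h2 : HasStrictDerivAt (fun a : ℝ => g t + a) 1 0 := (hasStrictDerivAt_id _).const_add _
    have h1 : HasStrictDerivAt (fun a => c' (δ (Circle.exp a))) v' (g t + 0) := by
      rw [add_zero]; exact h0
    have h3 := h1.scomp 0 h2
    rw [one_smul] at h3
    exact h3.sub_const (c' (h x))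
  have hσ0 : σ 0 = 0 := by simp [hσ, hx]
  have hτ0 : τ 0 = 0 := by simp [hτ, hx, hst]
  have hσ'0 : σ' 0 = 0 := by simp [hσ', hhx]
  have hτ'0 : τ' 0 = 0 := by simp [hτ', hhx']
  -- coordinates adapted to the strand `σ'`
  set f : ℝ × ℝ → Plane := fun p => σ' p.1 + p.2 • v' with hf
  set L : ℝ × ℝ →L[ℝ] Plane := (ContinuousLinearMap.fst ℝ ℝ ℝ).smulRight u'
    + (ContinuousLinearMap.snd ℝ ℝ ℝ).smulRight v' with hL
  have hL1 : L (1, 0) = u' := by simp [hL]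
  have hL2 : L (0, 1) = v' := by simp [hL]
  have hLdet : planeDet (L (1, 0)) (L (0, 1)) < 0 := by rwa [hL1, hL2]
  have hfd : HasStrictFDerivAt f L 0 := by
    refine HasStrictFDerivAt.add ?_ ?_
    · have h1 : HasStrictDerivAt σ' u' ((0 : ℝ × ℝ).1) := hσ'd
      exact h1.hasStrictFDerivAt.comp 0 hasStrictFDerivAt_fst
    · exact ((ContinuousLinearMap.snd ℝ ℝ ℝ).smulRight v').hasStrictFDerivAt
  have hf0 : f 0 = 0 := by simp [hf, hσ'0]
  obtain ⟨L', hL'⟩ := Plane.exists_equiv L hLdet.ne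
  rw [← hL'] at hfd
  set Ψ := hfd.toOpenPartialHomeomorph f with hΨ
  have hΨf : ∀ p, Ψ p = f p := fun p => rfl
  have hΨ0 : (0 : ℝ × ℝ) ∈ Ψ.source := hfd.mem_toOpenPartialHomeomorph_source
  have h0Ψ : (0 : Plane) ∈ Ψ.target := by
    have := Ψ.map_source hΨ0
    rwa [hΨf, hf0] at this
  have hΨs0 : Ψ.symm 0 = 0 := by
    have := Ψ.left_inv hΨ0
    rwa [hΨf, hf0] at this
  have hΨsd : HasStrictFDerivAt Ψ.symm (L'.symm : Plane →L[ℝ] ℝ × ℝ) 0 := by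
    refine Ψ.hasStrictFDerivAt_symm h0Ψ ?_
    rw [hΨs0]
    exact hfd
  -- the homeomorphism in the charts
  set H : M → M' := fun y => if hy : y ∈ N then (h ⟨y, hy⟩ : M') else h x with hH
  have hHN : ∀ y : N, H y = h y := fun y => by simp [hH, y.2]
  have hHc : ∀ y ∈ interior N, ContinuousAt H y := by
    intro y hy
    have h1 : ContinuousOn H N := by
      rw [continuousOn_iff_continuous_domRestrict]
      have : N.domRestrict H = fun y => (h y : M') := by
        funext y; exact hHN y
      rw [this]
      exact continuous_subtype_val.comp h.continuous
    exact h1.continuousAt (mem_interior_iff_mem_nhds.1 hy)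
  have hxi : (x : M) ∈ interior N := mem_interior_iff_mem_nhds.2 (hN _)
  have hHx : H x = h x := hHN x
  set Y : Plane → M := fun w => c.symm (c x + w) with hY
  set k : Plane → Plane := fun w => c' (H (Y w)) - c' (h x) with hk
  set q : Plane → ℝ × ℝ := fun w => Ψ.symm (k w) with hq
  have hY0 : Y 0 = x := by simp [hY, c.left_inv hcx]
  have hYc : ∀ w, c x + w ∈ c.target → ContinuousAt Y w := fun w hw =>
    ContinuousAt.comp (f := fun w => c x + w) (g := c.symm) (c.symm.continuousAt hw) (by fun_prop)
  have hY0c : Tendsto Y (𝓝 0) (𝓝 (x : M)) := by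
    have := hYc 0 (by simpa using c.map_source hcx)
    rwa [ContinuousAt, hY0] at this
  have hHY : Tendsto (fun w => H (Y w)) (𝓝 0) (𝓝 (h x : M')) := by
    have := (hHc x hxi).tendsto.comp hY0c
    rwa [hHx] at this
  have hk0c : Tendsto k (𝓝 0) (𝓝 0) := by
    have := ((c'.continuousAt hcx').tendsto.comp hHY).sub_const (c' (h x))
    rwa [sub_self] at this
  have hq0c : Tendsto q (𝓝 0) (𝓝 0) := by
    have := (Ψ.symm.continuousAt h0Ψ).tendsto.comp hk0c
    rwa [hΨs0] at this
  have hk0 : k 0 = 0 := by simp only [hk, hY0, hHx, sub_self]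
  obtain ⟨η, hη, hsign⟩ := exists_forall_planeDet_pos hσd hσ0 hτd hτ0 hdet
  -- parameters on the strand `σ'` come from parameters on the strand `σ`
  set A := min (g (s + η) - g s) (g s - g (s - η)) with hA
  have hA0 : 0 < A := lt_min (sub_pos.2 (hgm (by linarith))) (sub_pos.2 (hgm (by linarith)))
  have hgA : ∀ a, |a| < A → ∃ b ∈ Ioo (-η) η, g (s + b) = g s + a := by
    intro a ha
    have h1 := abs_lt.1 ha
    have h2 : g s + a ∈ Ioo (g (s - η)) (g (s + η)) :=
      ⟨by linarith [min_le_right (g (s + η) - g s) (g s - g (s - η))],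
        by linarith [min_le_left (g (s + η) - g s) (g s - g (s - η))]⟩
    obtain ⟨b, hb, e⟩ := intermediate_value_Ioo (by linarith : s - η ≤ s + η) hg.continuousOn h2
    exact ⟨b - s, ⟨by linarith [hb.1], by linarith [hb.2]⟩, by rw [add_sub_cancel, e]⟩
  -- conditions near the crossing
  have g1 : ∀ᶠ w in 𝓝 (0 : Plane), c x + w ∈ c.target := by
    have : Tendsto (fun w : Plane => c x + w) (𝓝 0) (𝓝 (c x)) := by
      have h0 : ContinuousAt (fun w : Plane => c x + w) 0 := by fun_prop
      simpa [ContinuousAt] using h0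
    exact this (c.open_target.mem_nhds (c.map_source hcx))
  have g2 : ∀ᶠ w in 𝓝 (0 : Plane), Y w ∈ interior N := hY0c (isOpen_interior.mem_nhds hxi)
  have g3 : ∀ᶠ w in 𝓝 (0 : Plane), H (Y w) ∈ c'.source := hHY (c'.open_source.mem_nhds hcx')
  have g4 : ∀ᶠ w in 𝓝 (0 : Plane), k w ∈ Ψ.target := hk0c (Ψ.open_target.mem_nhds h0Ψ)
  have g5 : ∀ᶠ w in 𝓝 (0 : Plane), q w ≠ 0 → ‖k w - L (q w)‖ < ‖L (q w)‖ := by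
    have h1 := hfd.hasFDerivAt.eventually_norm_sub_lt L'.injective
    filter_upwards [hq0c.eventually h1, g4] with w hw h4 hne
    have := hw hne
    rw [← hL']
    simpa only [hf0, sub_zero, ← hΨf, hq, Ψ.right_inv h4] using this
  have g6 : ∀ᶠ w in 𝓝 (0 : Plane), |(q w).1| < A := by
    have h1 : Tendsto (fun w => |(q w).1|) (𝓝 0) (𝓝 0) := by
      have := (((continuous_abs.comp continuous_fst).tendsto (0 : ℝ × ℝ)).comp hq0c)
      simpa [Function.comp_def] using this
    exact h1 (gt_mem_nhds hA0)
  have g7 : ∀ᶠ w in 𝓝 (0 : Plane), δ (Circle.exp (g s + (q w).1)) ∈ c'.source := by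
    have h1 : Tendsto (fun w => δ (Circle.exp (g s + (q w).1))) (𝓝 0) (𝓝 (h x : M')) := by
      have h2 : Continuous fun p : ℝ × ℝ => δ (Circle.exp (g s + p.1)) :=
        δ.continuous_comp_exp.comp (by fun_prop)
      have := (h2.tendsto 0).comp hq0c
      simpa [hhx, Function.comp_def] using this
    exact h1 (c'.open_source.mem_nhds hcx')
  obtain ⟨R, hR, hall⟩ := Metric.eventually_nhds_iff_ball.1
    ((((((g1.and g2).and g3).and g4).and g5).and g6).and g7)
  -- zeros of the second coordinate lie on the strand `σ`
  have hzero : ∀ w ∈ Metric.ball (0 : Plane) R, w ≠ 0 → (q w).2 = 0 →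
      ∃ b ∈ Ioo (-η) η, b ≠ 0 ∧ w = σ b ∧ g (s + b) = g s + (q w).1 := by
    intro w hw hw0 hqw
    obtain ⟨⟨⟨⟨⟨⟨k1, k2⟩, k3⟩, k4⟩, -⟩, k6⟩, k7⟩ := hall w hw
    obtain ⟨b, hb, hgb⟩ := hgA _ k6
    have h1 : k w = σ' (q w).1 := by
      rw [← Ψ.right_inv k4, hΨf, hf]
      change σ' (q w).1 + (q w).2 • v' = _
      rw [hqw, zero_smul, add_zero]
    have h2 : H (Y w) = δ (Circle.exp (g s + (q w).1)) :=
      c'.injOn k3 k7 (sub_left_injective h1)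
    have hYN : Y w ∈ N := interior_subset k2
    have h3 : h ⟨Y w, hYN⟩ = h ⟨γ (Circle.exp (s + b)), hNγ _⟩ := by
      apply Subtype.ext
      rw [hgh (s + b) ⟨γ (Circle.exp (s + b)), hNγ _⟩ rfl, hgb, ← h2, ← hHN]
    have h4 : Y w = γ (Circle.exp (s + b)) := congrArg Subtype.val (h.injective h3)
    have h5 : w = σ b := by
      have : c (Y w) = c x + w := c.right_inv k1
      rw [hσ]
      simp only
      rw [← h4, this, add_sub_cancel_left]
    refine ⟨b, hb, ?_, h5, hgb⟩
    rintro rfl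
    exact hw0 (h5.trans hσ0)
  -- the second coordinate is positive on the forward part of the strand `τ`
  have hτpos : ∀ᶠ b in 𝓝[>] (0 : ℝ), 0 < (q (τ b)).2 ∧ τ b ∈ Metric.ball (0 : Plane) R ∧
      γ (Circle.exp (t + b)) ∈ c.source := by
    have h1 : HasDerivAt (fun w : ℝ => (Ψ.symm (τ' w)).2) 1 0 := by
      have h2 : HasFDerivAt (fun w : Plane => (Ψ.symm w).2)
          ((ContinuousLinearMap.snd ℝ ℝ ℝ).comp (L'.symm : Plane →L[ℝ] ℝ × ℝ)) (τ' 0) := by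
        rw [hτ'0]
        exact (ContinuousLinearMap.snd ℝ ℝ ℝ).hasFDerivAt.comp 0 hΨsd.hasFDerivAt
      have h3 := h2.comp_hasDerivAt 0 hτ'd.hasDerivAt
      have h4 : L'.symm v' = (0, 1) := by
        rw [ContinuousLinearEquiv.symm_apply_eq, ← hL2, ← hL']
        rfl
      simpa [h4, Function.comp_def] using h3
    have h2 : ∀ᶠ w in 𝓝[>] (0 : ℝ), 0 < (Ψ.symm (τ' w)).2 := by
      have h3 := (hasDerivAt_iff_tendsto_slope.1 h1).eventually (eventually_gt_nhds one_pos)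
      have h4 : ∀ᶠ w in 𝓝[>] (0 : ℝ), 0 < slope (fun w : ℝ => (Ψ.symm (τ' w)).2) 0 w :=
        h3.filter_mono (nhdsWithin_mono _ fun _ h => ne_of_gt h)
      filter_upwards [h4, self_mem_nhdsWithin] with w hw hw0
      simp only [slope_def_field, hτ'0, hΨs0, Prod.snd_zero, sub_zero] at hw
      exact (div_pos_iff_of_pos_right hw0).1 hw
    have h3 : Tendsto (fun b => g (t + b) - g t) (𝓝[>] 0) (𝓝[>] 0) := by
      refine tendsto_nhdsWithin_iff.2 ⟨?_, ?_⟩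
      · have : Continuous fun b => g (t + b) - g t := by fun_prop
        have := this.tendsto 0
        simp only [add_zero, sub_self] at this
        exact this.mono_left nhdsWithin_le_nhds
      · filter_upwards [self_mem_nhdsWithin] with b hb
        exact sub_pos.2 (hgm (by simpa using hb))
    have h5 : Tendsto τ (𝓝[>] 0) (𝓝 0) := by
      have := hτd.continuousAt.tendsto
      rw [hτ0] at this
      exact this.mono_left nhdsWithin_le_nhds
    have h6 : ∀ᶠ b in 𝓝[>] (0 : ℝ), γ (Circle.exp (t + b)) ∈ c.source := by
      have : Continuous fun b : ℝ => γ (Circle.exp (t + b)) :=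
        γ.continuous_comp_exp.comp (by fun_prop)
      have := this.tendsto 0
      rw [add_zero, ← hst] at this
      exact (this.mono_left nhdsWithin_le_nhds) (c.open_source.mem_nhds hcx)
    filter_upwards [h3.eventually h2, h5 (Metric.ball_mem_nhds _ hR), h6] with b hb hbR hbc
    refine ⟨?_, hbR, hbc⟩
    have h7 : Y (τ b) = γ (Circle.exp (t + b)) := by
      simp only [hY, hτ, add_sub_cancel]
      exact c.left_inv hbc
    have h8 : k (τ b) = τ' (g (t + b) - g t) := by
      simp only [hk, hτ', h7, add_sub_cancel]
      rw [hHN ⟨_, hNγ _⟩, hgh (t + b) _ rfl]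
    simp only [hq, h8]
    exact hb
  obtain ⟨η', hη', hτη⟩ := (mem_nhdsGT_iff_exists_Ioo_subset' (show (0 : ℝ) < 1 from one_pos)).1
    hτpos
  -- choice of a small circle
  set η₁ := min η η' / 2 with hη₁
  have hη₁0 : 0 < η₁ := half_pos (lt_min hη hη')
  have hη₁η : η₁ < η := (half_lt_self (lt_min hη hη')).trans_le (min_le_left _ _)
  have hη₁η' : η₁ < η' := (half_lt_self (lt_min hη hη')).trans_le (min_le_right _ _)
  have hmem : η₁ ∈ Ioo (-η) η := ⟨by linarith, hη₁η⟩
  have hρ₀ : 0 < ‖τ η₁‖ := by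
    refine norm_pos_iff.2 fun h0 => ?_
    have := hsign η₁ hmem η₁ ⟨hη₁0, hη₁η⟩ hη₁0.ne'
    simp [h0, planeDet] at this
  obtain ⟨r, ⟨⟨θ, hθ, hθp, hθr⟩, hrR⟩, hrρ⟩ := (((hor x hxi).and (Ioo_mem_nhdsGT hR)).and
    (Ioo_mem_nhdsGT hρ₀)).exists
  have hr : 0 < r := hrR.1
  have hτc : ContinuousOn (fun b => ‖τ b‖) (Icc 0 η₁) := by
    refine ContinuousOn.norm fun b hb => ContinuousAt.continuousWithinAt ?_
    have hbc : γ (Circle.exp (t + b)) ∈ c.source := by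
      rcases hb.1.eq_or_lt with h0 | h0
      · rw [← h0, add_zero, ← hst]; exact hcx
      · exact (hτη ⟨h0, hb.2.trans_lt hη₁η'⟩).2.2
    refine ContinuousAt.sub ?_ continuousAt_const
    exact ContinuousAt.comp (g := c) (c.continuousAt hbc)
      (γ.continuous_comp_exp.comp (by fun_prop : Continuous fun b : ℝ => t + b)).continuousAt
  -- The radius was chosen below `‖τ η₁‖`, so the forward part of `τ` meets the circle, at the angle
  -- `α` found below.
  obtain ⟨b, hb, hbr⟩ := intermediate_value_Icc hη₁0.le hτc
    (show r ∈ Icc ‖τ 0‖ ‖τ η₁‖ by rw [hτ0, norm_zero]; exact ⟨hr.le, hrρ.2.le⟩)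
  replace hbr : ‖τ b‖ = r := hbr
  have hb0 : 0 < b := by
    rcases hb.1.eq_or_lt with h0 | h0
    · rw [← h0, hτ0] at hbr
      simp at hbr
      linarith
    · exact h0
  obtain ⟨α, hα⟩ := exists_eq_smul_unitVec hbr
  have hbpos := (hτη ⟨hb0, hb.2.trans_lt hη₁η'⟩).1
  set V : ℝ → Plane := fun t => r • unitVec t with hV
  have hVp : V.Periodic (2 * Real.pi) := fun t => by simp only [hV, unitVec_periodic t]
  have hVc : Continuous V := continuous_unitVec.const_smul r
  have hVn : ∀ t, ‖V t‖ = r := fun t => by simp [hV, norm_smul, norm_unitVec, abs_of_pos hr]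
  have hV0 : ∀ t, V t ≠ 0 := fun t => norm_pos_iff.1 ((hVn t).symm ▸ hr)
  have hVR : ∀ t, V t ∈ Metric.ball (0 : Plane) R := fun t => by simpa [hVn t] using hrR.2
  have hVall := fun t => hall (V t) (hVR t)
  have k1 := fun t => (hVall t).1.1.1.1.1.1
  have k2 := fun t => (hVall t).1.1.1.1.1.2
  have k3 := fun t => (hVall t).1.1.1.1.2
  have k4 := fun t => (hVall t).1.1.1.2
  have k5 := fun t => (hVall t).1.1.2
  have hHV : Continuous fun t => H (Y (V t)) := continuous_iff_continuousAt.2 fun t =>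
    ContinuousAt.comp (g := H) (hHc _ (k2 t))
      (ContinuousAt.comp (g := Y) (hYc _ (k1 t)) hVc.continuousAt)
  have hkV : Continuous fun t => k (V t) := by
    refine (continuous_iff_continuousAt.2 fun t => ?_).sub continuous_const
    exact ContinuousAt.comp (g := c') (c'.continuousAt (k3 t)) hHV.continuousAt
  have hqV : Continuous fun t => q (V t) := continuous_iff_continuousAt.2 fun t =>
    ContinuousAt.comp (g := Ψ.symm) (Ψ.symm.continuousAt (k4 t)) hkV.continuousAt
  have w1 : WindsOnce (fun t => k (V t) 0) fun t => k (V t) 1 := by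
    refine WindsOnce.of_Icc (fun t => by simp only [hVp t]) (fun t => by simp only [hVp t]) hθ hθp
      fun t ht => ?_
    obtain ⟨y, hy, hyc, -, ρ, hρ, hyρ⟩ := hθr t ht
    have h1 : Y (V t) = y := by
      simp only [hY]
      rw [← hyc]
      exact c.left_inv hy
    have h2 : k (V t) = ρ • unitVec (θ t) := by
      simp only [hk, h1, hHN]
      rw [sub_eq_iff_eq_add']
      exact hyρ
    refine ⟨ρ, hρ, ?_, ?_⟩ <;> simp [h2, unitVec]
  have hq0 : ∀ t, q (V t) ≠ 0 := by
    intro t h0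
    have h1 : k (V t) = 0 := by
      rw [← Ψ.right_inv (k4 t)]
      change Ψ (q (V t)) = 0
      rw [h0, hΨf, hf0]
    have := w1.ne_zero t
    simp [h1] at this
  have w2 := w1.of_norm_sub_lt (c' := fun t => L (q (V t))) hkV (L.continuous.comp hqV)
    (fun t => by simp only [hVp t]) (fun t => by simp only [hVp t])
    (fun t => Or.inr (by rw [norm_sub_rev]; exact k5 t (hq0 t)))
  -- Under the assumption to be refuted `L` reverses the orientation. Changing the sign of the
  -- second coordinate makes it positive, so in the coordinates `q` the loop winds once clockwise.
  set K : ℝ × ℝ →L[ℝ] Plane := (ContinuousLinearMap.fst ℝ ℝ ℝ).smulRight u'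
    + (ContinuousLinearMap.snd ℝ ℝ ℝ).smulRight (-v') with hK
  have hKq : ∀ p : ℝ × ℝ, L p = K (p.1, -p.2) := fun p => by simp [hL, hK]
  have hKdet : 0 < planeDet (K (1, 0)) (K (0, 1)) := by
    have h1 : K (1, 0) = u' := by simp [hK]
    have h2 : K (0, 1) = -v' := by simp [hK]
    rw [h1, h2]
    simp only [planeDet, PiLp.neg_apply] at hneg ⊢
    linarith
  simp only [hKq] at w2
  have w3 := w2.of_map_prod (q := fun t => ((q (V t)).1, -(q (V t)).2))
    ((continuous_fst.comp hqV).prodMk (continuous_snd.comp hqV).neg)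
    (fun t => by simp only [hVp t]) hKdet
  have hαb : τ b = V α := hα
  have hdetV : ∀ t, planeDet (V t) (τ b) = r ^ 2 * Real.sin (α - t) := fun t => by
    rw [hαb]; exact planeDet_smul_unitVec r t α
  have hbη : b ∈ Ioo 0 η := ⟨hb0, hb.2.trans_lt hη₁η⟩
  refine w3.false_of_reversed (α := α) (by rw [← hαb]; exact hbpos) ?_ ?_
  -- On the half circle before `α` the determinant with `τ b` is nonnegative, so only the forward
  -- half of `σ` can be met there; after `α` only the backward half. As `g` is increasing, the same
  -- holds for the image strand.
  · intro t' ht' h0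
    obtain ⟨a, ha, ha0, haσ, hga⟩ := hzero _ (hVR t') (hV0 t') h0
    have h1 := hsign a ha b hbη ha0
    rw [← haσ, hdetV] at h1
    have h2 : 0 ≤ Real.sin (α - t') :=
      Real.sin_nonneg_of_nonneg_of_le_pi (by linarith [ht'.2]) (by linarith [ht'.1])
    have h3 : 0 < a := pos_of_mul_pos_left h1 (by positivity)
    have h4 := hgm (show s < s + a by linarith)
    linarith
  · intro t' ht' h0
    obtain ⟨a, ha, ha0, haσ, hga⟩ := hzero _ (hVR t') (hV0 t') h0
    have h1 := hsign a ha b hbη ha0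
    rw [← haσ, hdetV] at h1
    have h2 : Real.sin (α - t') ≤ 0 :=
      Real.sin_nonpos_of_nonpos_of_neg_pi_le (by linarith [ht'.1]) (by linarith [ht'.2])
    have h3 : a < 0 := by
      by_contra hc
      have : r ^ 2 * Real.sin (α - t') ≤ 0 := mul_nonpos_of_nonneg_of_nonpos (by positivity) h2
      exact h1.not_ge (mul_nonpos_of_nonneg_of_nonpos (not_lt.1 hc) this)
    have h4 := hgm (show s + a < s by linarith)
    linarith

/-- Injectivity of `φ` excludes intervals of constancy of the monotone lift, and it forces degree
one: an increase by more than `2π` over one turn would repeat a value on the circle too early. -/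
theorem CirclePreservesOrientation.exists_lift {φ : Circle ≃ₜ Circle}
    (h : CirclePreservesOrientation φ) : ∃ g : ℝ → ℝ, Continuous g ∧ StrictMono g ∧
      (∀ t, g (t + 2 * Real.pi) = g t + 2 * Real.pi) ∧
      ∀ t, φ (Circle.exp t) = Circle.exp (g t) := by
  have hp := Real.two_pi_pos
  obtain ⟨g, hg, hgm, hφ⟩ := h
  have hne : ∀ a b : ℝ, a < b → b < a + 2 * Real.pi → Circle.exp b ≠ Circle.exp a := by
    intro a b hab hb he
    exact hab.ne' (Circle.exp_injOn_Ico (a := a) (b := a + 2 * Real.pi) (by linarith)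
      ⟨hab.le, hb⟩ ⟨le_rfl, by linarith⟩ he)
  have hinj : ∀ a b : ℝ, a < b → b < a + 2 * Real.pi → Circle.exp (g b) ≠ Circle.exp (g a) := by
    intro a b hab hb he
    rw [← hφ, ← hφ] at he
    exact hne a b hab hb (φ.injective he)
  have hlt : ∀ a b : ℝ, a < b → g a < g b := by
    intro a b hab
    refine lt_of_le_of_ne (hgm hab.le) fun he => ?_
    -- The point `c` lies less than a turn after `a`, so `a` and `c` are different points of the
    -- circle.
    obtain ⟨c, hac, hc⟩ := exists_between (lt_min hab (show a < a + 2 * Real.pi by linarith))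
    refine hinj a c hac (hc.trans_le (min_le_right _ _)) (congrArg _ (le_antisymm ?_ (hgm hac.le)))
    rw [he]
    exact hgm (hc.le.trans (min_le_left _ _))
  refine ⟨g, hg, hlt, fun t => ?_, hφ⟩
  have h1 : Circle.exp (g (t + 2 * Real.pi)) = Circle.exp (g t) := by
    rw [← hφ, ← hφ, Circle.exp_add_two_pi]
  obtain ⟨k, hk⟩ := Circle.exp_eq_exp.1 h1
  have h2 : g t < g (t + 2 * Real.pi) := hlt _ _ (by linarith)
  have hk1 : (1 : ℤ) ≤ k := by
    by_contra hc
    have : (k : ℝ) ≤ 0 := by exact_mod_cast (by omega : k ≤ 0)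
    nlinarith
  rcases hk1.eq_or_lt with h3 | h3
  · rw [hk, ← h3]; simp
  · exfalso
    have h4 : (2 : ℝ) ≤ k := by exact_mod_cast h3
    -- If `k ≥ 2`, the value `g t + 2π` is taken strictly before the turn is complete.
    obtain ⟨c, hc, hgc⟩ := intermediate_value_Ioo (by linarith : t ≤ t + 2 * Real.pi)
      hg.continuousOn (show g t + 2 * Real.pi ∈ Ioo (g t) (g (t + 2 * Real.pi)) from
        ⟨by linarith, by rw [hk]; nlinarith⟩)
    exact hinj t c hc.1 hc.2 (by rw [hgc, Circle.exp_add_two_pi])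

/-! ### Stably homeomorphic curves have cyclically equivalent words -/

section Curves

variable {M : Type*} [TopologicalSpace M] [ChartedSpace Plane M] [IsManifold (𝓡 2) ∞ M]
  {M' : Type*} [TopologicalSpace M'] [ChartedSpace Plane M'] [IsManifold (𝓡 2) ∞ M']

/-- The signed words of stably homeomorphic curves are cyclically equivalent. -/
theorem StablyHomeomorphic.cyclicEquiv {γ : GenericCurve M} {δ : GenericCurve M'}
    (h : StablyHomeomorphic γ δ) (P : γ.Labelling) (Q : δ.Labelling) :
    P.word.CyclicEquiv Q.word := by
  classical
  obtain ⟨N, N', hN, hN', h, hor, φ, hφ, hγ⟩ := h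
  obtain ⟨g, hg, hgm, hgp, hgφ⟩ := hφ.exists_lift
  have hNγ : ∀ z, γ z ∈ N := fun z => mem_of_mem_nhds (hN.1 z)
  have heq : ∀ z w, δ (φ z) = δ (φ w) ↔ γ z = γ w := by
    intro z w
    rw [← hγ z ⟨γ z, hNγ z⟩ rfl, ← hγ w ⟨γ w, hNγ w⟩ rfl, Subtype.coe_inj,
      h.injective.eq_iff, Subtype.mk.injEq]
  have hD : ∀ z, φ z ∈ doubleParams δ ↔ z ∈ doubleParams γ := by
    intro z
    constructor
    · rintro ⟨w, hw, hwz⟩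
      obtain ⟨w, rfl⟩ := φ.surjective w
      exact ⟨w, fun h => hw (congrArg φ h), (heq w z).1 hwz⟩
    · rintro ⟨w, hw, hwz⟩
      exact ⟨φ w, fun h => hw (φ.injective h), (heq w z).2 hwz⟩
  have hgh : ∀ (t : ℝ) (y : N), (y : M) = γ (Circle.exp t) →
      (h y : M') = δ (Circle.exp (g t)) := fun t y hy => by
    rw [← hgφ]; exact hγ _ y hy
  have hdet : ∀ s t : ℝ, Circle.exp s ≠ Circle.exp t → γ (Circle.exp s) = γ (Circle.exp t) →
      0 < planeDet (curveVelocity γ s) (curveVelocity γ t) →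
      0 < planeDet (curveVelocity δ (g s)) (curveVelocity δ (g t)) := by
    intro s t hne hst
    refine planeDet_pos_of_preservesOrientation γ δ h hor hN.1 hg hgm hgh hst
      (δ.transversal _ _ ?_ ?_)
    · rw [← hgφ, ← hgφ]
      exact fun h => hne (φ.injective h)
    · rw [← hgφ, ← hgφ]
      exact (heq _ _).2 hst
  set r : M' → M := fun y => if hy : ∃ z, δ (φ z) = y then γ hy.choose else γ 1 with hr
  have hrφ : ∀ z, r (δ (φ z)) = γ z := by
    intro z
    have hy : ∃ w, δ (φ w) = δ (φ z) := ⟨z, rfl⟩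
    simp only [hr, dif_pos hy]
    exact (heq _ _).1 hy.choose_spec
  have hlab : InjOn (P.label ∘ r) (δ '' doubleParams δ) := by
    rintro _ ⟨z, hz, rfl⟩ _ ⟨w, hw, rfl⟩ hzw
    obtain ⟨z, rfl⟩ := φ.surjective z
    obtain ⟨w, rfl⟩ := φ.surjective w
    simp only [Function.comp, hrφ] at hzw
    rw [heq]
    exact P.label_injOn (mem_image_of_mem _ ((hD z).1 hz)) (mem_image_of_mem _ ((hD w).1 hw)) hzw
  -- Base point and labels are transported from `γ`, so the two words agree letter by letter; the
  -- passage to `Q` takes place within the curve `δ`.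
  set Q' : δ.Labelling := ⟨g P.base, by rw [← hgφ, hD]; exact P.base_notMem, P.label ∘ r, hlab⟩
    with hQ'
  have himg : g '' P.crossingTimes = Q'.crossingTimes := by
    ext t'
    constructor
    · rintro ⟨t, ht, rfl⟩
      refine ⟨⟨hgm ht.1.1, (hgm ht.1.2).trans_eq (hgp _)⟩, ?_⟩
      rw [← hgφ, hD]
      exact ht.2
    · rintro ⟨⟨h1, h2⟩, h3⟩
      have h2' : t' < g (P.base + 2 * Real.pi) := by rw [hgp]; exact h2
      obtain ⟨t, ht, rfl⟩ := intermediate_value_Ioo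
        (by linarith [Real.two_pi_pos] : P.base ≤ P.base + 2 * Real.pi) hg.continuousOn ⟨h1, h2'⟩
      rw [← hgφ, hD] at h3
      exact ⟨t, ⟨ht, h3⟩, rfl⟩
  have hword : P.word = Q'.word := by
    refine P.word_eq_of_strictMonoOn Q' g (hgm.strictMonoOn _) himg
      (P.signedLetter_eq_of_correspond Q' g (hgm.strictMonoOn _)
        (fun t ht => (himg ▸ mem_image_of_mem g ht : g t ∈ Q'.crossingTimes).1) ?_ ?_ ?_)
    · intro t _ u _ htu
      rw [← hgφ, ← hgφ, heq]
      exact htu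
    · intro t ht u hu htu hlt
      have hne := P.exp_ne_of_mem_turn ht.1 hu.1 hlt.ne
      refine ⟨hdet t u hne htu, fun hpos => ?_⟩
      -- If the determinant for `γ` were negative, exchanging the two times would make it positive,
      -- and `hdet` would contradict the sign for `δ`.
      rcases lt_or_gt_of_ne (γ.transversal t u hne htu) with hd | hd
      · have := hdet u t hne.symm htu.symm (by rw [planeDet_swap]; linarith)
        rw [planeDet_swap] at this
        linarith
      · exact hd
    · intro t _
      rw [← hgφ]
      change P.label (r _) = _
      rw [hrφ]
  rw [hword]
  exact Q'.cyclicEquiv_word Q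

end Curves

/-! ### Piecewise linear reparametrizations -/

theorem exists_glue_strictMono {f₁ f₂ : ℝ → ℝ} (h₁ : Continuous f₁) (m₁ : StrictMono f₁)
    (h₂ : Continuous f₂) (m₂ : StrictMono f₂) {m : ℝ} (hm : f₁ m = f₂ m) :
    ∃ f : ℝ → ℝ, Continuous f ∧ StrictMono f ∧ (∀ s ≤ m, f s = f₁ s) ∧ ∀ s ≥ m, f s = f₂ s := by
  classical
  have hle : ∀ s ≤ m, (if s ≤ m then f₁ s else f₂ s) = f₁ s := fun s hs => if_pos hs
  have hge : ∀ s ≥ m, (if s ≤ m then f₁ s else f₂ s) = f₂ s := fun s hs => by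
    rcases hs.eq_or_lt with h | h
    · rw [← h, if_pos le_rfl, hm]
    · exact if_neg (not_le.2 h)
  refine ⟨fun s => if s ≤ m then f₁ s else f₂ s, ?_, ?_, hle, hge⟩
  · exact Continuous.if_le h₁ h₂ continuous_id continuous_const fun s hs => by
      rw [show s = m from hs, hm]
  · intro s t hst
    beta_reduce
    rcases le_total t m with ht | ht
    · rw [hle s (hst.le.trans ht), hle t ht]
      exact m₁ hst
    · rw [hge t ht]
      rcases le_total s m with hs | hs
      · rw [hle s hs]
        rcases hs.eq_or_lt with h | h
        · rw [h, hm]; exact m₂ (h ▸ hst)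
        · exact (m₁ h).trans_le (hm.trans_le (m₂.monotone ht))
      · rw [hge s hs]
        exact m₂ hst

theorem exists_strictMono_linear {a c : ℝ × ℝ} (h : a.1 < c.1 ∧ a.2 < c.2) :
    ∃ f : ℝ → ℝ, Continuous f ∧ StrictMono f ∧ f a.1 = a.2 ∧ f c.1 = c.2 := by
  have h1 : 0 < c.1 - a.1 := sub_pos.2 h.1
  have h2 : 0 < (c.2 - a.2) / (c.1 - a.1) := div_pos (sub_pos.2 h.2) h1
  refine ⟨fun s => a.2 + (c.2 - a.2) / (c.1 - a.1) * (s - a.1), by fun_prop, fun s t hst => ?_,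
    by simp, ?_⟩
  · beta_reduce
    have := mul_lt_mul_of_pos_left (sub_lt_sub_right hst a.1) h2
    linarith
  · beta_reduce
    rw [div_mul_cancel₀ _ h1.ne']
    ring

/-- There is an increasing homeomorphism of the line that maps given points to given points and is a
translation near these points. -/
theorem exists_strictMono_interpolation (l : List (ℝ × ℝ)) (c : ℝ × ℝ) : ∀ a : ℝ × ℝ,
    a.1 < c.1 ∧ a.2 < c.2 → (∀ p ∈ l, a.1 < p.1 ∧ a.2 < p.2) →
    (∀ p ∈ l, p.1 < c.1 ∧ p.2 < c.2) → l.Pairwise (fun p q => p.1 < q.1 ∧ p.2 < q.2) →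
    ∃ f : ℝ → ℝ, Continuous f ∧ StrictMono f ∧ f a.1 = a.2 ∧ f c.1 = c.2 ∧ ∃ η > 0,
      ∀ p ∈ l, a.1 + η ≤ p.1 ∧ p.1 + η ≤ c.1 ∧ ∀ τ, |τ| ≤ η → f (p.1 + τ) = p.2 + τ := by
  induction l with
  | nil =>
    intro a hac _ _ _
    obtain ⟨f, h1, h2, h3, h4⟩ := exists_strictMono_linear hac
    exact ⟨f, h1, h2, h3, h4, 1, one_pos, fun p hp => absurd hp List.not_mem_nil⟩
  | cons p l ih =>
    intro a hac hal hlc hl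
    rw [List.pairwise_cons] at hl
    have hap := hal p List.mem_cons_self
    have hpc := hlc p List.mem_cons_self
    have hev : ∀ x y : ℝ, x < y → ∀ᶠ η : ℝ in 𝓝[>] 0, x + η < y := fun x y hxy => by
      have : Tendsto (fun η : ℝ => x + η) (𝓝 0) (𝓝 x) := by
        have h0 : ContinuousAt (fun η : ℝ => x + η) 0 := by fun_prop
        simpa [ContinuousAt] using h0
      exact nhdsWithin_le_nhds (this (gt_mem_nhds hxy))
    have hevl : ∀ᶠ η : ℝ in 𝓝[>] 0, ∀ q ∈ {q | q ∈ l}, p.1 + η < q.1 ∧ p.2 + η < q.2 :=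
      (Filter.eventually_all_finite l.finite_toSet).2 fun q hq =>
        (hev _ _ (hl.1 q hq).1).and (hev _ _ (hl.1 q hq).2)
    obtain ⟨η₁, ⟨⟨⟨hη1, hη2⟩, hη3⟩, hηl⟩, hη₁⟩ :=
      (((((hev _ _ hap.1).and (hev _ _ hap.2)).and ((hev _ _ hpc.1).and (hev _ _ hpc.2))).and
        hevl).and self_mem_nhdsWithin).exists
    replace hη₁ : 0 < η₁ := hη₁
    -- The induction restarts at the end of the piece of slope one around `p`; this is why the left
    -- end `a` is arbitrary in the statement.
    obtain ⟨f₃, c₃, m₃, e₃, e₃', η₂, hη₂, h₃⟩ := ih (p.1 + η₁, p.2 + η₁) hη3 hηl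
      (fun q hq => hlc q (List.mem_cons_of_mem _ hq)) hl.2
    obtain ⟨f₁, c₁, m₁, e₁, e₁'⟩ := exists_strictMono_linear (a := a) (c := (p.1 - η₁, p.2 - η₁))
      ⟨by simp only; linarith, by simp only; linarith⟩
    have c₂ : Continuous fun s => s - p.1 + p.2 := by fun_prop
    have m₂ : StrictMono fun s => s - p.1 + p.2 := fun s t hst => by simpa using hst
    obtain ⟨f₄, c₄, m₄, e₄, e₄'⟩ := exists_glue_strictMono c₁ m₁ c₂ m₂ (m := p.1 - η₁) (by
      rw [e₁']; ring)
    obtain ⟨f, cf, mf, ef, ef'⟩ := exists_glue_strictMono c₄ m₄ c₃ m₃ (m := p.1 + η₁) (by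
      rw [e₄' _ (by linarith), e₃]; ring)
    refine ⟨f, cf, mf, ?_, ?_, min η₁ η₂, lt_min hη₁ hη₂, ?_⟩
    · rw [ef _ (by linarith), e₄ _ (by linarith), e₁]
    · rw [ef' _ (by linarith [hη3.1]), e₃']
    · intro q hq
      rcases List.mem_cons.1 hq with rfl | hq
      · refine ⟨by linarith [min_le_left η₁ η₂], by linarith [min_le_left η₁ η₂, hη3.1],
          fun τ hτ => ?_⟩
        have := abs_le.1 (hτ.trans (min_le_left _ _))
        rw [ef _ (by linarith), e₄' _ (by linarith)]
        ring
      · obtain ⟨h5, h6, h7⟩ := h₃ q hq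
        simp only at h5
        refine ⟨by linarith [min_le_right η₁ η₂], by linarith [min_le_right η₁ η₂],
          fun τ hτ => ?_⟩
        have hτ' := hτ.trans (min_le_right _ _)
        have := abs_le.1 hτ'
        rw [ef' _ (by linarith)]
        exact h7 τ hτ'

theorem strictMono_of_quasiperiodic {f g : ℝ → ℝ} (hf : StrictMono f) {b : ℝ}
    (hg : ∀ t, g (t + 2 * Real.pi) = g t + 2 * Real.pi)
    (h : ∀ t ∈ Icc b (b + 2 * Real.pi), g t = f t) : StrictMono g := by
  have hp := Real.two_pi_pos
  have hgk : ∀ (k : ℤ) t, g (t + k • (2 * Real.pi)) = g t + k • (2 * Real.pi) := by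
    intro k t
    have : Function.Periodic (fun t => g t - t) (2 * Real.pi) := fun t => by
      simp only [hg]; ring
    have h1 := this.zsmul k t
    linarith
  have key : ∀ s t, s < t → s ∈ Ico b (b + 2 * Real.pi) → g s < g t := by
    intro s t hst hs
    rw [h s (Ico_subset_Icc_self hs)]
    rcases le_or_gt t (b + 2 * Real.pi) with ht | ht
    · rw [h t ⟨hs.1.trans hst.le, ht⟩]
      exact hf hst
    · obtain ⟨k, hk, -⟩ := existsUnique_add_zsmul_mem_Ico hp t b
      have h1 := hgk k t
      rw [h _ (Ico_subset_Icc_self hk)] at h1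
      have h2 := hf.monotone hk.1
      have hk1 : k ≤ -1 := by
        by_contra hc
        have : (0 : ℝ) ≤ k := by exact_mod_cast (by omega : 0 ≤ k)
        have h3 := hk.2
        rw [zsmul_eq_mul] at h3
        nlinarith
      have hk2 : (k : ℝ) ≤ -1 := by exact_mod_cast hk1
      have h3 : f s < f (b + 2 * Real.pi) := hf hs.2
      have h4 : f (b + 2 * Real.pi) = f b + 2 * Real.pi := by
        rw [← h b ⟨le_rfl, by linarith⟩, ← h (b + 2 * Real.pi) ⟨by linarith, le_rfl⟩, hg]
      rw [zsmul_eq_mul] at h1 h2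
      nlinarith
  intro s t hst
  obtain ⟨k, hk, -⟩ := existsUnique_add_zsmul_mem_Ico hp s b
  have := key (s + k • (2 * Real.pi)) (t + k • (2 * Real.pi)) (by linarith) hk
  rw [hgk, hgk] at this
  linarith

/-! ### Matching the crossings of two curves with equal words -/

section Curves

variable {M : Type*} [TopologicalSpace M] [ChartedSpace Plane M]
  {M' : Type*} [TopologicalSpace M'] [ChartedSpace Plane M']

namespace GenericCurve

/-- An increasing homeomorphism of the line that commutes with `t ↦ t + 2π` and matches the
crossings of two curves with their signs, being a translation near the crossings. -/
structure Matching (γ : GenericCurve M) (δ : GenericCurve M') where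
  toFun : ℝ → ℝ
  continuous : Continuous toFun
  strictMono : StrictMono toFun
  add_two_pi : ∀ t, toFun (t + 2 * Real.pi) = toFun t + 2 * Real.pi
  η : ℝ
  η_pos : 0 < η
  translation : ∀ t, Circle.exp t ∈ doubleParams γ → ∀ τ, |τ| ≤ η →
    toFun (t + τ) = toFun t + τ
  eq_iff : ∀ s t, δ (Circle.exp (toFun s)) = δ (Circle.exp (toFun t)) ↔
    γ (Circle.exp s) = γ (Circle.exp t)
  det_iff : ∀ s t, Circle.exp s ≠ Circle.exp t → γ (Circle.exp s) = γ (Circle.exp t) →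
    (0 < planeDet (curveVelocity δ (toFun s)) (curveVelocity δ (toFun t)) ↔
      0 < planeDet (curveVelocity γ s) (curveVelocity γ t))

theorem exp_eq_exp_iff_of_quasiperiodic {g : ℝ → ℝ} (hg : StrictMono g)
    (hp : ∀ t, g (t + 2 * Real.pi) = g t + 2 * Real.pi) {s t : ℝ} :
    Circle.exp (g s) = Circle.exp (g t) ↔ Circle.exp s = Circle.exp t := by
  have hgk : ∀ (k : ℤ) t, g (t + k * (2 * Real.pi)) = g t + k * (2 * Real.pi) := by
    intro k t
    have : Function.Periodic (fun t => g t - t) (2 * Real.pi) := fun t => by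
      simp only [hp]; ring
    have h1 := this.int_mul k t
    linarith
  rw [Circle.exp_eq_exp, Circle.exp_eq_exp]
  refine exists_congr fun k => ⟨fun h => ?_, fun h => ?_⟩
  · rw [← hgk] at h
    exact hg.injective h
  · rw [h, hgk]

/-- Equal words pair the `n`-th passages of the two curves, with the same letter and sign.
Interpolating these pairs over one turn and extending to the line gives the reparametrization.
Labels then decide which passages share a crossing, and signs decide the determinants. -/
theorem Labelling.exists_matching {γ : GenericCurve M} {δ : GenericCurve M'} (P : γ.Labelling)
    (Q : δ.Labelling) (h : P.word = Q.word) : Nonempty (Matching γ δ) := by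
  have hp := Real.two_pi_pos
  set T := P.finite_crossingTimes.toFinset.sort (· ≤ ·) with hT
  set T' := Q.finite_crossingTimes.toFinset.sort (· ≤ ·) with hT'
  have hTm : ∀ t, t ∈ T ↔ t ∈ P.crossingTimes := fun t => by simp [hT]
  have hTm' : ∀ t, t ∈ T' ↔ t ∈ Q.crossingTimes := fun t => by simp [hT']
  have hmap : T.map P.signedLetter = T'.map Q.signedLetter := congrArg SignedWord.seq h
  have hlen : T.length = T'.length := by simpa using congrArg List.length hmap
  have hfst : ∀ p ∈ T.zip T', p.1 ∈ P.crossingTimes := fun p hp => (hTm _).1 (List.of_mem_zip hp).1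
  have hsnd : ∀ p ∈ T.zip T', p.2 ∈ Q.crossingTimes := fun p hp => (hTm' _).1 (List.of_mem_zip hp).2
  obtain ⟨f, hf, hfm, hfb, hfc, η, hη, hfη⟩ := exists_strictMono_interpolation (T.zip T')
    (P.base + 2 * Real.pi, Q.base + 2 * Real.pi) (P.base, Q.base)
    ⟨by simp only; linarith, by simp only; linarith⟩
    (fun p hp => ⟨(hfst p hp).1.1, (hsnd p hp).1.1⟩)
    (fun p hp => ⟨(hfst p hp).1.2, (hsnd p hp).1.2⟩)
    (by
      rw [List.pairwise_iff_getElem]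
      intro i j hi hj hij
      simp only [List.getElem_zip]
      exact ⟨List.pairwise_iff_getElem.1 (Finset.sort_pairwise_lt _) i j _ _ hij,
        List.pairwise_iff_getElem.1 (Finset.sort_pairwise_lt _) i j _ _ hij⟩)
  simp only at hfb hfc hfη
  obtain ⟨g, hg, hgp, hgf⟩ := exists_quasiperiodic_extension hf (b := P.base) (by rw [hfc, hfb])
  have hgm := strictMono_of_quasiperiodic hfm hgp hgf
  have hexp : ∀ {s t : ℝ}, Circle.exp (g s) = Circle.exp (g t) ↔ Circle.exp s = Circle.exp t :=
    exp_eq_exp_iff_of_quasiperiodic hgm hgp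
  have hgη : ∀ p ∈ T.zip T', ∀ τ, |τ| ≤ η → g (p.1 + τ) = p.2 + τ := by
    intro p hp τ hτ
    obtain ⟨h1, h2, h3⟩ := hfη p hp
    have := abs_le.1 hτ
    rw [hgf _ ⟨by linarith, by linarith⟩, h3 τ hτ]
  have hgT : T.map g = T' := by
    have h1 : (T.zip T').map (g ∘ Prod.fst) = (T.zip T').map Prod.snd := by
      refine List.map_congr_left fun p hp => ?_
      have := hgη p hp 0 (by simpa using hη.le)
      simpa using this
    rw [List.map_snd_zip hlen.ge, ← List.map_map, List.map_fst_zip hlen.le] at h1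
    exact h1
  have hcross : ∀ t ∈ P.crossingTimes, g t ∈ Q.crossingTimes := fun t ht => by
    rw [← hTm', ← hgT]
    exact List.mem_map_of_mem ((hTm t).2 ht)
  have hcross' : ∀ t' ∈ Q.crossingTimes, ∃ t ∈ P.crossingTimes, g t = t' := fun t' ht => by
    rw [← hTm', ← hgT] at ht
    obtain ⟨t, ht₂, rfl⟩ := List.mem_map.1 ht
    exact ⟨t, (hTm t).1 ht₂, rfl⟩
  have hletter : ∀ t ∈ P.crossingTimes, P.signedLetter t = Q.signedLetter (g t) := by
    rw [← hgT, List.map_map, List.map_inj_left] at hmap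
    exact fun t ht => hmap t ((hTm t).2 ht)
  have hneg : ∀ t ∈ P.crossingTimes,
      (P.IsNegative (γ (Circle.exp t)) ↔ Q.IsNegative (δ (Circle.exp (g t)))) := by
    intro t ht
    have h1 := congrArg Prod.snd (hletter t ht)
    simp only [signedLetter] at h1
    exact decide_eq_decide.1 (Bool.not_inj h1)
  have hred : ∀ t, Circle.exp t ∈ doubleParams γ → ∃ t₀ ∈ P.crossingTimes,
      Circle.exp t₀ = Circle.exp t := fun t ht => by
    obtain ⟨t₀, h0, h1⟩ := P.exists_turn_of_doubleParam ht
    exact ⟨t₀, ⟨h0, h1 ▸ ht⟩, h1⟩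
  have hmem : ∀ t, Circle.exp (g t) ∈ doubleParams δ ↔ Circle.exp t ∈ doubleParams γ := by
    intro t
    constructor
    · intro ht
      obtain ⟨t', h0, h1⟩ := Q.exists_turn_of_doubleParam ht
      obtain ⟨t₁, h2, rfl⟩ := hcross' t' ⟨h0, h1 ▸ ht⟩
      rw [← hexp.1 h1]
      exact h2.2
    · intro ht
      obtain ⟨t₀, h0, h1⟩ := hred t ht
      rw [← hexp.2 h1]
      exact (hcross t₀ h0).2
  have heq0 : ∀ s ∈ P.crossingTimes, ∀ t ∈ P.crossingTimes,
      (δ (Circle.exp (g s)) = δ (Circle.exp (g t)) ↔ γ (Circle.exp s) = γ (Circle.exp t)) := by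
    intro s hs t ht
    have h1 := congrArg Prod.fst (hletter s hs)
    have h2 := congrArg Prod.fst (hletter t ht)
    simp only [signedLetter] at h1 h2
    rw [← P.label_injOn.eq_iff (mem_image_of_mem _ hs.2) (mem_image_of_mem _ ht.2),
      ← Q.label_injOn.eq_iff (mem_image_of_mem _ (hcross s hs).2)
        (mem_image_of_mem _ (hcross t ht).2), h1, h2]
  have heq : ∀ s t, δ (Circle.exp (g s)) = δ (Circle.exp (g t)) ↔
      γ (Circle.exp s) = γ (Circle.exp t) := by
    intro s t
    by_cases hst : Circle.exp s = Circle.exp t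
    · rw [hexp.2 hst, hst]
      simp
    -- Distinct points of the circle can have equal images only if both are double points; otherwise
    -- both sides are false.
    by_cases hs : Circle.exp s ∈ doubleParams γ
    swap
    · refine iff_of_false (fun h => hs ?_) fun h => hs ⟨_, Ne.symm hst, h.symm⟩
      rw [← hmem]
      exact ⟨_, fun h => hst (hexp.1 h.symm), h.symm⟩
    by_cases ht : Circle.exp t ∈ doubleParams γ
    swap
    · refine iff_of_false (fun h => ht ?_) fun h => ht ⟨_, hst, h⟩
      rw [← hmem]
      exact ⟨_, fun h => hst (hexp.1 h), h⟩
    obtain ⟨s₀, h0, h1⟩ := hred s hs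
    obtain ⟨t₀, h2, h3⟩ := hred t ht
    rw [← hexp.2 h1, ← hexp.2 h3, ← h1, ← h3]
    exact heq0 s₀ h0 t₀ h2
  refine ⟨⟨g, hg, hgm, hgp, η, hη, ?_, heq, ?_⟩⟩
  · intro t ht τ hτ
    obtain ⟨t₀, h0, h1⟩ := hred t ht
    obtain ⟨k, hk⟩ := Circle.exp_eq_exp.1 h1.symm
    have hgk : ∀ t, g (t + k * (2 * Real.pi)) = g t + k * (2 * Real.pi) := by
      intro t
      have : Function.Periodic (fun t => g t - t) (2 * Real.pi) := fun t => by
        simp only [hgp]; ring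
      have h1 := this.int_mul k t
      linarith
    have h2 : t₀ ∈ (T.zip T').map Prod.fst := by
      rw [List.map_fst_zip hlen.le]; exact (hTm _).2 h0
    obtain ⟨p, hp, rfl⟩ := List.mem_map.1 h2
    have h3 := hgη p hp τ hτ
    have h4 := hgη p hp 0 (by simpa using hη.le)
    rw [add_zero, add_zero] at h4
    rw [hk, show p.1 + k * (2 * Real.pi) + τ = p.1 + τ + k * (2 * Real.pi) by ring, hgk, hgk,
      h3, h4]
    ring
  · intro s t hst hγst
    obtain ⟨s₀, h0, h1⟩ := hred s ⟨_, hst.symm, hγst.symm⟩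
    obtain ⟨t₀, h2, h3⟩ := hred t ⟨_, hst, hγst⟩
    rw [← δ.curveVelocity_congr (hexp.2 h1), ← δ.curveVelocity_congr (hexp.2 h3),
      ← γ.curveVelocity_congr h1, ← γ.curveVelocity_congr h3]
    rw [← h1, ← h3] at hst hγst
    have key : ∀ s ∈ P.crossingTimes, ∀ t ∈ P.crossingTimes, s < t →
        γ (Circle.exp s) = γ (Circle.exp t) →
        (0 < planeDet (curveVelocity δ (g s)) (curveVelocity δ (g t)) ↔
        0 < planeDet (curveVelocity γ s) (curveVelocity γ t)) := by
      intro s hs t ht hlt h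
      rw [← P.isNegative_iff hs.1 ht.1 hlt h, ← Q.isNegative_iff (hcross s hs).1 (hcross t ht).1
        (hgm hlt) ((heq s t).2 h), hneg s hs]
    rcases lt_trichotomy s₀ t₀ with hlt | hlt | hlt
    · exact key s₀ h0 t₀ h2 hlt hγst
    · exact absurd (congrArg _ hlt) hst
    · have h4 := key t₀ h2 s₀ h0 hlt hγst.symm
      rw [planeDet_swap (curveVelocity δ (g s₀)), planeDet_swap (curveVelocity γ s₀)] at h4
      have h5 := γ.transversal s₀ t₀ hst hγst
      have h6 := δ.transversal (g s₀) (g t₀) (fun h => hst (hexp.1 h)) ((heq _ _).2 hγst)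
      rw [neg_pos, neg_pos, ← not_le, ← not_le, not_iff_not] at h4
      exact ⟨fun h => lt_of_le_of_ne (h4.1 h.le) h5.symm,
        fun h => lt_of_le_of_ne (h4.2 h.le) h6.symm⟩

end GenericCurve
end Curves

/-! ### Framings along the core of a band -/

theorem Circle.map_nhds_mul_exp (z : Circle) (p : ℝ × ℝ) :
    map (fun q : ℝ × ℝ => (z * Circle.exp q.1, q.2)) (𝓝 p) = 𝓝 (z * Circle.exp p.1, p.2) := by
  have h1 : map (fun a : ℝ => z * Circle.exp a) (𝓝 p.1) = 𝓝 (z * Circle.exp p.1) := by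
    have : (fun a : ℝ => z * Circle.exp a) = (fun w => z * w) ∘ Circle.exp := rfl
    rw [this, ← Filter.map_map, isLocalHomeomorph_circleExp.map_nhds_eq]
    exact (Homeomorph.mulLeft z).map_nhds_eq _
  obtain ⟨a, b⟩ := p
  simp only at h1 ⊢
  rw [nhds_prod_eq, nhds_prod_eq, ← h1]
  conv_rhs => rw [← Filter.map_id (f := 𝓝 b), Filter.prod_map_map_eq]
  rfl

theorem Circle.map_nhds_mul_exp_zero (z : Circle) :
    map (fun q : ℝ × ℝ => (z * Circle.exp q.1, q.2)) (𝓝 0) = 𝓝 (z, 0) := by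
  simpa using Circle.map_nhds_mul_exp z 0

section Curves

variable {M : Type*} [TopologicalSpace M] [ChartedSpace Plane M]

/-- Read in a chart, the map `B` is strictly differentiable at the point `(z, 0)` of the annulus,
with a derivative that preserves the orientation. -/
def FramedAt (B : Circle × ℝ → M) (z : Circle) : Prop :=
  ∃ e ∈ atlas Plane M, (∀ᶠ q : ℝ × ℝ in 𝓝 0, B (z * Circle.exp q.1, q.2) ∈ e.source) ∧
    ∃ L : ℝ × ℝ →L[ℝ] Plane, 0 < planeDet (L (1, 0)) (L (0, 1)) ∧
      HasStrictFDerivAt (fun q : ℝ × ℝ => e (B (z * Circle.exp q.1, q.2))) L 0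

namespace FramedAt

variable {B B' : Circle × ℝ → M} {z : Circle}

theorem congr (h : FramedAt B z) (hB : B =ᶠ[𝓝 (z, 0)] B') : FramedAt B' z := by
  obtain ⟨e, he, hs, L, hL, hd⟩ := h
  rw [← Circle.map_nhds_mul_exp_zero] at hB
  have hB' := eventually_map.1 hB
  refine ⟨e, he, ?_, L, hL, hd.congr_of_eventuallyEq ?_⟩
  · filter_upwards [hs, hB'] with q h1 h2
    rwa [← h2]
  · filter_upwards [hB'] with q h2
    rw [h2]

/-- Transition maps have positive Jacobian, so a framing may be read in any chart around the point.
-/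
theorem exists_chart [IsManifold (𝓡 2) ∞ M] [OrientedSurface M] (h : FramedAt B z)
    {e : OpenPartialHomeomorph M Plane} (he : e ∈ atlas Plane M) (hz : B (z, 0) ∈ e.source) :
    (∀ᶠ q : ℝ × ℝ in 𝓝 0, B (z * Circle.exp q.1, q.2) ∈ e.source) ∧
    ∃ L : ℝ × ℝ →L[ℝ] Plane, 0 < planeDet (L (1, 0)) (L (0, 1)) ∧
      HasStrictFDerivAt (fun q : ℝ × ℝ => e (B (z * Circle.exp q.1, q.2))) L 0 := by
  obtain ⟨e', he', hs, L, hL, hd⟩ := h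
  have hz' : B (z, 0) ∈ e'.source := by simpa using hs.self_of_nhds
  obtain ⟨T, hT, hTd⟩ := exists_hasStrictFDerivAt_transition he' he hz' hz
  have hB0 : e' (B (z * Circle.exp (0 : ℝ × ℝ).1, (0 : ℝ × ℝ).2)) = e' (B (z, 0)) := by simp
  refine ⟨?_, T.comp L, ?_, ?_⟩
  · have h1 : ContinuousAt (fun q : ℝ × ℝ => e' (B (z * Circle.exp q.1, q.2))) 0 :=
      hd.hasFDerivAt.continuousAt
    have h2 : ∀ᶠ v in 𝓝 (e' (B (z, 0))), e'.symm v ∈ e.source := by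
      have h3 := e'.continuousAt_symm (e'.map_source hz')
      rw [ContinuousAt, e'.left_inv hz'] at h3
      exact h3.eventually (e.open_source.mem_nhds hz)
    rw [← hB0] at h2
    filter_upwards [h1.eventually h2, hs] with q h3 h4
    rwa [e'.left_inv h4] at h3
  · simp only [ContinuousLinearMap.comp_apply, Plane.det_comp]
    positivity
  · rw [← hB0] at hTd
    refine (hTd.comp 0 hd).congr_of_eventuallyEq ?_
    filter_upwards [hs] with q h4
    simp [e'.left_inv h4]

theorem of_symm {e : OpenPartialHomeomorph M Plane} (he : e ∈ atlas Plane M)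
    {G : Circle × ℝ → Plane} {L : ℝ × ℝ →L[ℝ] Plane} (hL : 0 < planeDet (L (1, 0)) (L (0, 1)))
    (hG : HasStrictFDerivAt (fun q : ℝ × ℝ => G (z * Circle.exp q.1, q.2)) L 0)
    (hz : G (z, 0) ∈ e.target) : FramedAt (fun p => e.symm (G p)) z := by
  have h1 : ∀ᶠ q : ℝ × ℝ in 𝓝 0, G (z * Circle.exp q.1, q.2) ∈ e.target :=
    hG.hasFDerivAt.continuousAt.eventually (e.open_target.mem_nhds (by simpa using hz))
  refine ⟨e, he, h1.mono fun q hq => e.map_target hq, L, hL, hG.congr_of_eventuallyEq ?_⟩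
  filter_upwards [h1] with q hq
  rw [e.right_inv hq]

theorem orientedAt (h : FramedAt B z) {t : ℝ} (ht : Circle.exp t = z) :
    OrientedAt (fun q : ℝ × ℝ => B (Circle.exp q.1, q.2)) (t, 0) := by
  obtain ⟨e, he, hs, L, hL, hd⟩ := h
  have h1 : ∀ q : ℝ × ℝ, Circle.exp q.1 = z * Circle.exp (q - (t, 0)).1 := fun q => by
    rw [← ht, ← Circle.exp_add]; simp
  have h2 : HasStrictFDerivAt (fun q : ℝ × ℝ => q - (t, 0)) (ContinuousLinearMap.id ℝ (ℝ × ℝ))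
      (t, 0) := (hasStrictFDerivAt_id _).sub_const _
  have h0 : ((t, 0) : ℝ × ℝ) - (t, 0) = 0 := sub_self _
  refine OrientedAt.of_hasStrictFDerivAt he hL ?_ ?_
  · rw [← h0] at hd
    have := HasStrictFDerivAt.comp (f := fun q : ℝ × ℝ => q - (t, 0)) (t, 0) hd h2
    rw [ContinuousLinearMap.comp_id] at this
    refine this.congr_of_eventuallyEq (Eventually.of_forall fun q => ?_)
    simp only [h1 q]
    simp
  · have h3 : Tendsto (fun q : ℝ × ℝ => q - (t, 0)) (𝓝 (t, 0)) (𝓝 0) := by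
      rw [← h0]; exact h2.hasFDerivAt.continuousAt
    filter_upwards [h3.eventually hs] with q hq
    rw [h1 q]
    simpa using hq

end FramedAt

namespace GenericCurve

/-- The immersion has injective differential, and `Circle.exp` has nonzero velocity; the latter is
seen after the inclusion into `ℂ`. -/
theorem curveVelocity_ne_zero [IsManifold (𝓡 2) ∞ M] (γ : GenericCurve M) (t : ℝ) :
    curveVelocity γ t ≠ 0 := by
  have hγ : MDifferentiableAt (𝓡 1) (𝓡 2) γ (Circle.exp t) :=
    (γ.contMDiff _).mdifferentiableAt (by simp)
  have hexp : MDifferentiableAt 𝓘(ℝ, ℝ) (𝓡 1) Circle.exp t :=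
    (contMDiff_circleExp (m := ∞) t).mdifferentiableAt (by simp)
  have : Fact (Module.finrank ℝ ℂ = 1 + 1) := finrank_real_complex_fact'
  have hcoe : MDifferentiableAt (𝓡 1) 𝓘(ℝ, ℂ) (fun z : Circle => (z : ℂ)) (Circle.exp t) :=
    (contMDiff_coe_sphere (E := ℂ) (n := 1) (m := ∞) _).mdifferentiableAt (by simp)
  have h1 : mfderiv 𝓘(ℝ, ℝ) (𝓡 1) Circle.exp t (1 : ℝ) ≠ 0 := by
    intro h0
    have h2 := mfderiv_comp (I := 𝓘(ℝ, ℝ)) (I' := 𝓡 1) (I'' := 𝓘(ℝ, ℂ)) t hcoe hexp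
    have h3 : mfderiv 𝓘(ℝ, ℝ) 𝓘(ℝ, ℂ) ((fun z : Circle => (z : ℂ)) ∘ Circle.exp) t (1 : ℝ) = 0 := by
      rw [h2]
      exact (congrArg (mfderiv (𝓡 1) 𝓘(ℝ, ℂ) (fun z : Circle => (z : ℂ)) (Circle.exp t)) h0).trans
        (ContinuousLinearMap.map_zero _)
    rw [mfderiv_eq_fderiv] at h3
    have h4 : HasDerivAt (fun s : ℝ => Complex.exp (s * Complex.I))
        (Complex.exp (t * Complex.I) * (1 * Complex.I)) t :=
      ((Complex.ofRealCLM.hasDerivAt (x := t)).mul_const Complex.I).cexp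
    have h5 : ((fun z : Circle => (z : ℂ)) ∘ Circle.exp)
        = fun s : ℝ => Complex.exp (s * Complex.I) := by
      funext s; simp
    rw [h5] at h3
    have h6 := h4.deriv
    rw [← fderiv_apply_one_eq_deriv] at h6
    have h7 := h6.symm.trans h3
    simp only [one_mul] at h7
    exact mul_ne_zero (Complex.exp_ne_zero _) Complex.I_ne_zero h7
  intro h0
  rw [curveVelocity] at h0
  have h2 := mfderiv_comp (I := 𝓘(ℝ, ℝ)) (I' := 𝓡 1) (I'' := 𝓡 2) t hγ hexp
  have h3 : mfderiv (𝓡 1) (𝓡 2) γ (Circle.exp t) (mfderiv 𝓘(ℝ, ℝ) (𝓡 1) Circle.exp t (1 : ℝ))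
      = 0 := by
    have h4 : mfderiv 𝓘(ℝ, ℝ) (𝓡 2) (γ ∘ Circle.exp) t (1 : ℝ) = 0 := h0
    rw [h2] at h4
    exact h4
  exact h1 (γ.immersion _ (h3.trans (map_zero _).symm))

/-- The sign of the crossing of the strands of the curve through `γ z` and `γ w`. -/
noncomputable def crossSign (γ : GenericCurve M) (z w : Circle) : ℝ :=
  if 0 < planeDet (curveVelocity γ (Complex.arg z)) (curveVelocity γ (Complex.arg w)) then 1 else -1

theorem crossSign_eq (γ : GenericCurve M) (z w : Circle) :
    γ.crossSign z w = 1 ∨ γ.crossSign z w = -1 := by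
  unfold crossSign; split_ifs <;> simp

theorem crossSign_exp (γ : GenericCurve M) (s t : ℝ) :
    γ.crossSign (Circle.exp s) (Circle.exp t) =
      if 0 < planeDet (curveVelocity γ s) (curveVelocity γ t) then 1 else -1 := by
  rw [crossSign, γ.curveVelocity_congr (Circle.exp_arg (Circle.exp s)),
    γ.curveVelocity_congr (Circle.exp_arg (Circle.exp t))]

theorem crossSign_swap (γ : GenericCurve M) {z w : Circle} (h : z ≠ w) (hγ : γ z = γ w) :
    γ.crossSign w z = -γ.crossSign z w := by
  obtain ⟨s, rfl⟩ := Circle.exp_surjective z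
  obtain ⟨t, rfl⟩ := Circle.exp_surjective w
  have h1 := γ.transversal s t h hγ
  rw [crossSign_exp, crossSign_exp, planeDet_swap]
  rcases lt_or_gt_of_ne h1 with h2 | h2
  · rw [if_pos (by linarith), if_neg (by linarith)]; ring
  · rw [if_neg (by linarith), if_pos (by linarith)]

theorem deriv_chart_mul (γ : GenericCurve M) (e : M → Plane) (t : ℝ) :
    deriv (fun a : ℝ => e (γ (Circle.exp t * Circle.exp a))) 0 =
      deriv (fun s : ℝ => e (γ (Circle.exp s))) t := by
  have := deriv_comp_const_add (f := fun s : ℝ => e (γ (Circle.exp s))) t 0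
  simpa [Circle.exp_add] using this

variable [IsManifold (𝓡 2) ∞ M]

theorem contDiffAt_chart_mul (γ : GenericCurve M) {e : OpenPartialHomeomorph M Plane}
    (he : e ∈ atlas Plane M) {z : Circle} (hz : γ z ∈ e.source) :
    ContDiffAt ℝ ∞ (fun a : ℝ => e (γ (z * Circle.exp a))) 0 := by
  obtain ⟨t, rfl⟩ := Circle.exp_surjective z
  have h1 := γ.contDiffAt_chart he hz
  rw [← add_zero t] at h1
  have h2 : ContDiffAt ℝ ∞ (fun a : ℝ => t + a) 0 := by fun_prop
  refine (ContDiffAt.comp (g := fun s : ℝ => e (γ (Circle.exp s))) (0 : ℝ) h1 h2).congr_of_eventuallyEq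
    (Eventually.of_forall fun a => ?_)
  simp [Circle.exp_add]

theorem hasStrictDerivAt_chart_mul (γ : GenericCurve M) {e : OpenPartialHomeomorph M Plane}
    (he : e ∈ atlas Plane M) {z : Circle} (hz : γ z ∈ e.source) :
    HasStrictDerivAt (fun a : ℝ => e (γ (z * Circle.exp a)))
      (deriv (fun a : ℝ => e (γ (z * Circle.exp a))) 0) 0 :=
  (γ.contDiffAt_chart_mul he hz).hasStrictDerivAt (by simp)

theorem eventually_planeDet_deriv_pos (γ : GenericCurve M) {e : OpenPartialHomeomorph M Plane}
    (he : e ∈ atlas Plane M) {z : Circle} (hz : γ z ∈ e.source) {v : Plane}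
    (hv : 0 < planeDet (deriv (fun a : ℝ => e (γ (z * Circle.exp a))) 0) v) :
    ∀ᶠ w in 𝓝 z, 0 < planeDet (deriv (fun a : ℝ => e (γ (w * Circle.exp a))) 0) v := by
  obtain ⟨t, rfl⟩ := Circle.exp_surjective z
  rw [← isLocalHomeomorph_circleExp.map_nhds_eq, eventually_map]
  simp only [deriv_chart_mul] at hv ⊢
  have h1 : ContinuousAt (deriv fun s : ℝ => e (γ (Circle.exp s))) t := by
    change ContinuousAt (fun x => deriv (fun s : ℝ => e (γ (Circle.exp s))) x) t
    simp only [← fderiv_apply_one_eq_deriv]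
    exact ((γ.contDiffAt_chart he hz).fderiv_right (m := 0) (by simp)).continuousAt.clm_apply
      continuousAt_const
  have h2 : Continuous fun u : Plane => planeDet u v := by unfold planeDet; fun_prop
  exact (h2.continuousAt.comp h1).eventually (lt_mem_nhds hv)

end GenericCurve
end Curves

/-! ### Construction of a band along a curve -/

section Curves

variable {M : Type*} [TopologicalSpace M] [ChartedSpace Plane M]

namespace GenericCurve

/-- Near the crossings through `γ z`, the map `B` is given by adding the two strands in the chart. -/
def CrossingAt (γ : GenericCurve M) (B : Circle × ℝ → M) (z : Circle) : Prop :=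
  ∀ w, z ≠ w → γ z = γ w → ∀ᶠ q : ℝ × ℝ in 𝓝 0, B (z * Circle.exp q.1, q.2) =
    (chartAt Plane (γ z)).symm (chartAt Plane (γ z) (γ (z * Circle.exp q.1)) +
      (chartAt Plane (γ z) (γ (w * Circle.exp (γ.crossSign z w * q.2)))
        - chartAt Plane (γ z) (γ z)))

theorem CrossingAt.congr {γ : GenericCurve M} {B B' : Circle × ℝ → M} {z : Circle}
    (h : γ.CrossingAt B z) (hB : B =ᶠ[𝓝 (z, 0)] B') : γ.CrossingAt B' z := by
  intro w hzw hγ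
  rw [← Circle.map_nhds_mul_exp_zero] at hB
  filter_upwards [h w hzw hγ, eventually_map.1 hB] with q h1 h2
  rw [← h2, h1]

/-- A band along the curve, defined by `B` over the points of `K`. -/
structure IsBandOn (γ : GenericCurve M) (K : Set Circle) (B : Circle × ℝ → M) : Prop where
  core : ∀ w, B (w, 0) = γ w
  framed : ∀ z ∈ K, FramedAt B z
  crossing : ∀ z ∈ K, γ.CrossingAt B z

theorem IsBandOn.mono {γ : GenericCurve M} {K K' : Set Circle} {B : Circle × ℝ → M}
    (h : γ.IsBandOn K' B) (hK : K ⊆ K') : γ.IsBandOn K B :=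
  ⟨h.core, fun z hz => h.framed z (hK hz), fun z hz => h.crossing z (hK hz)⟩

variable [IsManifold (𝓡 2) ∞ M]

theorem hasStrictFDerivAt_chart_add (γ : GenericCurve M) {e : OpenPartialHomeomorph M Plane}
    (he : e ∈ atlas Plane M) {z : Circle} (hz : γ z ∈ e.source) {m : ℝ → Plane} {m' : Plane}
    (hm : HasStrictDerivAt m m' 0) :
    ∃ L : ℝ × ℝ →L[ℝ] Plane, L (1, 0) = deriv (fun a : ℝ => e (γ (z * Circle.exp a))) 0 ∧
      L (0, 1) = m' ∧
      HasStrictFDerivAt (fun q : ℝ × ℝ => e (γ (z * Circle.exp q.1)) + m q.2) L 0 := by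
  have h1 := (γ.hasStrictDerivAt_chart_mul he hz).hasStrictFDerivAt
  have h2 := hm.hasStrictFDerivAt
  have h3 := HasStrictFDerivAt.comp (0 : ℝ × ℝ) (f := Prod.fst) h1 hasStrictFDerivAt_fst
  have h4 := HasStrictFDerivAt.comp (0 : ℝ × ℝ) (f := Prod.snd) h2 hasStrictFDerivAt_snd
  exact ⟨_, by simp, by simp, h3.add h4⟩

theorem framedAt_chart_add (γ : GenericCurve M) {e : OpenPartialHomeomorph M Plane}
    (he : e ∈ atlas Plane M) {z : Circle} (hz : γ z ∈ e.source) {m : ℝ → Plane} {m' : Plane}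
    (hm0 : m 0 = 0) (hm : HasStrictDerivAt m m' 0)
    (hdet : 0 < planeDet (deriv (fun a : ℝ => e (γ (z * Circle.exp a))) 0) m') :
    FramedAt (fun p : Circle × ℝ => e.symm (e (γ p.1) + m p.2)) z := by
  obtain ⟨L, h1, h2, hL⟩ := γ.hasStrictFDerivAt_chart_add he hz hm
  refine FramedAt.of_symm he (L := L) (G := fun p : Circle × ℝ => e (γ p.1) + m p.2) ?_ hL ?_
  · rwa [h1, h2]
  · simpa [hm0] using e.map_source hz

/-- The interpolation of two framed bands in a chart. -/
theorem framedAt_interpolate [OrientedSurface M] (γ : GenericCurve M) {B : Circle × ℝ → M}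
    (hcore : ∀ w, B (w, 0) = γ w) {e : OpenPartialHomeomorph M Plane}
    (he : e ∈ atlas Plane M) {z : Circle} (hB : FramedAt B z) (hz : γ z ∈ e.source)
    {m : ℝ → Plane} {m' : Plane} (hm0 : m 0 = 0) (hm : HasStrictDerivAt m m' 0)
    (hdet : 0 < planeDet (deriv (fun a : ℝ => e (γ (z * Circle.exp a))) 0) m')
    {l : Circle → ℝ} {l' : ℝ} (hl : HasStrictDerivAt (fun a : ℝ => l (z * Circle.exp a)) l' 0)
    (h0 : 0 ≤ l z) (h1 : l z ≤ 1) :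
    FramedAt (fun p : Circle × ℝ => e.symm (e (B p) + l p.1 • (e (γ p.1) + m p.2 - e (B p)))) z := by
  obtain ⟨hs, L, hL, hd⟩ := hB.exists_chart he (by rwa [hcore])
  obtain ⟨K, hK1, hK2, hK⟩ := γ.hasStrictFDerivAt_chart_add he hz hm
  have h2 := HasStrictFDerivAt.comp (0 : ℝ × ℝ) (f := Prod.fst) hl.hasStrictFDerivAt
    hasStrictFDerivAt_fst
  have h3 := hd.add (h2.smul (hK.sub hd))
  -- On the core `B` is `γ`, so the longitudinal derivatives of the two bands agree.
  have h4 : L (1, 0) = deriv (fun a : ℝ => e (γ (z * Circle.exp a))) 0 := by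
    have h5 : HasFDerivAt (fun a : ℝ => ((a, 0) : ℝ × ℝ)) (ContinuousLinearMap.inl ℝ ℝ ℝ) 0 :=
      (ContinuousLinearMap.inl ℝ ℝ ℝ).hasFDerivAt
    have h6 := HasFDerivAt.comp (0 : ℝ) (f := fun a : ℝ => ((a, 0) : ℝ × ℝ)) hd.hasFDerivAt h5
    have h7 := h6.hasDerivAt.deriv
    simp only [Function.comp_def, hcore] at h7
    rw [h7]
    simp
  refine FramedAt.of_symm he (z := z)
    (G := fun p : Circle × ℝ => e (B p) + l p.1 • (e (γ p.1) + m p.2 - e (B p))) ?_ h3 ?_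
  -- On the core both bands coincide, so the derivative of `l` contributes nothing. Only the
  -- transversal direction changes, to a convex combination of two vectors on the same side of the
  -- tangent, and the determinant stays positive.
  · have h5 : planeDet (L (1, 0)) (L (0, 1) + l z • (m' - L (0, 1))) =
        (1 - l z) * planeDet (L (1, 0)) (L (0, 1)) + l z * planeDet (L (1, 0)) m' := by
      simp [planeDet]; ring
    have h6 : 0 < planeDet (L (1, 0)) (L (0, 1) + l z • (m' - L (0, 1))) := by
      rw [h5]
      rw [h4] at hL ⊢
      rcases h0.eq_or_lt with h | h
      · rw [← h]; simpa using hL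
      · have := mul_pos h hdet
        have := mul_nonneg (sub_nonneg.2 h1) hL.le
        linarith
    convert h6 using 2
    · simp [hK1, ← h4, hcore, hm0]
    · simp [hK2, hcore, hm0]
  · simpa [hcore, hm0] using e.map_source hz

/-- A direction transversal to the strand through `z`; at a crossing, this is the other strand. -/
theorem exists_transversal (γ : GenericCurve M) (z : Circle) :
    ∃ (m : ℝ → Plane) (m' : Plane), m 0 = 0 ∧ HasStrictDerivAt m m' 0 ∧
      0 < planeDet (deriv (fun a : ℝ => chartAt Plane (γ z) (γ (z * Circle.exp a))) 0) m' ∧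
      ∀ w, z ≠ w → γ z = γ w → ∀ b, m b =
        chartAt Plane (γ z) (γ (w * Circle.exp (γ.crossSign z w * b)))
          - chartAt Plane (γ z) (γ z) := by
  obtain ⟨t, rfl⟩ := Circle.exp_surjective z
  rw [deriv_chart_mul, ← curveVelocity_eq_deriv]
  by_cases h : ∃ w, Circle.exp t ≠ w ∧ γ (Circle.exp t) = γ w
  · obtain ⟨w, hw, hγ⟩ := h
    obtain ⟨u, rfl⟩ := Circle.exp_surjective w
    set e := chartAt Plane (γ (Circle.exp t)) with he
    set σ := γ.crossSign (Circle.exp t) (Circle.exp u) with hσ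
    refine ⟨fun b => e (γ (Circle.exp u * Circle.exp (σ * b))) - e (γ (Circle.exp t)),
      σ • curveVelocity γ u, by simp [hγ], ?_, ?_, ?_⟩
    · have h1 := γ.hasStrictDerivAt_chart_mul (e := e) (chart_mem_atlas _ _) (z := Circle.exp u)
        (hγ ▸ mem_chart_source _ _)
      rw [deriv_chart_mul, he, hγ, ← curveVelocity_eq_deriv, ← hγ, ← he] at h1
      have h2 : HasStrictDerivAt (fun b : ℝ => σ * b) σ 0 := by
        simpa using (hasStrictDerivAt_id (0 : ℝ)).const_mul σ
      rw [← mul_zero σ] at h1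
      exact (h1.scomp 0 h2).sub_const _
    · have h1 := γ.transversal t u hw hγ
      have h2 : planeDet (curveVelocity γ t) (σ • curveVelocity γ u)
          = σ * planeDet (curveVelocity γ t) (curveVelocity γ u) := by
        simp [planeDet]; ring
      rw [h2, hσ, crossSign_exp]
      split_ifs with h3
      · linarith
      · have := lt_of_le_of_ne (not_lt.1 h3) h1
        linarith
    · intro w' hw' hγ' b
      rcases γ.no_triple _ _ _ hγ.symm hγ' with h1 | h1 | h1
      · exact absurd h1.symm hw
      · exact absurd h1 hw'
      · rw [← h1]
  · have h0 := γ.curveVelocity_ne_zero t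
    set v := curveVelocity γ t
    refine ⟨fun b => b • !₂[-v 1, v 0], !₂[-v 1, v 0], by simp, ?_, ?_, fun w hw hγ =>
      absurd ⟨w, hw, hγ⟩ h⟩
    · simpa using (hasStrictDerivAt_id (0 : ℝ)).smul_const !₂[-v 1, v 0]
    · have h1 : ‖v‖ ^ 2 = v 0 ^ 2 + v 1 ^ 2 := Plane.norm_sq v
      have h2 : 0 < ‖v‖ := norm_pos_iff.2 h0
      have h3 : 0 < ‖v‖ ^ 2 := by positivity
      simp [planeDet]
      nlinarith

/-- A smooth bump function on `ℂ`, restricted to the circle. It vanishes near each point outside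
`U`, not only at it, so bands remain unchanged on neighborhoods. -/
theorem _root_.Circle.exists_bump {U : Set Circle} {z : Circle} (hU : U ∈ 𝓝 z) :
    ∃ l : Circle → ℝ, (∀ w, 0 ≤ l w ∧ l w ≤ 1) ∧ (∀ᶠ w in 𝓝 z, l w = 1) ∧
      (∀ w, w ∉ U → ∀ᶠ w' in 𝓝 w, l w' = 0) ∧
      ∀ w, ∃ l', HasStrictDerivAt (fun a : ℝ => l (w * Circle.exp a)) l' 0 := by
  obtain ⟨r, hr, hrU⟩ := Metric.nhds_basis_closedBall.mem_iff.1 hU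
  let f : ContDiffBump (z : ℂ) := ⟨r / 2, r, by positivity, by linarith⟩
  refine ⟨fun w => f (w : ℂ), fun w => ⟨f.nonneg, f.le_one⟩, ?_, fun w hw => ?_, fun w => ?_⟩
  · filter_upwards [Metric.ball_mem_nhds z (show 0 < r / 2 by positivity)] with w hw
    exact f.one_of_mem_closedBall (Metric.ball_subset_closedBall hw)
  · have h1 : w ∈ (Metric.closedBall z r)ᶜ := fun h => hw (hrU h)
    filter_upwards [Metric.isClosed_closedBall.isOpen_compl.mem_nhds h1] with w' hw'
    refine f.zero_of_le_dist ?_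
    exact (not_le.1 fun h => hw' (Metric.mem_closedBall.2 h)).le
  · have h1 : ContDiff ℝ ∞ fun a : ℝ => f ((w * Circle.exp a : Circle) : ℂ) := by
      simp only [Circle.coe_mul, Circle.coe_exp]
      refine f.contDiff.comp (contDiff_const.mul (Complex.contDiff_exp.comp ?_))
      exact Complex.ofRealCLM.contDiff.mul contDiff_const
    exact ⟨_, h1.contDiffAt.hasStrictDerivAt (by simp)⟩

/-- The given band is interpolated with the local model at `z`. The neighborhood `s` does not depend
on `K` and `B`, as required for the compactness argument. -/
theorem IsBandOn.exists_extend [OrientedSurface M] (γ : GenericCurve M) (z : Circle) :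
    ∃ s ∈ 𝓝 z, ∀ (K : Set Circle) (B : Circle × ℝ → M), γ.IsBandOn K B →
      ∃ B', γ.IsBandOn (K ∪ s) B' := by
  classical
  obtain ⟨m, m', hm0, hm, hdet, hmc⟩ := γ.exists_transversal z
  set e := chartAt Plane (γ z) with he
  have heA : e ∈ atlas Plane M := chart_mem_atlas _ _
  have hze : γ z ∈ e.source := mem_chart_source _ _
  have hU1 : ∀ᶠ w in 𝓝 z, γ w ∈ e.source :=
    γ.contMDiff.continuous.continuousAt.eventually (e.open_source.mem_nhds hze)
  -- With no double point other than `z` in the modified region, the prescribed form at other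
  -- crossings is not disturbed.
  have hU2 : ∀ᶠ w in 𝓝 z, w ∈ doubleParams γ → w = z := by
    have h1 : (doubleParams γ \ {z})ᶜ ∈ 𝓝 z :=
      (γ.finite_doubleParams.sdiff.isClosed.isOpen_compl).mem_nhds (by simp)
    filter_upwards [h1] with w hw h2
    by_contra h3
    exact hw ⟨h2, h3⟩
  have hU3 := γ.eventually_planeDet_deriv_pos heA hze hdet
  obtain ⟨l, hl01, hl1, hl0, hld⟩ := Circle.exists_bump (hU1.and (hU2.and hU3))
  -- Near the points of `s` the new band is the local model itself, so nothing need be known about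
  -- `B` there.
  refine ⟨_, eventually_eventually_nhds.2 (hl1.and (hU1.and (hU2.and hU3))), fun K B hB => ?_⟩
  -- Where `l` vanishes `B` is kept literally, because its values may lie outside the chart.
  set B' : Circle × ℝ → M := fun p => if l p.1 = 0 then B p else
    e.symm (e (B p) + l p.1 • (e (γ p.1) + m p.2 - e (B p))) with hB'
  have hnear : ∀ {w : Circle} {p : Circle → Prop}, (∀ᶠ w' in 𝓝 w, p w') →
      ∀ᶠ q : Circle × ℝ in 𝓝 (w, 0), p q.1 := fun h =>
    continuousAt_fst.eventually h
  have hone : ∀ w, (∀ᶠ w' in 𝓝 w, l w' = 1) →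
      (fun p : Circle × ℝ => e.symm (e (γ p.1) + m p.2)) =ᶠ[𝓝 (w, 0)] B' := fun w hw => by
    filter_upwards [hnear hw] with q hq
    simp only [hB', hq, one_ne_zero, if_false, one_smul]
    congr 1
    abel
  have hzero : ∀ w, (∀ᶠ w' in 𝓝 w, l w' = 0) → B =ᶠ[𝓝 (w, 0)] B' := fun w hw => by
    filter_upwards [hnear hw] with q hq
    simp only [hB', hq, if_true]
  have hmem : ∀ w, ¬ (∀ᶠ w' in 𝓝 w, l w' = 0) → γ w ∈ e.source ∧ (w ∈ doubleParams γ → w = z) ∧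
      0 < planeDet (deriv (fun a : ℝ => e (γ (w * Circle.exp a))) 0) m' := fun w hw => by
    by_contra h
    exact hw (hl0 w h)
  have hcz : γ.CrossingAt B' z := by
    refine CrossingAt.congr (B := fun p : Circle × ℝ => e.symm (e (γ p.1) + m p.2)) ?_ (hone z hl1)
    intro w hw hγ
    refine Eventually.of_forall fun q => ?_
    simp only [hmc w hw hγ, ← he]
  have hvac : ∀ w, w ∉ doubleParams γ → γ.CrossingAt B' w := fun w hw u hu hγ =>
    absurd ⟨u, hu.symm, hγ.symm⟩ hw
  refine ⟨B', fun w => ?_, ?_, ?_⟩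
  · by_cases h : l w = 0
    · simp [hB', h, hB.core]
    · have h1 := (hmem w fun h1 => h h1.self_of_nhds).1
      simp [hB', h, hB.core, hm0, e.left_inv h1]
  · rintro w (hw | hw)
    · by_cases h : ∀ᶠ w' in 𝓝 w, l w' = 0
      · exact (hB.framed w hw).congr (hzero w h)
      · obtain ⟨h1, -, h2⟩ := hmem w h
        obtain ⟨l', hl'⟩ := hld w
        refine (γ.framedAt_interpolate hB.core heA (hB.framed w hw) h1 hm0 hm h2 hl' (hl01 w).1
          (hl01 w).2).congr ?_
        obtain ⟨hs, -⟩ := (hB.framed w hw).exists_chart heA (by rwa [hB.core])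
        rw [← Circle.map_nhds_mul_exp_zero]
        refine eventually_map.2 (hs.mono fun q hq => ?_)
        by_cases h3 : l (w * Circle.exp q.1) = 0
        · simp [hB', h3, e.left_inv hq]
        · simp [hB', h3]
    · have h1 := hw.self_of_nhds
      exact (γ.framedAt_chart_add heA h1.2.1 hm0 hm h1.2.2.2).congr (hone w (hw.mono fun _ h => h.1))
  · rintro w (hw | hw)
    · by_cases h : ∀ᶠ w' in 𝓝 w, l w' = 0
      · exact (hB.crossing w hw).congr (hzero w h)
      · by_cases h2 : w ∈ doubleParams γ
        · rw [(hmem w h).2.1 h2]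
          exact hcz
        · exact hvac w h2
    · have h1 := hw.self_of_nhds
      by_cases h2 : w ∈ doubleParams γ
      · rw [h1.2.2.1 h2]
        exact hcz
      · exact hvac w h2

/-- The circle is covered by finitely many of the sets `s`. The start is `K = ∅`, where only the
values on the core are required. -/
theorem exists_isBandOn [OrientedSurface M] (γ : GenericCurve M) :
    ∃ B, γ.IsBandOn univ B := by
  have key : ∀ (K : Set Circle) (B : Circle × ℝ → M), γ.IsBandOn K B →
      ∃ B', γ.IsBandOn (K ∪ univ) B' := by
    refine isCompact_univ.induction_on (p := fun s => ∀ (K : Set Circle) (B : Circle × ℝ → M),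
      γ.IsBandOn K B → ∃ B', γ.IsBandOn (K ∪ s) B') ?_ ?_ ?_ ?_
    · exact fun K B h => ⟨B, by rwa [union_empty]⟩
    · intro s t hst h K B hB
      obtain ⟨B', h'⟩ := h K B hB
      exact ⟨B', h'.mono (union_subset_union_right _ hst)⟩
    · intro s t hs ht K B hB
      obtain ⟨B', h'⟩ := hs K B hB
      obtain ⟨B'', h''⟩ := ht _ B' h'
      exact ⟨B'', by rwa [← union_assoc]⟩
    · intro z _
      obtain ⟨s, hs, h⟩ := IsBandOn.exists_extend γ z
      exact ⟨s, mem_nhdsWithin_of_mem_nhds hs, h⟩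
  obtain ⟨B, hB⟩ := key ∅ (fun p => γ p.1) ⟨fun _ => rfl, by simp, by simp⟩
  exact ⟨B, hB.mono subset_union_right⟩

end GenericCurve
end Curves

/-! ### Overlaps of a thin band -/

section Curves

variable {M : Type*} [TopologicalSpace M] [ChartedSpace Plane M]

theorem OrientedAt.map_nhds_annulus {B : Circle × ℝ → M} {t b : ℝ}
    (h : OrientedAt (fun q : ℝ × ℝ => B (Circle.exp q.1, q.2)) (t, b)) :
    map B (𝓝 (Circle.exp t, b)) = 𝓝 (B (Circle.exp t, b)) := by
  have h1 := Circle.map_nhds_mul_exp 1 (t, b)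
  simp only [one_mul] at h1
  rw [← h1, Filter.map_map]
  exact h.map_nhds_eq

theorem OrientedAt.exists_injOn_annulus {B : Circle × ℝ → M} {t b : ℝ}
    (h : OrientedAt (fun q : ℝ × ℝ => B (Circle.exp q.1, q.2)) (t, b)) :
    ∃ U ∈ 𝓝 (Circle.exp t, b), InjOn B U := by
  obtain ⟨U, hU, hUi⟩ := h.exists_injOn
  have h1 := Circle.map_nhds_mul_exp 1 (t, b)
  simp only [one_mul] at h1
  refine ⟨(fun q : ℝ × ℝ => (Circle.exp q.1, q.2)) '' U, ?_, ?_⟩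
  · rw [← h1]
    exact image_mem_map hU
  · rintro _ ⟨u, hu, rfl⟩ _ ⟨v, hv, rfl⟩ huv
    rw [hUi hu hv huv]

namespace GenericCurve

/-- The points `p` and `q` of the annulus are glued at a crossing of the band along `γ`. -/
def Glued (γ : GenericCurve M) (p q : Circle × ℝ) : Prop :=
  ∃ z w, z ≠ w ∧ γ z = γ w ∧ ∃ a : ℝ, p.1 = z * Circle.exp a ∧
    q = (w * Circle.exp (γ.crossSign z w * p.2), -(γ.crossSign z w * a))

/-- A band of half width `r` along the curve `γ`. -/
structure IsBand (γ : GenericCurve M) (r : ℝ) (B : Circle × ℝ → M) : Prop where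
  core : ∀ w, B (w, 0) = γ w
  oriented : ∀ p : Circle × ℝ, |p.2| ≤ r →
    ∃ t, Circle.exp t = p.1 ∧ OrientedAt (fun q : ℝ × ℝ => B (Circle.exp q.1, q.2)) (t, p.2)
  eq_iff : ∀ p q : Circle × ℝ, |p.2| ≤ r → |q.2| ≤ r → (B p = B q ↔ p = q ∨ γ.Glued p q)

theorem IsBand.mono {γ : GenericCurve M} {r r' : ℝ} {B : Circle × ℝ → M} (h : γ.IsBand r' B)
    (hr : r ≤ r') : γ.IsBand r B :=
  ⟨h.core, fun p hp => h.oriented p (hp.trans hr),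
    fun p q hp hq => h.eq_iff p q (hp.trans hr) (hq.trans hr)⟩

/-- Both sides are the same sum of two strands in the chart at the crossing, with the roles of the
strands exchanged. The opposite signs `crossSign z w` and `crossSign w z` turn the exchange into a
rotation by a right angle. -/
theorem IsBandOn.eventually_eq {γ : GenericCurve M} {B : Circle × ℝ → M} (h : γ.IsBandOn univ B)
    {z w : Circle} (hzw : z ≠ w) (hγ : γ z = γ w) :
    ∀ᶠ q : ℝ × ℝ in 𝓝 0, B (z * Circle.exp q.1, q.2) =
      B (w * Circle.exp (γ.crossSign z w * q.2), -(γ.crossSign z w * q.1)) := by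
  set σ := γ.crossSign z w with hσ
  have h1 := h.crossing z (mem_univ _) w hzw hγ
  have h2 := h.crossing w (mem_univ _) z hzw.symm hγ.symm
  have h3 : Tendsto (fun q : ℝ × ℝ => (σ * q.2, -(σ * q.1))) (𝓝 0) (𝓝 0) := by
    have : Continuous fun q : ℝ × ℝ => (σ * q.2, -(σ * q.1)) := by fun_prop
    simpa [Prod.zero_eq_mk] using this.tendsto 0
  filter_upwards [h1, h3.eventually h2] with q h4 h5
  rw [h4, h5, γ.crossSign_swap hzw hγ, ← hσ]
  have h6 : -σ * -(σ * q.1) = q.1 := by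
    rcases γ.crossSign_eq z w with h | h <;> rw [hσ, h] <;> ring
  simp only [h6, ← hγ]
  congr 1
  abel

variable [T2Space M]

/-- Different images are separated by the Hausdorff property, and near a single point the band is
injective. At a crossing each point near `(w, 0)` has the same image as its rotated partner near
`(z, 0)`, and injectivity near `(z, 0)` leaves no other preimage there. -/
theorem IsBandOn.eventually_glued {γ : GenericCurve M} {B : Circle × ℝ → M}
    (h : γ.IsBandOn univ B) (z w : Circle) :
    ∀ᶠ pq : (Circle × ℝ) × (Circle × ℝ) in 𝓝 ((z, 0), (w, 0)),
      B pq.1 = B pq.2 → pq.1 = pq.2 ∨ γ.Glued pq.1 pq.2 := by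
  have hor : ∀ z : Circle, ∃ t, Circle.exp t = z ∧
      OrientedAt (fun q : ℝ × ℝ => B (Circle.exp q.1, q.2)) (t, 0) := fun z => by
    obtain ⟨t, ht⟩ := Circle.exp_surjective z
    exact ⟨t, ht, (h.framed z (mem_univ _)).orientedAt ht⟩
  have hcont : ∀ z : Circle, Tendsto B (𝓝 (z, 0)) (𝓝 (γ z)) := fun z => by
    obtain ⟨t, rfl, ht⟩ := hor z
    have := ht.map_nhds_annulus
    rw [h.core] at this
    exact this.le
  have hinj : ∃ U ∈ 𝓝 (z, (0 : ℝ)), InjOn B U := by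
    obtain ⟨t, rfl, ht⟩ := hor z
    exact ht.exists_injOn_annulus
  obtain ⟨U, hU, hUi⟩ := hinj
  by_cases hγ : γ z = γ w
  swap
  · have h1 : Tendsto (fun pq : (Circle × ℝ) × (Circle × ℝ) => (B pq.1, B pq.2))
        (𝓝 ((z, 0), (w, 0))) (𝓝 (γ z, γ w)) := by
      rw [nhds_prod_eq, nhds_prod_eq (X := M)]
      exact (hcont z).prodMap (hcont w)
    have h2 := isClosed_diagonal.isOpen_compl.mem_nhds
      (show (γ z, γ w) ∈ (diagonal M)ᶜ from hγ)
    filter_upwards [h1.eventually h2] with pq h3 h4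
    exact absurd h4 h3
  by_cases hzw : z = w
  · subst hzw
    have h1 : U ×ˢ U ∈ 𝓝 ((z, (0 : ℝ)), (z, (0 : ℝ))) := prod_mem_nhds hU hU
    filter_upwards [h1] with pq h2 h3
    exact Or.inl (hUi h2.1 h2.2 h3)
  set σ := γ.crossSign z w with hσ
  have hσσ : ∀ a : ℝ, σ * (σ * a) = a := fun a => by
    rcases γ.crossSign_eq z w with h | h <;> rw [hσ, h] <;> ring
  have h1 : ∀ᶠ a : ℝ × ℝ in 𝓝 0, (z * Circle.exp (-(σ * a.2)), σ * a.1) ∈ U ∧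
      B (w * Circle.exp a.1, a.2) = B (z * Circle.exp (-(σ * a.2)), σ * a.1) := by
    have h2 : Tendsto (fun a : ℝ × ℝ => (-(σ * a.2), σ * a.1)) (𝓝 0) (𝓝 0) := by
      have : Continuous fun a : ℝ × ℝ => (-(σ * a.2), σ * a.1) := by fun_prop
      simpa [Prod.zero_eq_mk] using this.tendsto 0
    have h3 : ∀ᶠ q : ℝ × ℝ in 𝓝 0, (z * Circle.exp q.1, q.2) ∈ U := by
      rw [← Circle.map_nhds_mul_exp_zero] at hU
      exact hU
    filter_upwards [h2.eventually (h.eventually_eq hzw hγ), h2.eventually h3] with a h4 h5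
    refine ⟨h5, ?_⟩
    rw [h4, ← hσ, hσσ, mul_neg, hσσ, neg_neg]
  have h2 : ∀ᶠ q : Circle × ℝ in 𝓝 (w, 0), ∀ p ∈ U, B p = B q → γ.Glued p q := by
    rw [← Circle.map_nhds_mul_exp_zero, eventually_map]
    filter_upwards [h1] with a h3 p hp h4
    have h5 := hUi hp h3.1 (h4.trans h3.2)
    refine ⟨z, w, hzw, hγ, -(σ * a.2), by rw [h5], ?_⟩
    rw [h5, ← hσ, hσσ, mul_neg, hσσ, neg_neg]
  rw [nhds_prod_eq]
  filter_upwards [Filter.prod_mem_prod hU h2] with pq h3 h4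
  exact Or.inr (h3.2 _ h3.1 h4)

/-- The local statements hold near the core; compactness of the circle and of its square gives a
common half width. -/
theorem IsBandOn.exists_isBand {γ : GenericCurve M} {B : Circle × ℝ → M}
    (h : γ.IsBandOn univ B) : ∃ r > 0, γ.IsBand r B := by
  have h1 : ∀ᶠ b : ℝ in 𝓝 0, ∀ z ∈ (univ : Set Circle), ∃ t, Circle.exp t = z ∧
      OrientedAt (fun q : ℝ × ℝ => B (Circle.exp q.1, q.2)) (t, b) := by
    refine isCompact_univ.eventually_forall_of_forall_eventually fun z _ => ?_
    obtain ⟨t, rfl⟩ := Circle.exp_surjective z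
    have h2 := ((h.framed _ (mem_univ _)).orientedAt (t := t) rfl).eventually
    have h3 : ∀ᶠ q : Circle × ℝ in 𝓝 (Circle.exp t, 0), ∃ s, Circle.exp s = q.1 ∧
        OrientedAt (fun q : ℝ × ℝ => B (Circle.exp q.1, q.2)) (s, q.2) := by
      have h4 := Circle.map_nhds_mul_exp 1 (t, 0)
      simp only [one_mul] at h4
      rw [← h4, eventually_map]
      exact h2.mono fun q hq => ⟨q.1, rfl, hq⟩
    exact (continuous_swap.tendsto ((0 : ℝ), Circle.exp t)).eventually h3
  have h2 : ∀ᶠ b : ℝ × ℝ in 𝓝 0, ∀ z ∈ (univ : Set (Circle × Circle)),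
      B (z.1, b.1) = B (z.2, b.2) → (z.1, b.1) = (z.2, b.2) ∨ γ.Glued (z.1, b.1) (z.2, b.2) := by
    refine isCompact_univ.eventually_forall_of_forall_eventually fun z _ => ?_
    have h3 : Continuous fun x : (ℝ × ℝ) × (Circle × Circle) =>
      ((x.2.1, x.1.1), (x.2.2, x.1.2)) := by fun_prop
    exact (h3.tendsto ((0 : ℝ × ℝ), z)).eventually (h.eventually_glued z.1 z.2)
  have h3 : ∀ᶠ q : ℝ × ℝ in 𝓝 0, ∀ z ∈ doubleParams γ, ∀ w ∈ doubleParams γ, z ≠ w → γ z = γ w →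
      B (z * Circle.exp q.1, q.2) =
        B (w * Circle.exp (γ.crossSign z w * q.2), -(γ.crossSign z w * q.1)) := by
    rw [eventually_all_finite γ.finite_doubleParams]
    intro z _
    rw [eventually_all_finite γ.finite_doubleParams]
    intro w _
    by_cases hzw : z ≠ w ∧ γ z = γ w
    · exact (h.eventually_eq hzw.1 hzw.2).mono fun q hq _ _ => hq
    · exact Eventually.of_forall fun q h1 h2 => absurd ⟨h1, h2⟩ hzw
  obtain ⟨r₁, hr₁, h1⟩ := Metric.nhds_basis_closedBall.eventually_iff.1 h1
  obtain ⟨r₂, hr₂, h2⟩ := Metric.nhds_basis_closedBall.eventually_iff.1 h2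
  obtain ⟨r₃, hr₃, h3⟩ := Metric.nhds_basis_closedBall.eventually_iff.1 h3
  have hball : ∀ {r a b : ℝ}, |a| ≤ r → |b| ≤ r → ((a, b) : ℝ × ℝ) ∈ Metric.closedBall 0 r :=
    fun ha hb => by
      rw [mem_closedBall_zero_iff, Prod.norm_def]
      exact max_le ha hb
  refine ⟨min r₁ (min r₂ r₃), by positivity, h.core, fun p hp => ?_, fun p q hp hq => ?_⟩
  · exact h1 (by simpa using hp.trans (min_le_left _ _)) p.1 (mem_univ _)
  · have hp' := hp.trans (min_le_right _ _)
    have hq' := hq.trans (min_le_right _ _)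
    refine ⟨h2 (hball (hp'.trans (min_le_left _ _)) (hq'.trans (min_le_left _ _))) (p.1, q.1)
      (mem_univ _), ?_⟩
    rintro (rfl | ⟨z, w, hzw, hγ, a, ha, rfl⟩)
    · rfl
    -- Up to sign the offset `a` along one strand is the transversal coordinate of `q`, hence
    -- bounded by the half width.
    · have h4 : |a| = |-(γ.crossSign z w * a)| := by
        rcases γ.crossSign_eq z w with h | h <;> rw [h] <;> simp
      have := h3 (hball (a := a) (b := p.2) (h4.trans_le (hq'.trans (min_le_right _ _)))
        (hp'.trans (min_le_right _ _))) z ⟨w, hzw.symm, hγ.symm⟩ w ⟨z, hzw, hγ⟩ hzw hγ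
      rw [← this, ← ha]

theorem exists_isBand [IsManifold (𝓡 2) ∞ M] [OrientedSurface M] (γ : GenericCurve M) :
    ∃ B, ∃ r > 0, γ.IsBand r B := by
  obtain ⟨B, hB⟩ := γ.exists_isBandOn
  exact ⟨B, hB.exists_isBand⟩

end GenericCurve
end Curves

/-- Continuous images of a compact space with the same fibers are homeomorphic. -/
theorem exists_homeomorph_range {X Y Y' : Type*} [TopologicalSpace X] [CompactSpace X]
    [TopologicalSpace Y] [T2Space Y] [TopologicalSpace Y'] [T2Space Y'] {f : X → Y} {f' : X → Y'}
    (hf : Continuous f) (hf' : Continuous f') (h : ∀ p q, f p = f q ↔ f' p = f' q) :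
    ∃ H : range f ≃ₜ range f', ∀ (p : X) (y : range f), (y : Y) = f p → (H y : Y') = f' p := by
  have hq : IsQuotientMap (rangeFactorization f) :=
    (hf.rangeFactorization.isClosedMap).isQuotientMap hf.rangeFactorization
      rangeFactorization_surjective
  set g : range f → range f' := fun y => rangeFactorization f' y.2.choose with hg
  have hgp : ∀ p, g (rangeFactorization f p) = rangeFactorization f' p := fun p => by
    refine Subtype.ext ?_
    exact (h _ _).1 (rangeFactorization f p).2.choose_spec
  have hgc : Continuous g := by
    rw [hq.continuous_iff]
    have : g ∘ rangeFactorization f = rangeFactorization f' := funext hgp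
    rw [this]
    exact hf'.rangeFactorization
  have hb : Function.Bijective g := by
    constructor
    · intro y y' hyy
      obtain ⟨p, rfl⟩ := rangeFactorization_surjective y
      obtain ⟨p', rfl⟩ := rangeFactorization_surjective y'
      rw [hgp, hgp] at hyy
      exact Subtype.ext ((h _ _).2 (congrArg Subtype.val hyy))
    · intro y
      obtain ⟨p, rfl⟩ := rangeFactorization_surjective y
      exact ⟨_, hgp p⟩
  have hcomp : CompactSpace (range f) := isCompact_iff_compactSpace.1 (isCompact_range hf)
  refine ⟨Continuous.homeoOfEquivCompactToT2 (f := Equiv.ofBijective g hb) hgc, fun p y hy => ?_⟩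
  have : y = rangeFactorization f p := Subtype.ext hy
  rw [this]
  exact congrArg Subtype.val (hgp p)

theorem Circle.exists_disjoint_arcs {S : Set Circle} (hS : S.Finite) :
    ∃ r > 0, ∀ z ∈ S, ∀ w ∈ S, z ≠ w → ∀ a b : ℝ, |a| ≤ r → |b| ≤ r →
      z * Circle.exp a ≠ w * Circle.exp b := by
  have h1 : ∀ᶠ q : ℝ × ℝ in 𝓝 0, ∀ z ∈ S, ∀ w ∈ S, z ≠ w →
      z * Circle.exp q.1 ≠ w * Circle.exp q.2 := by
    rw [eventually_all_finite hS]
    intro z _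
    rw [eventually_all_finite hS]
    intro w _
    by_cases hzw : z = w
    · exact Eventually.of_forall fun q h => absurd hzw h
    · have hc : Continuous fun q : ℝ × ℝ => (z * Circle.exp q.1, w * Circle.exp q.2) := by
        have := Circle.exp.continuous
        fun_prop
      have h2 := isClosed_diagonal.isOpen_compl.mem_nhds (show (z, w) ∈ (diagonal Circle)ᶜ from hzw)
      have h3 : Tendsto (fun q : ℝ × ℝ => (z * Circle.exp q.1, w * Circle.exp q.2)) (𝓝 0)
          (𝓝 (z, w)) := by simpa using hc.tendsto 0
      filter_upwards [h3.eventually h2] with q h4 _ h5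
      exact h4 h5
  obtain ⟨r, hr, h⟩ := Metric.nhds_basis_closedBall.eventually_iff.1 h1
  refine ⟨r, hr, fun z hz w hw hzw a b ha hb => h (x := (a, b)) ?_ z hz w hw hzw⟩
  rw [mem_closedBall_zero_iff, Prod.norm_def]
  exact max_le ha hb

/-! ### From a matching to a homeomorphism of bands -/

section Curves

variable {M : Type*} [TopologicalSpace M] [ChartedSpace Plane M]
  {M' : Type*} [TopologicalSpace M'] [ChartedSpace Plane M']

namespace GenericCurve

theorem abs_crossSign_mul (γ : GenericCurve M) (z w : Circle) (a : ℝ) :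
    |γ.crossSign z w * a| = |a| := by
  rcases γ.crossSign_eq z w with h | h <;> rw [h] <;> simp

theorem IsBand.continuousAt {γ : GenericCurve M} {r : ℝ} {B : Circle × ℝ → M} (h : γ.IsBand r B)
    {p : Circle × ℝ} (hp : |p.2| ≤ r) : ContinuousAt B p := by
  obtain ⟨z, b⟩ := p
  obtain ⟨t, rfl, ht⟩ := h.oriented _ hp
  exact ht.map_nhds_annulus.le

theorem _root_.abs_mul_le_of_mem_annulus {p : Circle × ℝ} (hp : p ∈ annulus) {r : ℝ} (hr : 0 ≤ r) :
    |r * p.2| ≤ r := by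
  rw [abs_mul, abs_of_nonneg hr]
  exact mul_le_of_le_one_right hr (abs_le.2 hp.2)

/-- The immersed band obtained by rescaling a band of half width `r`. -/
noncomputable def IsBand.immersedBand {γ : GenericCurve M} {r : ℝ} {B : Circle × ℝ → M}
    (h : γ.IsBand r B) (hr : 0 < r) (hπ : r < Real.pi)
    (hd : ∀ z ∈ doubleParams γ, ∀ w ∈ doubleParams γ, z ≠ w → ∀ a b : ℝ, |a| ≤ r → |b| ≤ r →
      z * Circle.exp a ≠ w * Circle.exp b) : ImmersedBand γ where
  band p := B (p.1, r * p.2)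
  continuousOn p hp := by
    refine ContinuousAt.continuousWithinAt ?_
    refine ContinuousAt.comp (g := B) (f := fun p : Circle × ℝ => (p.1, r * p.2))
      (h.continuousAt (abs_mul_le_of_mem_annulus hp hr.le)) ?_
    fun_prop
  locallyInjective p hp := by
    obtain ⟨t, ht, hor⟩ := h.oriented (p.1, r * p.2) (abs_mul_le_of_mem_annulus hp hr.le)
    obtain ⟨U, hU, hUi⟩ := hor.exists_injOn_annulus
    have hc : ContinuousAt (fun p : Circle × ℝ => (p.1, r * p.2)) p := by fun_prop
    refine ⟨_, hc (by rwa [ht] at hU), fun x hx y hy hxy => ?_⟩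
    have h1 := hUi hx.1 hy.1 hxy
    simp only [Prod.mk.injEq, mul_eq_mul_left_iff, hr.ne', or_false] at h1
    exact Prod.ext h1.1 h1.2
  core z := by simp [h.core]
  ε := r
  ε_pos := hr
  ε_lt := hπ
  σ := γ.crossSign
  σ_eq := γ.crossSign_eq
  disjoint_arcs z hz w hw hzw a ha b hb := by
    refine hd z hz w hw hzw _ _ ?_ ?_
    · exact abs_mul_le_of_mem_annulus (p := (z, a)) ⟨mem_univ _, ha⟩ hr.le
    · exact abs_mul_le_of_mem_annulus (p := (z, b)) ⟨mem_univ _, hb⟩ hr.le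
  overlap p hp q hq := by
    rw [h.eq_iff _ _ (abs_mul_le_of_mem_annulus hp hr.le) (abs_mul_le_of_mem_annulus hq hr.le)]
    refine or_congr ?_ (exists_congr fun z => exists_congr fun w => and_congr_right fun _ =>
      and_congr_right fun _ => ?_)
    · simp [hr.ne', Prod.ext_iff]
    constructor
    · rintro ⟨a, ha, hqa⟩
      simp only [Prod.mk.injEq] at hqa ha
      obtain ⟨hq1, hq2⟩ := hqa
      have h1 : |a| ≤ r := by
        have := abs_mul_le_of_mem_annulus hq hr.le
        rwa [hq2, abs_neg, abs_crossSign_mul] at this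
      refine ⟨a / r, ?_, p.2, hp.2, Prod.ext ?_ rfl, Prod.ext ?_ ?_⟩
      · rw [mem_Icc, ← abs_le, abs_div, abs_of_pos hr]
        exact div_le_one_of_le₀ h1 hr.le
      · rw [ha, mul_div_cancel₀ _ hr.ne']
      · rw [hq1]
        congr 2
        ring
      · have h2 : r * q.2 = r * -(γ.crossSign z w * (a / r)) := by
          rw [hq2]; field_simp
        exact mul_left_cancel₀ hr.ne' h2
    · rintro ⟨a, -, b, -, rfl, rfl⟩
      refine ⟨r * a, rfl, Prod.ext ?_ ?_⟩
      · simp only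
        congr 2
        ring
      · simp only
        ring

theorem IsBand.image_mem_nhds {γ : GenericCurve M} {r : ℝ} {B : Circle × ℝ → M}
    (h : γ.IsBand r B) (hr : 0 < r) (z : Circle) :
    (fun p : Circle × ℝ => B (p.1, r * p.2)) '' annulus ∈ 𝓝 (γ z) := by
  obtain ⟨t, ht, hor⟩ := h.oriented (z, 0) (by simpa using hr.le)
  have h1 := hor.map_nhds_annulus
  simp only at ht
  simp only [ht, h.core] at h1
  have h2 : {p : Circle × ℝ | |p.2| < r} ∈ 𝓝 (z, (0 : ℝ)) := by
    have : Continuous fun p : Circle × ℝ => |p.2| := by fun_prop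
    exact this.continuousAt.eventually (gt_mem_nhds (by simpa using hr))
  have h3 := image_mem_map (m := B) h2
  rw [h1] at h3
  refine mem_of_superset h3 ?_
  rintro _ ⟨p, hp, rfl⟩
  refine ⟨(p.1, p.2 / r), ⟨mem_univ _, ?_⟩, ?_⟩
  · simp only
    rw [mem_Icc, ← abs_le, abs_div, abs_of_pos hr]
    exact div_le_one_of_le₀ (le_of_lt hp) hr.le
  · simp only
    rw [mul_div_cancel₀ _ hr.ne']

namespace Matching

variable {γ : GenericCurve M} {δ : GenericCurve M'} (G : Matching γ δ)

theorem surjective : Function.Surjective G.toFun := by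
  intro c
  have hk : ∀ (k : ℤ), G.toFun (k * (2 * Real.pi)) = G.toFun 0 + k * (2 * Real.pi) := by
    intro k
    have : Function.Periodic (fun t => G.toFun t - t) (2 * Real.pi) := fun t => by
      simp only [G.add_two_pi]; ring
    have h1 := this.int_mul k 0
    simp only [zero_add, sub_zero] at h1
    linarith
  have hp := Real.two_pi_pos
  refine mem_range_of_exists_le_of_exists_ge G.continuous ?_ ?_
  · obtain ⟨k, hk'⟩ := exists_int_lt ((c - G.toFun 0) / (2 * Real.pi))
    refine ⟨k * (2 * Real.pi), ?_⟩
    rw [lt_div_iff₀ hp] at hk'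
    rw [hk]; linarith
  · obtain ⟨k, hk'⟩ := exists_int_gt ((c - G.toFun 0) / (2 * Real.pi))
    refine ⟨k * (2 * Real.pi), ?_⟩
    rw [div_lt_iff₀ hp] at hk'
    rw [hk]; linarith

theorem exists_homeomorph : ∃ φ : Circle ≃ₜ Circle, ∀ t, φ (Circle.exp t) = Circle.exp (G.toFun t) := by
  set φ : Circle → Circle := fun z => Circle.exp (G.toFun (Complex.arg z)) with hφ
  have hexp : ∀ t, φ (Circle.exp t) = Circle.exp (G.toFun t) := fun t =>
    (exp_eq_exp_iff_of_quasiperiodic G.strictMono G.add_two_pi).2 (Circle.exp_arg _)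
  have hq : IsQuotientMap Circle.exp :=
    isLocalHomeomorph_circleExp.isOpenMap.isQuotientMap Circle.exp.continuous Circle.exp_surjective
  have hc : Continuous φ := by
    rw [hq.continuous_iff, show φ ∘ Circle.exp = fun t => Circle.exp (G.toFun t) from funext hexp]
    exact Circle.exp.continuous.comp G.continuous
  have hb : Function.Bijective φ := by
    constructor
    · intro z w h
      obtain ⟨s, rfl⟩ := Circle.exp_surjective z
      obtain ⟨t, rfl⟩ := Circle.exp_surjective w
      rw [hexp, hexp] at h
      exact (exp_eq_exp_iff_of_quasiperiodic G.strictMono G.add_two_pi).1 h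
    · intro w
      obtain ⟨t, rfl⟩ := Circle.exp_surjective w
      obtain ⟨s, rfl⟩ := G.surjective t
      exact ⟨_, hexp s⟩
  exact ⟨Continuous.homeoOfEquivCompactToT2 (f := Equiv.ofBijective φ hb) hc, hexp⟩

variable {φ : Circle ≃ₜ Circle}

theorem circle_eq_iff (hφ : ∀ t, φ (Circle.exp t) = Circle.exp (G.toFun t))
    (z w : Circle) : δ (φ z) = δ (φ w) ↔ γ z = γ w := by
  obtain ⟨s, rfl⟩ := Circle.exp_surjective z
  obtain ⟨t, rfl⟩ := Circle.exp_surjective w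
  rw [hφ, hφ, G.eq_iff]

theorem crossSign_eq (hφ : ∀ t, φ (Circle.exp t) = Circle.exp (G.toFun t))
    {z w : Circle} (hzw : z ≠ w) (hγ : γ z = γ w) :
    δ.crossSign (φ z) (φ w) = γ.crossSign z w := by
  obtain ⟨s, rfl⟩ := Circle.exp_surjective z
  obtain ⟨t, rfl⟩ := Circle.exp_surjective w
  rw [hφ, hφ, crossSign_exp, crossSign_exp]
  simp only [G.det_iff s t hzw hγ]

theorem apply_mul_exp (hφ : ∀ t, φ (Circle.exp t) = Circle.exp (G.toFun t))
    {z : Circle} (hz : z ∈ doubleParams γ) {a : ℝ} (ha : |a| ≤ G.η) :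
    φ (z * Circle.exp a) = φ z * Circle.exp a := by
  obtain ⟨s, rfl⟩ := Circle.exp_surjective z
  rw [← Circle.exp_add, hφ, hφ, G.translation s hz a ha, Circle.exp_add]

/-- Gluing exchanges, up to sign, the offset along one strand with the transversal coordinate of the
other. Since `(z, b) ↦ (φ z, b)` fixes transversal coordinates, compatibility requires `φ` to be a
translation near the double points. The offsets involved have absolute values `|p.2|` and `|q.2|`,
hence at most `G.η`. -/
theorem glued_iff (hφ : ∀ t, φ (Circle.exp t) = Circle.exp (G.toFun t))
    {p q : Circle × ℝ} (hp : |p.2| ≤ G.η) (hq : |q.2| ≤ G.η) :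
    δ.Glued (φ p.1, p.2) (φ q.1, q.2) ↔ γ.Glued p q := by
  have key : ∀ z w : Circle, z ≠ w → γ z = γ w → ∀ a : ℝ,
      ((φ p.1 = φ z * Circle.exp a ∧ ((φ q.1, q.2) : Circle × ℝ) =
        (φ w * Circle.exp (δ.crossSign (φ z) (φ w) * p.2), -(δ.crossSign (φ z) (φ w) * a))) ↔
      (p.1 = z * Circle.exp a ∧
        q = (w * Circle.exp (γ.crossSign z w * p.2), -(γ.crossSign z w * a)))) := by
    intro z w hzw hγ a
    rw [G.crossSign_eq hφ hzw hγ, ← G.apply_mul_exp hφ (z := w) ⟨z, hzw, hγ⟩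
      (by rwa [abs_crossSign_mul])]
    have h2 : q.2 = -(γ.crossSign z w * a) → (φ p.1 = φ z * Circle.exp a ↔
        p.1 = z * Circle.exp a) := fun h => by
      rw [h, abs_neg, abs_crossSign_mul] at hq
      rw [← G.apply_mul_exp hφ ⟨w, hzw.symm, hγ.symm⟩ hq, φ.injective.eq_iff]
    rw [Prod.mk.injEq, Prod.ext_iff, φ.injective.eq_iff]
    constructor
    · rintro ⟨h3, h4, h5⟩
      exact ⟨(h2 h5).1 h3, h4, h5⟩
    · rintro ⟨h3, h4, h5⟩
      exact ⟨(h2 h5).2 h3, h4, h5⟩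
  constructor
  · rintro ⟨z', w', hzw, hδ, a, h⟩
    obtain ⟨z, rfl⟩ := φ.surjective z'
    obtain ⟨w, rfl⟩ := φ.surjective w'
    have h1 : z ≠ w := fun h => hzw (by rw [h])
    have h2 := (G.circle_eq_iff hφ z w).1 hδ
    exact ⟨z, w, h1, h2, a, (key z w h1 h2 a).1 h⟩
  · rintro ⟨z, w, hzw, hγ, a, h⟩
    exact ⟨φ z, φ w, φ.injective.ne hzw, (G.circle_eq_iff hφ z w).2 hγ, a, (key z w hzw hγ a).2 h⟩

theorem band_eq_iff (hφ : ∀ t, φ (Circle.exp t) = Circle.exp (G.toFun t))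
    {r : ℝ} (hr : r ≤ G.η) {B : Circle × ℝ → M} {B' : Circle × ℝ → M'}
    (hB : γ.IsBand r B) (hB' : δ.IsBand r B') {p q : Circle × ℝ} (hp : |p.2| ≤ r)
    (hq : |q.2| ≤ r) : B p = B q ↔ B' (φ p.1, p.2) = B' (φ q.1, q.2) := by
  rw [hB.eq_iff p q hp hq, hB'.eq_iff (φ p.1, p.2) (φ q.1, q.2) hp hq, G.glued_iff hφ (hp.trans hr) (hq.trans hr),
    Prod.ext_iff, Prod.ext_iff (x := (φ p.1, p.2)), φ.injective.eq_iff]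

end Matching
end GenericCurve
end Curves

section Curves

variable {M : Type*} [TopologicalSpace M] [ChartedSpace Plane M] [T2Space M]
  [IsManifold (𝓡 2) ∞ M] [OrientedSurface M]
  {M' : Type*} [TopologicalSpace M'] [ChartedSpace Plane M'] [T2Space M']
  [IsManifold (𝓡 2) ∞ M'] [OrientedSurface M']

namespace GenericCurve

/-- The two bands identify corresponding pairs of points of the annulus, so their images are
homeomorphic quotients of it. -/
theorem Matching.stablyHomeomorphic {γ : GenericCurve M} {δ : GenericCurve M'}
    (G : Matching γ δ) : StablyHomeomorphic γ δ := by
  obtain ⟨B, r₁, hr₁, hB⟩ := γ.exists_isBand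
  obtain ⟨B', r₂, hr₂, hB'⟩ := δ.exists_isBand
  obtain ⟨r₃, hr₃, hd⟩ := Circle.exists_disjoint_arcs γ.finite_doubleParams
  obtain ⟨r₄, hr₄, hd'⟩ := Circle.exists_disjoint_arcs δ.finite_doubleParams
  obtain ⟨φ, hφ⟩ := G.exists_homeomorph
  obtain ⟨R, hR, hR₁, hR₂, hRη⟩ : ∃ R > 0, R ≤ r₁ ∧ R ≤ r₂ ∧ R ≤ G.η :=
    ⟨min r₁ (min r₂ G.η), lt_min hr₁ (lt_min hr₂ G.η_pos), min_le_left _ _,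
      (min_le_right _ _).trans (min_le_left _ _), (min_le_right _ _).trans (min_le_right _ _)⟩
  -- The half width `r` is strictly below `R`: an interior point of the neighborhood may be
  -- represented by a boundary point of the annulus, and its parameter neighborhood then leaves the
  -- annulus.
  obtain ⟨r, hr, hrR, hr₃', hr₄', hrπ⟩ : ∃ r > 0, r < R ∧ r ≤ r₃ ∧ r ≤ r₄ ∧ r < Real.pi := by
    have h1 : 0 < min (min R r₃) (min r₄ Real.pi) :=
      lt_min (lt_min hR hr₃) (lt_min hr₄ Real.pi_pos)
    refine ⟨min (min R r₃) (min r₄ Real.pi) / 2, half_pos h1, ?_, ?_, ?_, ?_⟩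
    · exact (half_lt_self h1).trans_le ((min_le_left _ _).trans (min_le_left _ _))
    · exact (half_le_self h1.le).trans ((min_le_left _ _).trans (min_le_right _ _))
    · exact (half_le_self h1.le).trans ((min_le_right _ _).trans (min_le_left _ _))
    · exact (half_lt_self h1).trans_le ((min_le_right _ _).trans (min_le_right _ _))
  replace hB := hB.mono hR₁
  replace hB' := hB'.mono hR₂
  set b : ImmersedBand γ := (hB.mono hrR.le).immersedBand hr hrπ fun z hz w hw hzw x y hx hy =>
    hd z hz w hw hzw x y (hx.trans hr₃') (hy.trans hr₃') with hb
  set b' : ImmersedBand δ := (hB'.mono hrR.le).immersedBand hr hrπ fun z hz w hw hzw x y hx hy =>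
    hd' z hz w hw hzw x y (hx.trans hr₄') (hy.trans hr₄') with hb'
  have hbp : ∀ p, b.band p = B (p.1, r * p.2) := fun p => rfl
  have hbp' : ∀ p, b'.band p = B' (p.1, r * p.2) := fun p => rfl
  have hann : ∀ p : annulus, |r * p.1.2| ≤ r := fun p => abs_mul_le_of_mem_annulus p.2 hr.le
  have hΦ : ∀ p : Circle × ℝ, p ∈ annulus → (φ p.1, p.2) ∈ annulus := fun p hp =>
    ⟨mem_univ _, hp.2⟩
  set f : annulus → M := fun p => b.band p with hf
  set f' : annulus → M' := fun p => b'.band (φ p.1.1, p.1.2) with hf'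
  have hcomp : CompactSpace annulus :=
    isCompact_iff_compactSpace.1 (isCompact_univ.prod isCompact_Icc)
  have hfc : Continuous f := continuousOn_iff_continuous_domRestrict.1 b.continuousOn
  have hfc' : Continuous f' := by
    have h1 : Continuous fun p : annulus => ((φ p.1.1, p.1.2) : Circle × ℝ) := by fun_prop
    exact b'.continuousOn.comp_continuous h1 fun p => hΦ _ p.2
  have hff : ∀ p q, f p = f q ↔ f' p = f' q := fun p q => by
    simp only [hf, hf', hbp, hbp']
    exact G.band_eq_iff hφ hRη hB hB' ((hann p).trans hrR.le) ((hann q).trans hrR.le)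
  obtain ⟨h, hh⟩ := exists_homeomorph_range hfc hfc' hff
  have hrange : b.band '' annulus = range f := by
    ext x; simp [hf]
  have hrange' : b'.band '' annulus = range f' := by
    ext x
    constructor
    · rintro ⟨p, hp, rfl⟩
      exact ⟨⟨(φ.symm p.1, p.2), ⟨mem_univ _, hp.2⟩⟩, by simp [hf']⟩
    · rintro ⟨p, rfl⟩
      exact ⟨_, hΦ _ p.2, rfl⟩
  refine ⟨range f, range f', ⟨fun z => ?_, b, hrange⟩, ⟨fun z => ?_, b', hrange'⟩, h, ?_, φ,
    ⟨G.toFun, G.continuous, G.strictMono.monotone, hφ⟩, fun z y hy => ?_⟩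
  · rw [← hrange]
    exact (hB.mono hrR.le).image_mem_nhds hr z
  · rw [← hrange']
    exact (hB'.mono hrR.le).image_mem_nhds hr z
  · intro x hx
    obtain ⟨p, hp⟩ := x.2
    have hpR : |r * p.1.2| ≤ R := (hann p).trans hrR.le
    have hhx := hh p x hp.symm
    obtain ⟨t, ht, hor⟩ := hB.oriented (p.1.1, r * p.1.2) hpR
    obtain ⟨t', ht', hor'⟩ := hB'.oriented (φ p.1.1, r * p.1.2) hpR
    simp only at ht ht' hor hor'
    rw [← ht, hφ, Circle.exp_eq_exp] at ht'
    obtain ⟨k, hk⟩ := ht'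
    -- In band coordinates the homeomorphism is `G` times the identity; the shift by `k` turns
    -- selects the lift at which `B'` is known to be oriented.
    refine winding_of_orientedAt h x hx (F := fun q : ℝ × ℝ => B (Circle.exp q.1, q.2))
      (F' := fun q : ℝ × ℝ => B' (Circle.exp q.1, q.2)) (p := (t, r * p.1.2))
      (Φ := fun q => (G.toFun q.1 + k * (2 * Real.pi), q.2)) hor ?_ ?_ ?_ ?_ ?_ ?_
    · rw [← hp, hf]
      simp only [ht, hbp]
    · simp only [← hk]
      exact hor'
    · rw [hhx]
      simp only [Circle.exp_add_int_mul, ← hφ, ht, hf', hbp']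
    · have := G.continuous
      fun_prop
    · intro q hq
      simp only
      rcases eq_or_ne q.1 t with h1 | h1
      · have h2 : q.2 - r * p.1.2 ≠ 0 := fun h2 => hq (Prod.ext h1 (sub_eq_zero.1 h2))
        have := mul_self_pos.2 h2
        rw [h1]
        linarith
      · have h2 : 0 < (q.1 - t) * (G.toFun q.1 - G.toFun t) := by
          rcases lt_or_gt_of_ne h1 with h3 | h3
          · exact mul_pos_of_neg_of_neg (sub_neg.2 h3) (sub_neg.2 (G.strictMono h3))
          · exact mul_pos (sub_pos.2 h3) (sub_pos.2 (G.strictMono h3))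
        nlinarith [mul_self_nonneg (q.2 - r * p.1.2)]
    · have h1 : ∀ᶠ q : ℝ × ℝ in 𝓝 (t, r * p.1.2), |q.2| < R := by
        have : Continuous fun q : ℝ × ℝ => |q.2| := by fun_prop
        exact this.continuousAt.eventually (gt_mem_nhds ((hann p).trans_lt hrR))
      filter_upwards [h1] with q hq y hy
      obtain ⟨p', hp'⟩ := y.2
      rw [hh p' y hp'.symm]
      simp only [Circle.exp_add_int_mul, ← hφ, hf', hbp']
      refine (G.band_eq_iff hφ hRη hB hB' (p := (p'.1.1, r * p'.1.2)) (q := (Circle.exp q.1, q.2))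
        ((hann p').trans hrR.le) hq.le).1 ?_
      rw [← hy, ← hp']
      rfl
  · have h1 := hh ⟨(z, 0), mem_univ _, by simp⟩ y (by rw [hy]; exact (b.core z).symm)
    rw [h1]
    exact b'.core (φ z)

end GenericCurve
end Curves

theorem mainTheorem3 {F : Type*} [Field F]
    {M : Type*} [TopologicalSpace M] [T2Space M] [CompactSpace M]
    [ChartedSpace Plane M] [IsManifold (𝓡 2) ∞ M] [OrientedSurface M]
    {M' : Type*} [TopologicalSpace M'] [T2Space M'] [CompactSpace M']
    [ChartedSpace Plane M'] [IsManifold (𝓡 2) ∞ M'] [OrientedSurface M']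
    (γ : GenericCurve M) (δ : GenericCurve M') (P : γ.Labelling) (Q : δ.Labelling) :
    StablyHomeomorphic γ δ ↔
      ∀ v : CyclicInvariant F, v.IsFiniteType → v P.word = v Q.word := by
  rw [← CyclicInvariant.cyclicEquiv_iff_forall_isFiniteType]
  refine ⟨fun h => h.cyclicEquiv P Q, fun h => ?_⟩
  -- Another base point and labelling of `γ` make the two words equal, not merely equivalent.
  obtain ⟨P', hP'⟩ := P.exists_word_eq_of_cyclicEquiv h
  obtain ⟨G⟩ := P'.exists_matching Q hP'
  exact G.stablyHomeomorphic
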